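/- **Notation.** Work over the field $\mathbb C(t)$. Let $\mathbf x=(x_1,x_2,\dots)$, $\mathbf y=(y_1,y_2,\dots)$, $\tilde\partial_{\mathbf x}=(\partial_{x_1},\tfrac12\partial_{x_2},\tfrac13\partial_{x_3},\dots)$ and similarly $\tilde\partial_{\mathbf y}$. Put $\xi_t(\mathbf x,z)=\sum_{n\ge1}(1-t^n)x_nz^n$, $\xi=\xi_0$, and define $q_n(\mathbf x)$ by $\sum_{n\ge0}q_n(\mathbf x)z^n=e^{\xi_t(\mathbf x,z)}$, with $q_n=0$ for $n<0$. For Young diagrams $\lambda,\mu$ let $$Q_\lambda(\mathbf x)=\prod_{i<j}\frac{1-R_{ij}}{1-tR_{ij}}\,q_{\lambda}(\mathbf x),\qquad P_\lambda=b_\lambda(t)^{-1}Q_\lambda,\qquad b_\lambda(t)=\prod_{i\ge1}\prod_{j=1}^{m_i(\lambda)}(1-t^j),$$ $$Q_{[\lambda,\mu]}(\mathbf x,\mathbf y)=\prod_{i<j}\frac{1-R_{\lambda_i\lambda_j}}{1-tR_{\lambda_i\lambda_j}}\prod_{a<b}\frac{1-R_{\mu_a\mu_b}}{1-tR_{\mu_a\mu_b}}\prod_{i,a}\frac{(1-D_{\lambda_i\mu_a})(1-t^2D_{\lambda_i\mu_a})}{(1-tD_{\lambda_i\mu_a})^2}\;q_\lambda(\mathbf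 x)q_\mu(\mathbf y),$$ where $q_\lambda=\prod_iq_{\lambda_i}$, $m_i(\lambda)$ is the number of parts of $\lambda$ equal to $i$, the raising operator $R_{ij}$ adds $1$ to the $i$-th and subtracts $1$ from the $j$-th index, and $D_{\lambda_i\mu_a}$ subtracts $1$ from $\lambda_i$ and from $\mu_a$. The scalar product on $\mathbb C(t)[\mathbf x]$ is the bilinear form with $(P_\lambda,Q_\mu)=\delta_{\lambda\mu}$, and $q_k^\perp(\mathbf x)$ is the adjoint of multiplication by $q_k(\mathbf x)$. Let $\Lambda_M$ be the span of the $Q_\lambda(\mathbf x)$ with at most $M$ columns. For an operator $S$ on $\mathbb C(t)[\mathbf x]$, the operators $S(\mathbf x-\tilde\partial_{\mathbf y})$ and $S(\mathbf y-\tilde\partial_{\mathbf x})$ on $\mathbb C(t)[\mathbf x,\mathbf y]$ are defined by $$S(\mathbf x-\tilde\partial_{\mathbf y})\,f(\mathbf x-\tilde\partial_{\mathbf y})g(\mathbf y-\tilde\partial_{\mathbf x})\cdot1=(Sf)(\mathbf x-\tilde\partial_{\mathbf y})g(\mathbf y-\tilde\partial_{\mathbf x})\cdot1,$$ $$S(\mathbf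 y-\tilde\partial_{\mathbf x})\,f(\mathbf x-\tilde\partial_{\mathbf y})g(\mathbf y-\tilde\partial_{\mathbf x})\cdot1=f(\mathbf x-\tilde\partial_{\mathbf y})(Sg)(\mathbf y-\tilde\partial_{\mathbf x})\cdot1$$ for all polynomials $f,g$ in one family of variables. Put $H_M^\perp(\mathbf x,z)=\sum_{k=0}^Mz^kq_k^\perp(\mathbf x)$. The vertex operators are $$\Gamma_1^-(z)=e^{\xi_t(\mathbf x-\tilde\partial_{\mathbf y},z)},\quad\Gamma_1^+(z)=e^{\xi(\tilde\partial_{\mathbf x},z^{-1})},\quad\Gamma_2^-(z)=e^{\xi_t(\mathbf y-\tilde\partial_{\mathbf x},z)},\quad\Gamma_2^+(z)=e^{\xi(\tilde\partial_{\mathbf y},z^{-1})}.$$ **The model.** For integers $M_1,M_2\ge0$ let $\hat{\mathcal F}=\bigotimes_{i=1}^{M_1}\mathcal F_i^{(1)}\otimes\bigotimes_{i=1}^{M_2}\mathcal F_i^{(2)}$ be the tensor product of copies of the $q$-boson Fock space with $q=t$: a copy has basis $|n\rangle$, $n\ge0$, with $B^\dagger|n\rangle=|n+1\rangle$, $B|n\rangle=\frac{1-t^n}{1-t}|n-1\rangle$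 for $n\ge1$, and $B|0\rangle=0$. For $s=1,2$ let $$\begin{pmatrix}A_s(u)&B_s(u)\\C_s(u)&D_s(u)\end{pmatrix}=L^{(s)}_{M_s}(u)\cdots L_1^{(s)}(u)L_0^{(s)}(u),\qquad L_i^{(s)}(u)=\begin{pmatrix}u^{-1}&B_i^{(s)\dagger}\\(1-t)B_i^{(s)}&u\end{pmatrix}\ (i\ge1),$$ with a formal scalar parameter $u$, where the zero-energy space is forgotten, i.e. $B_0^{(s)\dagger}$ and $(1-t)B_0^{(s)}$ are replaced by $1$ in $L_0^{(s)}(u)$. Put $\tilde B_s(u)=u^{M_s}B_s(u)$, $\tilde C_s(u)=u^{-M_s}C_s(u)$. Let $\jmath:\hat{\mathcal F}\to\mathbb C(t)[\mathbf x,\mathbf y]$ be the linear map $\bigotimes_i|n_i\rangle_i^{(1)}\otimes\bigotimes_i|m_i\rangle_i^{(2)}\mapsto Q_{[\lambda,\mu]}(\mathbf x,\mathbf y)$, $\lambda=1^{n_1}2^{n_2}\cdots$, $\mu=1^{m_1}2^{m_2}\cdots$. **Statement.** (0) The scalar product and the adjoints $q_k^\perp(\mathbf x)$ exist and are unique; $q_k^\perp(\mathbf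 x)$ maps each $\Lambda_M$ to itself; the operators $q_k^\perp(\mathbf x-\tilde\partial_{\mathbf y})$ and $q_k^\perp(\mathbf y-\tilde\partial_{\mathbf x})$ exist and are unique; $\jmath$ is injective, and its image is the span $\mathbb C(t)_{M_1,M_2}[\mathbf x,\mathbf y]$ of the $Q_{[\lambda,\mu]}$ with $\lambda$ having at most $M_1$ and $\mu$ at most $M_2$ columns. (1) For all $M_1,M_2$, under the identification $\jmath$ of $\hat{\mathcal F}$ with $\mathbb C(t)_{M_1,M_2}[\mathbf x,\mathbf y]$, $$\tilde C_1(u)=H^\perp_{M_1}(\mathbf x-\tilde\partial_{\mathbf y},u^{-2}),\qquad\tilde C_2(u)=H^\perp_{M_2}(\mathbf y-\tilde\partial_{\mathbf x},u^{-2}).$$ (2) In the limit $M_1,M_2\to\infty$, $$\tilde B_1(u)\to\Gamma_1^-(u^2),\quad\tilde C_1(u)\to\Gamma_1^+(u^2),\quad\tilde B_2(u)\to\Gamma_2^-(u^2),\quad\tilde C_2(u)\to\Gamma_2^+(u^2),$$ in the following sense: for every $f\in\mathbb C(t)[\mathbf x,\mathbf y]$ and every $n\in\mathbb Z$, for all sufficiently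 large $M_1,M_2$ one has $f\in\mathbb C(t)_{M_1,M_2}[\mathbf x,\mathbf y]$, and the coefficient of $u^n$ in the operator on the left, applied to $f$, equals the coefficient of $u^n$ in the operator on the right, applied to $f$. -/

import Mathlib

open scoped LaurentPolynomial

namespace CoupledHL

noncomputable section

/-! ### Scalars, variables, generating series -/

/-- The field `ℂ(t)`. -/
abbrev K : Type := RatFunc ℂ

/-- The deformation parameter `t`; it is also the parameter `q` of the `q`-boson algebra. -/
def tParam : K := RatFunc.X

/-- The algebra `ℂ(t)[x₁, x₂, …]` of polynomials in one family of variables. -/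
abbrev PolyOne : Type := MvPolynomial ℕ+ K

/-- The algebra `ℂ(t)[𝐱, 𝐲]`: `Sum.inl n` is the index of `xₙ`, `Sum.inr n` that of `yₙ`. -/
abbrev PolyTwo : Type := MvPolynomial (ℕ+ ⊕ ℕ+) K

/-- The formal series `ξ_τ(a, z) = ∑_{n ≥ 1} (1 - τⁿ) aₙ zⁿ`, with coefficients in any
(possibly noncommutative) `ℂ(t)`-algebra. -/
def xiSeries {A : Type*} [Ring A] [Algebra K A] (τ : K) (a : ℕ+ → A) : PowerSeries A :=
  PowerSeries.mk fun n => if h : 0 < n then (1 - τ ^ n) • a ⟨n, h⟩ else 0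

/-- The exponential `∑ⱼ Fʲ / j!` of a formal power series `F` without constant term (for such `F`
only the powers `j ≤ n` contribute to the coefficient of `zⁿ`). -/
def expSeries {A : Type*} [Ring A] [Algebra K A] (F : PowerSeries A) : PowerSeries A :=
  PowerSeries.mk fun n =>
    ∑ j ∈ Finset.range (n + 1), ((j.factorial : K)⁻¹) • PowerSeries.coeff n (F ^ j)

/-- The polynomials `qₙ(𝐱)`, defined by `∑ₙ qₙ(𝐱) zⁿ = exp ξ_t(𝐱, z)`. -/
def qPoly (n : ℕ) : PolyOne :=
  PowerSeries.coeff n (expSeries (xiSeries tParam fun m => (MvPolynomial.X m : PolyOne)))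

/-- `qₙ(𝐱)` for all integers `n`, with `qₙ = 0` for `n < 0`. -/
def qInt (n : ℤ) : PolyOne := if 0 ≤ n then qPoly n.toNat else 0

/-! ### Hall-Littlewood functions and coupled Hall-Littlewood functions -/

/-- The coefficient of `Rᵏ` in the expansion of `(1 - R) / (1 - t R)`. -/
def raiseCoeff (k : ℕ) : K :=
  PowerSeries.coeff k
    (((1 : PowerSeries K) - PowerSeries.X) * (1 - PowerSeries.C tParam * PowerSeries.X)⁻¹)

/-- The coefficient of `Dᵏ` in the expansion of `(1 - D) (1 - t² D) / (1 - t D)²`. -/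
def lowerCoeff (k : ℕ) : K :=
  PowerSeries.coeff k
    (((1 : PowerSeries K) - PowerSeries.X) * (1 - PowerSeries.C tParam * PowerSeries.X)⁻¹ *
      ((1 - PowerSeries.C (tParam ^ 2) * PowerSeries.X) *
        (1 - PowerSeries.C tParam * PowerSeries.X)⁻¹))

/-- Exponents `(e_{ij})_{i<j}` of a monomial `∏_{i<j} R_{ij}^{e_{ij}}` in the raising operators. -/
abbrev RaiseExp (l : ℕ) : Type := {p : Fin l × Fin l // p.1 < p.2} → ℕ

/-- The `i`-th entry of the integer vector obtained from `lam` by applying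
`∏_{i<j} R_{ij}^{e_{ij}}`, where `R_{ij}` adds `1` to entry `i` and subtracts `1` from entry `j`. -/
def raised (lam : List ℕ) (e : RaiseExp lam.length) (i : Fin lam.length) : ℤ :=
  (lam.get i : ℤ) + ∑ p, (if p.1.1 = i then (e p : ℤ) else 0)
    - ∑ p, (if p.1.2 = i then (e p : ℤ) else 0)

/-- The Hall-Littlewood function
`Q_λ(𝐱) = ∏_{i<j} (1 - R_{ij}) / (1 - t R_{ij}) q_λ(𝐱)`, expanded in the raising operators; only
finitely many terms are nonzero, because `qₙ = 0` for `n < 0`. -/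
def hallQ (lam : YoungDiagram) : PolyOne :=
  ∑ᶠ e : RaiseExp lam.rowLens.length,
    (∏ p, raiseCoeff (e p)) • ∏ i, qInt (raised lam.rowLens e i)

/-- `b_λ(t) = ∏_{i ≥ 1} (1 - t)(1 - t²) ⋯ (1 - t^{mᵢ})`, where `mᵢ` is the number of parts of `λ`
equal to `i`. -/
def bNorm (lam : YoungDiagram) : K :=
  ∏ i ∈ lam.rowLens.toFinset, ∏ j ∈ Finset.range (lam.rowLens.count i), (1 - tParam ^ (j + 1))

/-- The Hall-Littlewood function `P_λ(𝐱) = b_λ(t)⁻¹ Q_λ(𝐱)`. -/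
def hallP (lam : YoungDiagram) : PolyOne := (bNorm lam)⁻¹ • hallQ lam

/-- The coupled Hall-Littlewood function `Q_{[λ,μ]}(𝐱,𝐲)`, that is
`∏_{i<j} (1-R_{λᵢλⱼ})/(1-tR_{λᵢλⱼ}) ∏_{a<b} (1-R_{μₐμ_b})/(1-tR_{μₐμ_b})
∏_{i,a} (1-D_{λᵢμₐ})(1-t²D_{λᵢμₐ})/(1-tD_{λᵢμₐ})²` applied to
`q_{[λ,μ]} = q_λ(𝐱) q_μ(𝐲)`, where `D_{λᵢμₐ}` subtracts `1` from `λᵢ` and from `μₐ`. The sum over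
the exponents `(e, f, d)` of the monomials in these operators has finitely many nonzero terms. -/
def coupledQ (lam mu : YoungDiagram) : PolyTwo :=
  ∑ᶠ w : RaiseExp lam.rowLens.length × RaiseExp mu.rowLens.length ×
      (Fin lam.rowLens.length × Fin mu.rowLens.length → ℕ),
    ((∏ p, raiseCoeff (w.1 p)) * (∏ p, raiseCoeff (w.2.1 p)) * (∏ p, lowerCoeff (w.2.2 p))) •
      ((∏ i, MvPolynomial.rename Sum.inl
          (qInt (raised lam.rowLens w.1 i - ∑ a, (w.2.2 (i, a) : ℤ)))) *
        (∏ a, MvPolynomial.rename Sum.inr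
          (qInt (raised mu.rowLens w.2.1 a - ∑ i, (w.2.2 (i, a) : ℤ)))))

/-- The space `Λ_M` spanned by the `Q_λ(𝐱)` whose diagrams have at most `M` columns. -/
def hallSpan (M : ℕ) : Submodule K PolyOne :=
  Submodule.span K {f | ∃ lam : YoungDiagram, lam.rowLen 0 ≤ M ∧ f = hallQ lam}

/-- The space `ℂ(t)_{M₁,M₂}[𝐱,𝐲]` spanned by the `Q_{[λ,μ]}(𝐱,𝐲)` such that `λ` has at most `M₁`
columns and `μ` has at most `M₂` columns. -/
def coupledSpan (M₁ M₂ : ℕ) : Submodule K PolyTwo :=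
  Submodule.span K {f | ∃ lam mu : YoungDiagram,
    lam.rowLen 0 ≤ M₁ ∧ mu.rowLen 0 ≤ M₂ ∧ f = coupledQ lam mu}

/-- `s` is the Hall-Littlewood scalar product: `(P_λ, Q_μ) = δ_{λμ}`. -/
def IsHallForm (s : LinearMap.BilinForm K PolyOne) : Prop :=
  ∀ lam mu : YoungDiagram,
    (lam = mu → s (hallP lam) (hallQ mu) = 1) ∧ (lam ≠ mu → s (hallP lam) (hallQ mu) = 0)

/-- `S` is adjoint, with respect to `s`, to the operator of multiplication by `q_k(𝐱)`. -/
def IsPerp (s : LinearMap.BilinForm K PolyOne) (k : ℕ) (S : Module.End K PolyOne) : Prop :=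
  ∀ f g : PolyOne, s (qPoly k * f) g = s f (S g)

/-! ### Differential operators and vertex operators -/

/-- The operator `∂̃_v` with `v = xₙ` or `v = yₙ`, i.e. `(1/n) ∂/∂xₙ` or `(1/n) ∂/∂yₙ`, where
`v n` is the index of the variable. -/
def dTilde (v : ℕ+ → ℕ+ ⊕ ℕ+) (n : ℕ+) : Module.End K PolyTwo :=
  ((n : ℕ) : K)⁻¹ • (MvPolynomial.pderiv (v n) : Derivation K PolyTwo PolyTwo).toLinearMap

/-- Multiplication by the `n`-th variable of the family `v`. -/
def mulVar (v : ℕ+ → ℕ+ ⊕ ℕ+) (n : ℕ+) : Module.End K PolyTwo :=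
  LinearMap.mulLeft K (MvPolynomial.X (v n) : PolyTwo)

/-- The operators `xₙ - (1/n) ∂/∂yₙ`, the components of `𝐱 - ∂̃_𝐲`. -/
def xShift (n : ℕ+) : Module.End K PolyTwo := mulVar Sum.inl n - dTilde Sum.inr n

/-- The operators `yₙ - (1/n) ∂/∂xₙ`, the components of `𝐲 - ∂̃_𝐱`. -/
def yShift (n : ℕ+) : Module.End K PolyTwo := mulVar Sum.inr n - dTilde Sum.inl n

theorem shift_comm (v w : ℕ+ → ℕ+ ⊕ ℕ+) (h : ∀ n m, v n ≠ w m) (n m : ℕ+) :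
    (mulVar v n - dTilde w n) * (mulVar v m - dTilde w m) =
      (mulVar v m - dTilde w m) * (mulVar v n - dTilde w n) := by
  have hX : ∀ n m, MvPolynomial.pderiv (w n) (MvPolynomial.X (v m) : PolyTwo) = 0 := fun n m =>
    MvPolynomial.pderiv_X_of_ne (h m n)
  have hD : ∀ (i j : ℕ+ ⊕ ℕ+) (f : PolyTwo),
      MvPolynomial.pderiv i (MvPolynomial.pderiv j f) =
        MvPolynomial.pderiv j (MvPolynomial.pderiv i f) := by
    intro i j f
    have key : ⁅(MvPolynomial.pderiv i : Derivation K PolyTwo PolyTwo),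
        (MvPolynomial.pderiv j : Derivation K PolyTwo PolyTwo)⁆ = 0 := by
      apply MvPolynomial.derivation_ext
      intro a
      rw [Derivation.commutator_apply]
      simp only [MvPolynomial.pderiv_X, Pi.single_apply]
      split_ifs <;> simp
    have := congrArg (fun D : Derivation K PolyTwo PolyTwo => D f) key
    simpa [Derivation.commutator_apply, sub_eq_zero] using this
  refine LinearMap.ext fun f => ?_
  simp [mulVar, dTilde, hX, MvPolynomial.smul_eq_C_mul, hD (w n) (w m)]
  ring

open scoped IsMulCommutative in
/-- Evaluation of a polynomial in `x₁, x₂, …` at pairwise commuting elements `a₁, a₂, …` of an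
algebra. -/
def commEval {A : Type*} [Ring A] [Algebra K A] (a : ℕ+ → A)
    (h : ∀ n m, a n * a m = a m * a n) : PolyOne →ₐ[K] A :=
  haveI : IsMulCommutative (Algebra.adjoin K (Set.range a)) :=
    Algebra.isMulCommutative_adjoin K (by rintro _ ⟨n, rfl⟩ _ ⟨m, rfl⟩; exact h n m)
  (Algebra.adjoin K (Set.range a)).val.comp
    (MvPolynomial.aeval (R := K) fun n =>
      (⟨a n, Algebra.subset_adjoin ⟨n, rfl⟩⟩ : Algebra.adjoin K (Set.range a)))

open scoped IsMulCommutative in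
theorem commEval_X {A : Type*} [Ring A] [Algebra K A] (a : ℕ+ → A)
    (h : ∀ n m, a n * a m = a m * a n) (n : ℕ+) :
    commEval a h (MvPolynomial.X n) = a n := by
  simp [commEval]

/-- The operator `f(𝐱 - ∂̃_𝐲)` on `ℂ(t)[𝐱,𝐲]`, for a polynomial `f`. -/
def atX : PolyOne →ₐ[K] Module.End K PolyTwo :=
  commEval xShift (shift_comm _ _ fun _ _ => Sum.inl_ne_inr)

/-- The operator `g(𝐲 - ∂̃_𝐱)` on `ℂ(t)[𝐱,𝐲]`, for a polynomial `g`. -/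
def atY : PolyOne →ₐ[K] Module.End K PolyTwo :=
  commEval yShift (shift_comm _ _ fun _ _ => Sum.inr_ne_inl)

/-- `U` is the operator `S(𝐱 - ∂̃_𝐲)` obtained from an operator `S` on polynomials in `𝐱` by
replacing `𝐱` with `𝐱 - ∂̃_𝐲`:
`U (f(𝐱 - ∂̃_𝐲) g(𝐲 - ∂̃_𝐱) · 1) = (S f)(𝐱 - ∂̃_𝐲) g(𝐲 - ∂̃_𝐱) · 1`. When `S` is multiplication by
a polynomial `p`, this is `p(𝐱 - ∂̃_𝐲)`. -/
def IsSubstX (S : Module.End K PolyOne) (U : Module.End K PolyTwo) : Prop :=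
  ∀ f g : PolyOne, U (atX f (atY g 1)) = atX (S f) (atY g 1)

/-- `U` is the operator `S(𝐲 - ∂̃_𝐱)`:
`U (f(𝐱 - ∂̃_𝐲) g(𝐲 - ∂̃_𝐱) · 1) = f(𝐱 - ∂̃_𝐲) (S g)(𝐲 - ∂̃_𝐱) · 1`. -/
def IsSubstY (S : Module.End K PolyOne) (U : Module.End K PolyTwo) : Prop :=
  ∀ f g : PolyOne, U (atX f (atY g 1)) = atX f (atY (S g) 1)

/-- `Γ₁⁻(z) = exp ξ_t(𝐱 - ∂̃_𝐲, z)`, a power series in `z` with operator coefficients. -/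
def gammaMinus₁ : PowerSeries (Module.End K PolyTwo) := expSeries (xiSeries tParam xShift)

/-- `Γ₂⁻(z) = exp ξ_t(𝐲 - ∂̃_𝐱, z)`, a power series in `z`. -/
def gammaMinus₂ : PowerSeries (Module.End K PolyTwo) := expSeries (xiSeries tParam yShift)

/-- `Γ₁⁺(z) = exp ξ(∂̃_𝐱, z⁻¹)`, as a power series in `z⁻¹`; here `ξ = ξ₀`. -/
def gammaPlus₁ : PowerSeries (Module.End K PolyTwo) := expSeries (xiSeries 0 (dTilde Sum.inl))

/-- `Γ₂⁺(z) = exp ξ(∂̃_𝐲, z⁻¹)`, as a power series in `z⁻¹`. -/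
def gammaPlus₂ : PowerSeries (Module.End K PolyTwo) := expSeries (xiSeries 0 (dTilde Sum.inr))

/-- The coefficient of `uⁿ` (`n ∈ ℤ`) in `F(uᵈ)`, for a power series `F` and an integer `d ≠ 0`. -/
def coeffAtPow {A : Type*} [Ring A] (F : PowerSeries A) (d n : ℤ) : A :=
  if d ∣ n ∧ 0 ≤ n / d then PowerSeries.coeff (n / d).toNat F else 0

/-- The truncated operator-valued sum `H_M(z) = ∑_{k=0}^{M} zᵏ U_k` at `z = u⁻²`. -/
def truncSum (U : ℕ → Module.End K PolyTwo) (M : ℕ) : (Module.End K PolyTwo)[T;T⁻¹] :=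
  ∑ k ∈ Finset.range (M + 1), LaurentPolynomial.T (-2 * (k : ℤ)) * LaurentPolynomial.C (U k)

/-! ### The two-site `q`-boson model -/

/-- The Fock space `⊗_{i ∈ ι} 𝓕ᵢ` of copies of the `q`-boson Fock space: its basis consists of the
vectors `⊗ᵢ |nᵢ⟩ᵢ`, indexed by the occupation numbers `n : ι → ℕ`. -/
abbrev Fock (ι : Type) : Type := (ι → ℕ) →₀ K

/-- The creation operator `Bᵢ†`: `|nᵢ⟩ ↦ |nᵢ + 1⟩`. -/
def creat {ι : Type} [DecidableEq ι] (i : ι) : Module.End K (Fock ι) :=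
  Finsupp.linearCombination K fun n : ι → ℕ =>
    (Finsupp.single (Function.update n i (n i + 1)) 1 : Fock ι)

/-- The `q`-number `[n] = (1 - qⁿ) / (1 - q)` at `q = t`. -/
def qNumber (n : ℕ) : K := (1 - tParam ^ n) / (1 - tParam)

/-- The annihilation operator `Bᵢ`: `|nᵢ⟩ ↦ [nᵢ] |nᵢ - 1⟩`, and `|0⟩ ↦ 0`. -/
def annih {ι : Type} [DecidableEq ι] (i : ι) : Module.End K (Fock ι) :=
  Finsupp.linearCombination K fun n : ι → ℕ =>
    (Finsupp.single (Function.update n i (n i - 1)) (qNumber (n i)) : Fock ι)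

/-- The matrix with rows `(u⁻¹, up)` and `(dn, u)`; the `L`-matrix of a site has `up = B†` and
`dn = (1 - q) B`. The spectral parameter `u` is the variable of the Laurent polynomials, whose
coefficients are operators. -/
def lMatrix {A : Type*} [Ring A] (up dn : A) : Matrix (Fin 2) (Fin 2) A[T;T⁻¹] :=
  !![LaurentPolynomial.T (-1), LaurentPolynomial.C up;
     LaurentPolynomial.C dn, LaurentPolynomial.T 1]

/-- The monodromy matrix `L_M(u) ⋯ L₁(u) L₀(u)` of a chain after the zero-energy space has been
forgotten: `Bᵢ†`, `Bᵢ` for `1 ≤ i ≤ M` are the operators of the site `site (i - 1)`, and both `B₀†`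
and `(1 - q) B₀` are replaced by the identity in `L₀(u)`. -/
def monodromy {ι : Type} [DecidableEq ι] (M : ℕ) (site : Fin M → ι) :
    Matrix (Fin 2) (Fin 2) (Module.End K (Fock ι))[T;T⁻¹] :=
  ((List.ofFn fun i : Fin M =>
      lMatrix (creat (site i)) ((1 - tParam) • annih (site i))).reverse).prod * lMatrix 1 1

/-- The space `𝓕̂ = ⊗_{i=1}^{M₁} 𝓕ᵢ⁽¹⁾ ⊗ ⊗_{i=1}^{M₂} 𝓕ᵢ⁽²⁾`. -/
abbrev TwoFock (M₁ M₂ : ℕ) : Type := Fock (Fin M₁ ⊕ Fin M₂)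

/-- The monodromy matrix `T₁(u)`, with entries `A₁, B₁; C₁, D₁`. -/
def monodromy₁ (M₁ M₂ : ℕ) : Matrix (Fin 2) (Fin 2) (Module.End K (TwoFock M₁ M₂))[T;T⁻¹] :=
  monodromy M₁ Sum.inl

/-- The monodromy matrix `T₂(u)`, with entries `A₂, B₂; C₂, D₂`. -/
def monodromy₂ (M₁ M₂ : ℕ) : Matrix (Fin 2) (Fin 2) (Module.End K (TwoFock M₁ M₂))[T;T⁻¹] :=
  monodromy M₂ Sum.inr

/-- `B̃₁(u) = u^{M₁} B₁(u)`. -/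
def bTilde₁ (M₁ M₂ : ℕ) : (Module.End K (TwoFock M₁ M₂))[T;T⁻¹] :=
  LaurentPolynomial.T (M₁ : ℤ) * monodromy₁ M₁ M₂ 0 1

/-- `B̃₂(u) = u^{M₂} B₂(u)`. -/
def bTilde₂ (M₁ M₂ : ℕ) : (Module.End K (TwoFock M₁ M₂))[T;T⁻¹] :=
  LaurentPolynomial.T (M₂ : ℤ) * monodromy₂ M₁ M₂ 0 1

/-- `C̃₁(u) = u^{-M₁} C₁(u)`. -/
def cTilde₁ (M₁ M₂ : ℕ) : (Module.End K (TwoFock M₁ M₂))[T;T⁻¹] :=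
  LaurentPolynomial.T (-(M₁ : ℤ)) * monodromy₁ M₁ M₂ 1 0

/-- `C̃₂(u) = u^{-M₂} C₂(u)`. -/
def cTilde₂ (M₁ M₂ : ℕ) : (Module.End K (TwoFock M₁ M₂))[T;T⁻¹] :=
  LaurentPolynomial.T (-(M₂ : ℤ)) * monodromy₂ M₁ M₂ 1 0

/-- The Young diagram `1^{n₁} 2^{n₂} ⋯ M^{n_M}`; `n i` is the number of rows of length `i + 1`. -/
def diagramOf {M : ℕ} (n : Fin M → ℕ) : YoungDiagram :=
  YoungDiagram.ofRowLens ((∑ i, n i • {(i : ℕ) + 1} : Multiset ℕ).sort (· ≥ ·))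
    (Multiset.pairwise_sort _ _).sortedGE

/-- The map `ȷ`: the basis vector with occupation numbers `n⁽¹⁾`, `n⁽²⁾` goes to `Q_{[λ,μ]}(𝐱,𝐲)`
with `λ = 1^{n₁⁽¹⁾} 2^{n₂⁽¹⁾} ⋯` and `μ = 1^{n₁⁽²⁾} 2^{n₂⁽²⁾} ⋯`. -/
def jmath (M₁ M₂ : ℕ) : TwoFock M₁ M₂ →ₗ[K] PolyTwo :=
  Finsupp.linearCombination K fun n : Fin M₁ ⊕ Fin M₂ → ℕ =>
    coupledQ (diagramOf fun i => n (Sum.inl i)) (diagramOf fun i => n (Sum.inr i))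

/-- Under the identification `ȷ`, the operator-valued Laurent polynomial `𝒜` on `𝓕̂` acts as the
operator-valued Laurent polynomial `ℋ` on `ℂ(t)[𝐱,𝐲]`. -/
def ActsAs {M₁ M₂ : ℕ} (𝒜 : (Module.End K (TwoFock M₁ M₂))[T;T⁻¹])
    (ℋ : (Module.End K PolyTwo)[T;T⁻¹]) : Prop :=
  ∀ (v : TwoFock M₁ M₂) (n : ℤ), jmath M₁ M₂ (𝒜.coeff n v) = ℋ.coeff n (jmath M₁ M₂ v)

/-- The operators `𝒜_{M₁,M₂}(u)` converge to the formal series `∑ₙ G n uⁿ` of operators on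
`ℂ(t)[𝐱,𝐲]` as `M₁, M₂ → ∞`: for every `f` and every `n`, as soon as `M₁` and `M₂` are large
enough, `f` belongs to the image of `ȷ` and, under the identification `ȷ`, the coefficient of `uⁿ`
in `𝒜_{M₁,M₂}(u) f` is `G n f`. -/
def LimitIs (𝒜 : ∀ M₁ M₂ : ℕ, (Module.End K (TwoFock M₁ M₂))[T;T⁻¹])
    (G : ℤ → Module.End K PolyTwo) : Prop :=
  ∀ (f : PolyTwo) (n : ℤ), ∃ N : ℕ, ∀ M₁ M₂ : ℕ, N ≤ M₁ → N ≤ M₂ →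
    ∃ v : TwoFock M₁ M₂, jmath M₁ M₂ v = f ∧ jmath M₁ M₂ ((𝒜 M₁ M₂).coeff n v) = G n f

end

end CoupledHL

open CoupledHL

/-! Everything reduces to one chain and one family of variables. The map F ↦ F(x − ∂̃_y, y − ∂̃_x)·1
is a linear automorphism of ℂ(t)[x,y] (`twistEquiv`) that commutes with all derivatives. Normal
ordering of q_n(x − ∂̃_y) against q_m(y) produces exactly the factor (1−D)(1−t²D)/(1−tD)², so
Q_{[λ,μ]} is the image of Q_λ ⊗ Q_μ (`coupledQ_eq`). The operators S(x − ∂̃_y) and S(y − ∂̃_x) are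
the transports of S ⊗ 1 and 1 ⊗ S (`rhoX`, `rhoY`), and the four vertex operators Γ are transports
of multiplication by q(z) = ∑ q_k zᵏ and of D⁺(w) = exp ξ(∂̃, w).

For one family, Q_λ = H_{λ₁} H_{λ₂} ⋯ 1 (`vecQ_get`), where the vertex operators H_n satisfy a
quadratic exchange relation (`hOp_relation`). It yields D⁺ H_nʳ = H_nʳ D⁺ + (1 − tʳ) H_nʳ⁻¹ E_n,
which has the shape of the q-boson rule for (1−t)B (B†)ʳ. Induction on the number m of sites then
identifies C̃ with D⁺ and the entry A, normalised, with E_{m+1} (`lower_intertwine`). The companion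
identity (`upper_intertwine`) says that multiplication by q(z) is B̃ plus a correction ∑ zʲ
H_{m+1+j} applied to the lower right entry D of the monodromy matrix. For the full chain of M sites,
the correction adds a row longer than M.

The rest follows from these two identities. The top coefficient of C̃ is the annihilation operator
of the last site, which makes the map from the Fock space injective, so the Q_λ are independent. The
identity for q(z) shows that their span is stable under multiplication by every q_k, so they form a
basis. B̃ and C̃ are adjoint, and the correction is orthogonal to functions with at most M columns,
hence q_k^⊥ is the coefficient of wᵏ in D⁺ (`isPerp_dPlus`). Thus (1) holds exactly, with truncation
at M because C̃ has degree M in u⁻². In (2) the limits of C̃ are immediate, and those of B̃ hold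
because D, applied to a vector whose far sites are empty, is divisible by a high power of the
spectral variable (`upper_eq_of_lt`). -/

namespace CoupledHL

noncomputable section

open PowerSeries

/-! ### The Euler operator and exponential series -/

section Euler

variable {A : Type*} [Ring A]

/-- The Euler operator `z d/dz` on formal power series over a possibly noncommutative ring. -/
def eul : PowerSeries A →+ PowerSeries A where
  toFun F := PowerSeries.mk fun n => n • coeff n F
  map_zero' := by ext; simp
  map_add' F G := by ext; simp

@[simp] theorem coeff_eul (F : PowerSeries A) (n : ℕ) : coeff n (eul F) = n • coeff n F := by
  simp [eul]

theorem eul_mul (F G : PowerSeries A) : eul (F * G) = eul F * G + F * eul G := by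
  ext n
  simp only [coeff_eul, coeff_mul, map_add, Finset.smul_sum, ← Finset.sum_add_distrib]
  refine Finset.sum_congr rfl fun p hp => ?_
  rw [← Finset.HasAntidiagonal.mem_antidiagonal.1 hp, add_smul, smul_mul_assoc, mul_smul_comm]

theorem eul_C (a : A) : eul (C a) = 0 := by
  ext n
  rcases n with _ | n <;> simp [coeff_C]

theorem eul_one : eul (1 : PowerSeries A) = 0 := by simpa using eul_C (1 : A)

theorem eul_C_mul (a : A) (F : PowerSeries A) : eul (C a * F) = C a * eul F := by
  rw [eul_mul, eul_C, zero_mul, zero_add]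

theorem eul_mul_C (a : A) (F : PowerSeries A) : eul (F * C a) = eul F * C a := by
  rw [eul_mul, eul_C, mul_zero, add_zero]

theorem eul_X_pow (n : ℕ) : eul (X ^ n : PowerSeries A) = n • X ^ n := by
  ext m
  by_cases h : m = n
  · subst h; rw [coeff_eul, map_nsmul]
  · rw [coeff_eul, map_nsmul, coeff_X_pow, if_neg h]; simp

theorem eul_map {B : Type*} [Ring B] (f : A →+* B) (F : PowerSeries A) :
    eul (PowerSeries.map f F) = PowerSeries.map f (eul F) := by
  ext n; simp

/-- A solution of the equation `z Z' = G Z` with vanishing constant term vanishes. -/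
theorem eq_zero_of_eul_eq [Algebra K A] {G Z : PowerSeries A} (hG : coeff 0 G = 0)
    (hZ : coeff 0 Z = 0) (h : eul Z = G * Z) : Z = 0 := by
  ext n
  induction n using Nat.strong_induction_on with
  | _ n ih =>
    rcases Nat.eq_zero_or_pos n with rfl | hn
    · simpa using hZ
    have h1 : n • coeff n Z = 0 := by
      rw [← coeff_eul, h, coeff_mul]
      refine Finset.sum_eq_zero fun p hp => ?_
      have hp' := Finset.HasAntidiagonal.mem_antidiagonal.1 hp
      rcases Nat.eq_zero_or_pos p.1 with h0 | h0
      · rw [h0, hG, zero_mul]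
      · rw [ih p.2 (by omega)]; simp
    have h2 : ((n : ℕ) : K) • coeff n Z = 0 := by
      rw [← h1, Nat.cast_smul_eq_nsmul]
    have h3 : ((n : ℕ) : K) ≠ 0 := Nat.cast_ne_zero.2 hn.ne'
    simpa using (smul_eq_zero_iff_right h3).1 h2

/-- The uniqueness principle by which exponentials are compared: it is enough to match constant
terms and logarithmic derivatives. -/
theorem eq_of_eul_eq [Algebra K A] {G Y Z : PowerSeries A} (hG : coeff 0 G = 0)
    (h0 : coeff 0 Y = coeff 0 Z) (hY : eul Y = G * Y) (hZ : eul Z = G * Z) : Y = Z := by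
  rw [← sub_eq_zero]
  refine eq_zero_of_eul_eq hG (by rw [map_sub, h0, sub_self]) ?_
  rw [map_sub, hY, hZ, mul_sub]

end Euler

/-- The series `∑_{n ≥ 1} κₙ aₙ zⁿ`. -/
def linSeries {A : Type*} [Ring A] [Algebra K A] (κ : ℕ → K) (a : ℕ+ → A) : PowerSeries A :=
  PowerSeries.mk fun n => if h : 0 < n then κ n • a ⟨n, h⟩ else 0

section Exp

variable {A : Type*} [Ring A] [Algebra K A]

theorem xiSeries_eq_linSeries (τ : K) (a : ℕ+ → A) :
    xiSeries τ a = linSeries (fun n => 1 - τ ^ n) a := rfl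

@[simp] theorem coeff_zero_linSeries (κ : ℕ → K) (a : ℕ+ → A) :
    coeff 0 (linSeries κ a) = 0 := by simp [linSeries]

theorem coeff_linSeries (κ : ℕ → K) (a : ℕ+ → A) (n : ℕ+) :
    coeff (n : ℕ) (linSeries κ a) = κ n • a n := by
  rw [linSeries, coeff_mk, dif_pos n.pos]
  rfl

theorem map_linSeries {B : Type*} [Ring B] [Algebra K B] (f : A →ₐ[K] B) (κ : ℕ → K)
    (a : ℕ+ → A) :
    PowerSeries.map (f : A →+* B) (linSeries κ a) = linSeries κ fun n => f (a n) := by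
  ext n
  by_cases h : 0 < n <;> simp [linSeries, h]

theorem map_expSeries {B : Type*} [Ring B] [Algebra K B] (f : A →ₐ[K] B) (F : PowerSeries A) :
    PowerSeries.map (f : A →+* B) (expSeries F) =
      expSeries (PowerSeries.map (f : A →+* B) F) := by
  ext n
  simp only [expSeries, coeff_map, coeff_mk, map_sum, ← map_pow]
  refine Finset.sum_congr rfl fun j _ => ?_
  simp

theorem coeff_zero_expSeries (F : PowerSeries A) : coeff 0 (expSeries F) = 1 := by
  simp [expSeries]

@[simp] theorem constantCoeff_expSeries (F : PowerSeries A) :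
    constantCoeff (expSeries F) = 1 := by
  rw [← coeff_zero_eq_constantCoeff_apply, coeff_zero_expSeries]

end Exp

theorem coeff_pow_of_lt {A : Type*} [Ring A] {F : PowerSeries A} (hF : coeff 0 F = 0) {n j : ℕ} (h : n < j) :
    coeff n (F ^ j) = 0 := by
  have hX : X ∣ F := PowerSeries.X_dvd_iff.2 (by simpa using hF)
  obtain ⟨G, rfl⟩ := hX
  have : ∀ j : ℕ, (X * G) ^ j = X ^ j * G ^ j := fun j => (PowerSeries.commute_X G).symm.mul_pow j
  rw [this, PowerSeries.coeff_X_pow_mul', if_neg (by omega)]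

/-- The partial sums S_N of the exponential satisfy z S_{N+1}' = (z F') S_N, and the coefficient of
zⁿ sees only the powers Fʲ with j ≤ n. Commutativity enters through the derivative of Fʲ. -/
theorem eul_expSeries_comm {A : Type*} [CommRing A] [Algebra K A] {F : PowerSeries A}
    (hF : coeff 0 F = 0) : eul (expSeries F) = eul F * expSeries F := by
  have hpow : ∀ j : ℕ, eul (F ^ (j + 1)) = (j + 1) • (eul F * F ^ j) := by
    intro j
    induction j with
    | zero => simp
    | succ j ih => rw [pow_succ, eul_mul, ih, pow_succ F j]; simp only [nsmul_eq_mul]; push_cast; ring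
  let S : ℕ → PowerSeries A := fun N =>
    ∑ j ∈ Finset.range N, ((j.factorial : K)⁻¹) • F ^ j
  have hS : ∀ n N, n < N → coeff n (expSeries F) = coeff n (S N) := by
    intro n N h
    simp only [expSeries, coeff_mk, S, map_sum, coeff_smul]
    refine Finset.sum_subset (fun a ha => ?_) fun j _ hj => ?_
    · simp only [Finset.mem_range] at ha ⊢; omega
    · rw [coeff_pow_of_lt hF (by simpa using hj), smul_zero]
  have heul : ∀ N, eul (S (N + 1)) = eul F * S N := by
    intro N
    simp only [S]
    rw [Finset.sum_range_succ', map_add, map_sum, Finset.mul_sum]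
    have h0 : eul (((Nat.factorial 0 : ℕ) : K)⁻¹ • F ^ 0) = 0 := by
      simp [eul_one]
    rw [h0, add_zero]
    refine Finset.sum_congr rfl fun j _ => ?_
    have hs : ∀ (c : K) (G : PowerSeries A), eul (c • G) = c • eul G := by
      intro c G; ext n; simp [smul_comm]
    rw [hs, hpow, ← Nat.cast_smul_eq_nsmul K, smul_smul, mul_smul_comm]
    congr 1
    have h1 : ((j : K) + 1) ≠ 0 := by exact_mod_cast Nat.succ_ne_zero j
    have h2 : ((j.factorial : ℕ) : K) ≠ 0 := Nat.cast_ne_zero.2 j.factorial_ne_zero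
    rw [Nat.factorial_succ]
    push_cast
    field_simp
  ext n
  rw [coeff_eul, hS n (n + 1 + 1) (by omega), ← coeff_eul, heul, coeff_mul, coeff_mul]
  refine Finset.sum_congr rfl fun p hp => ?_
  have := Finset.HasAntidiagonal.mem_antidiagonal.1 hp
  rw [hS p.2 (n + 1) (by omega)]

/-- Pairwise commuting operators are images of variables under an algebra homomorphism, so facts
about their exponentials descend from the commutative polynomial ring. -/
theorem linSeries_eq_map {A : Type*} [Ring A] [Algebra K A] (κ : ℕ → K) (a : ℕ+ → A)
    (h : ∀ n m, a n * a m = a m * a n) :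
    linSeries κ a = PowerSeries.map (commEval a h : PolyOne →+* A)
      (linSeries κ fun n => (MvPolynomial.X n : PolyOne)) := by
  rw [map_linSeries]
  simp only [commEval_X]

theorem expSeries_linSeries_eq_map {A : Type*} [Ring A] [Algebra K A] (κ : ℕ → K) (a : ℕ+ → A)
    (h : ∀ n m, a n * a m = a m * a n) :
    expSeries (linSeries κ a) = PowerSeries.map (commEval a h : PolyOne →+* A)
      (expSeries (linSeries κ fun n => (MvPolynomial.X n : PolyOne))) := by
  rw [map_expSeries, ← linSeries_eq_map]

/-- The differential equation of the exponential of a series with commuting coefficients. -/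
theorem eul_expSeries {A : Type*} [Ring A] [Algebra K A] (κ : ℕ → K) (a : ℕ+ → A)
    (h : ∀ n m, a n * a m = a m * a n) :
    eul (expSeries (linSeries κ a)) = eul (linSeries κ a) * expSeries (linSeries κ a) := by
  rw [expSeries_linSeries_eq_map κ a h, linSeries_eq_map κ a h, eul_map, eul_map,
    eul_expSeries_comm (coeff_zero_linSeries _ _), map_mul]

theorem commute_coeff_expSeries {A : Type*} [Ring A] [Algebra K A] (κ κ' : ℕ → K) (a : ℕ+ → A)
    (h : ∀ n m, a n * a m = a m * a n) (i j : ℕ) :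
    Commute (coeff i (expSeries (linSeries κ a))) (coeff j (expSeries (linSeries κ' a))) := by
  rw [expSeries_linSeries_eq_map κ a h, expSeries_linSeries_eq_map κ' a h, coeff_map, coeff_map]
  exact (Commute.all _ _).map (commEval a h : PolyOne →+* A)

/-! ### Exponentials of derivations -/

section Taylor

variable {σ : Type*}

/-- The operator `(1/n) ∂/∂vₙ`. -/
def divDeriv (v : ℕ+ → σ) (n : ℕ+) : Module.End K (MvPolynomial σ K) :=
  ((n : ℕ) : K)⁻¹ • (MvPolynomial.pderiv (v n) : Derivation K _ _).toLinearMap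

theorem pderiv_comm (i j : σ) (f : MvPolynomial σ K) :
    MvPolynomial.pderiv i (MvPolynomial.pderiv j f) =
      MvPolynomial.pderiv j (MvPolynomial.pderiv i f) := by
  classical
  have key : ⁅(MvPolynomial.pderiv i : Derivation K (MvPolynomial σ K) (MvPolynomial σ K)),
      (MvPolynomial.pderiv j : Derivation K (MvPolynomial σ K) (MvPolynomial σ K))⁆ = 0 := by
    apply MvPolynomial.derivation_ext
    intro a
    rw [Derivation.commutator_apply]
    simp only [MvPolynomial.pderiv_X, Pi.single_apply]
    split_ifs <;> simp
  have := congrArg (fun D : Derivation K (MvPolynomial σ K) (MvPolynomial σ K) => D f) key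
  simpa [Derivation.commutator_apply, sub_eq_zero] using this

theorem divDeriv_comm (v w : ℕ+ → σ) (n m : ℕ+) :
    divDeriv v n * divDeriv w m = divDeriv w m * divDeriv v n := by
  refine LinearMap.ext fun f => ?_
  simp only [divDeriv, Module.End.mul_apply, LinearMap.smul_apply, Derivation.coeFn_coe, map_smul]
  rw [pderiv_comm (v n) (w m), smul_comm]

/-- The operators `exp (∑ₙ κₙ wⁿ (1/n) ∂/∂vₙ)`. -/
def derivExp (v : ℕ+ → σ) (κ : ℕ → K) : PowerSeries (Module.End K (MvPolynomial σ K)) :=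
  expSeries (linSeries κ (divDeriv v))

/-- Multiplication operators. -/
abbrev mulOp (f : MvPolynomial σ K) : Module.End K (MvPolynomial σ K) := LinearMap.mulLeft K f

theorem eul_derivExp (v : ℕ+ → σ) (κ : ℕ → K) :
    eul (derivExp v κ) = eul (linSeries κ (divDeriv v)) * derivExp v κ :=
  eul_expSeries κ _ (divDeriv_comm v v)

theorem commute_derivExp (v : ℕ+ → σ) (κ κ' : ℕ → K) (i j : ℕ) :
    Commute (coeff i (derivExp v κ)) (coeff j (derivExp v κ')) :=
  commute_coeff_expSeries κ κ' _ (divDeriv_comm v v) i j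

open Classical in
/-- The shift `c wⁿ` of the variable with index `s` under `exp (∑ₙ κₙ wⁿ (1/n) ∂/∂vₙ)`. -/
def shiftOf (v : ℕ+ → σ) (κ : ℕ → K) (s : σ) : Polynomial K :=
  if h : ∃ n, v n = s then Polynomial.monomial (h.choose : ℕ) (κ h.choose / (h.choose : ℕ)) else 0

theorem shiftOf_apply {v : ℕ+ → σ} (hv : Function.Injective v) (κ : ℕ → K) (n : ℕ+) :
    shiftOf v κ (v n) = Polynomial.monomial (n : ℕ) (κ n / (n : ℕ)) := by
  have h : ∃ m, v m = v n := ⟨n, rfl⟩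
  have h' : h.choose = n := hv h.choose_spec
  rw [shiftOf, dif_pos h, h']

theorem shiftOf_of_ne {v : ℕ+ → σ} (κ : ℕ → K) {s : σ} (h : ∀ n, v n ≠ s) :
    shiftOf v κ s = 0 := by
  rw [shiftOf, dif_neg (by simpa using h)]

/-- The substitution `X_{vₙ} ↦ X_{vₙ} + (κₙ / n) wⁿ`. -/
def taylor (v : ℕ+ → σ) (κ : ℕ → K) :
    MvPolynomial σ K →ₐ[K] Polynomial (MvPolynomial σ K) :=
  MvPolynomial.aeval fun s => Polynomial.C (MvPolynomial.X s) +
    (shiftOf v κ s).map (algebraMap K (MvPolynomial σ K))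

theorem divDeriv_X_mul {v : ℕ+ → σ} (hv : Function.Injective v) (n : ℕ+) (m : ℕ+)
    (f : MvPolynomial σ K) : divDeriv v m (MvPolynomial.X (v n) * f) =
      MvPolynomial.X (v n) * divDeriv v m f + if m = n then ((n : ℕ) : K)⁻¹ • f else 0 := by
  classical
  simp only [divDeriv, LinearMap.smul_apply, Derivation.coeFn_coe,
    Derivation.leibniz, MvPolynomial.pderiv_X, smul_add, Pi.single_apply, hv.eq_iff, smul_eq_mul]
  rw [mul_smul_comm]
  congr 1
  by_cases h : m = n
  · subst h; simp
  · rw [if_neg h, if_neg (fun h' => h h'.symm)]; simp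

theorem divDeriv_X_mul_of_ne {v : ℕ+ → σ} {s : σ} (hs : ∀ n, v n ≠ s) (m : ℕ+)
    (f : MvPolynomial σ K) : divDeriv v m (MvPolynomial.X s * f) =
      MvPolynomial.X s * divDeriv v m f := by
  classical
  simp [divDeriv, MvPolynomial.pderiv_X_of_ne (hs m).symm]

/-- Commutation of an exponential of derivations with a variable. -/
theorem derivExp_mul_X {v : ℕ+ → σ} (hv : Function.Injective v) (κ : ℕ → K) (n : ℕ+) :
    derivExp v κ * C (mulOp (MvPolynomial.X (v n))) =
      C (mulOp (MvPolynomial.X (v n))) * derivExp v κ +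
        (κ n / (n : ℕ)) • (X ^ (n : ℕ) * derivExp v κ) := by
  set x : PowerSeries (Module.End K (MvPolynomial σ K)) := C (mulOp (MvPolynomial.X (v n)))
  set Y := derivExp v κ
  set G := eul (linSeries κ (divDeriv v)) with hGdef
  have hY : eul Y = G * Y := eul_derivExp v κ
  have hn : ((n : ℕ) : K) ≠ 0 := Nat.cast_ne_zero.2 n.pos.ne'
  -- Only the n-th derivation fails to commute with the variable; the factor n of the Euler operator
  -- cancels the 1/n of the divided derivative.
  have hG : G * x = x * G + κ n • X ^ (n : ℕ) := by
    ext1 k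
    simp only [x, hGdef, coeff_mul_C, coeff_C_mul, map_add, coeff_eul, coeff_smul, coeff_X_pow]
    refine LinearMap.ext fun f => ?_
    rcases Nat.eq_zero_or_pos k with rfl | hk
    · simp [n.pos.ne]
    · lift k to ℕ+ using hk
      rw [coeff_linSeries]
      simp only [PNat.coe_inj]
      by_cases h : k = n
      · subst h
        simp only [Module.End.mul_apply, LinearMap.smul_apply, LinearMap.add_apply,
          LinearMap.mulLeft_apply, divDeriv_X_mul hv, if_true, smul_add, mul_smul_comm]
        congr 1
        rw [← Nat.cast_smul_eq_nsmul K, smul_smul, smul_smul, Module.End.one_apply]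
        congr 1
        field_simp
      · simp only [Module.End.mul_apply, LinearMap.smul_apply, LinearMap.add_apply,
          LinearMap.mulLeft_apply, divDeriv_X_mul hv, if_neg h, smul_add, mul_smul_comm]
        simp
  have hs : ∀ (c : K) (G : PowerSeries (Module.End K (MvPolynomial σ K))),
      eul (c • G) = c • eul G := by
    intro c G; ext1 n; simp [smul_comm]
  have hXp : ∀ F : PowerSeries (Module.End K (MvPolynomial σ K)),
      F * X ^ (n : ℕ) = X ^ (n : ℕ) * F := fun F => (PowerSeries.commute_X_pow F n)
  -- The difference Z of the two sides satisfies z Z' = G Z: the commutator term of `hG` is matched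
  -- by the Euler derivative of the explicit power of the formal variable.
  rw [← sub_eq_zero]
  refine eq_zero_of_eul_eq (G := G) (by simp [hGdef]) ?_ ?_
  · simp [x, Y, derivExp]
  · have e1 : eul (Y * x) = G * Y * x := by rw [eul_mul_C, hY]
    have e2 : eul (x * Y) = x * (G * Y) := by rw [eul_C_mul, hY]
    have e3 : eul ((κ n / (n : ℕ)) • (X ^ (n : ℕ) * Y)) =
        κ n • (X ^ (n : ℕ) * Y) + (κ n / (n : ℕ)) • (G * (X ^ (n : ℕ) * Y)) := by
      rw [hs, eul_mul, eul_X_pow, hY, smul_add, ← Nat.cast_smul_eq_nsmul K, smul_mul_assoc,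
        smul_smul, div_mul_cancel₀ _ hn, ← mul_assoc, ← mul_assoc, hXp]
    rw [map_sub, map_add, e1, e2, e3, mul_sub, mul_add, ← mul_assoc G x, hG, add_mul,
      smul_mul_assoc, mul_smul_comm]
    simp only [mul_assoc]
    abel

theorem derivExp_mul_X_of_ne {v : ℕ+ → σ} (κ : ℕ → K) {s : σ} (h : ∀ n, v n ≠ s) :
    derivExp v κ * C (mulOp (MvPolynomial.X s)) = C (mulOp (MvPolynomial.X s)) * derivExp v κ := by
  set x : PowerSeries (Module.End K (MvPolynomial σ K)) := C (mulOp (MvPolynomial.X s))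
  set Y := derivExp v κ
  set G := eul (linSeries κ (divDeriv v)) with hGdef
  have hY : eul Y = G * Y := eul_derivExp v κ
  have hG : G * x = x * G := by
    ext1 k
    simp only [x, hGdef, coeff_mul_C, coeff_C_mul, coeff_eul]
    refine LinearMap.ext fun f => ?_
    rcases Nat.eq_zero_or_pos k with rfl | hk
    · simp
    · lift k to ℕ+ using hk
      rw [coeff_linSeries]
      simp only [Module.End.mul_apply, LinearMap.smul_apply, LinearMap.mulLeft_apply,
        divDeriv_X_mul_of_ne h, mul_smul_comm]
  refine eq_of_eul_eq (G := G) (by simp [hGdef]) (by simp [x, Y, derivExp]) ?_ ?_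
  · rw [eul_mul_C, hY, mul_assoc]
  · rw [eul_C_mul, hY, ← mul_assoc, ← hG, mul_assoc]

theorem linSeries_apply_one (v : ℕ+ → σ) (κ : ℕ → K) (k : ℕ) (c : K) :
    coeff k (linSeries κ (divDeriv v)) (MvPolynomial.C c) = 0 := by
  rcases Nat.eq_zero_or_pos k with rfl | hk
  · simp
  · lift k to ℕ+ using hk
    rw [coeff_linSeries]
    simp [divDeriv]

theorem derivExp_apply_C (v : ℕ+ → σ) (κ : ℕ → K) (k : ℕ) (c : K) :
    coeff k (derivExp v κ) (MvPolynomial.C c) = if k = 0 then MvPolynomial.C c else 0 := by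
  induction k using Nat.strong_induction_on with
  | _ k ih =>
    rcases Nat.eq_zero_or_pos k with rfl | hk
    · simp [derivExp]
    rw [if_neg hk.ne']
    have h := congrArg (fun F => (coeff k F : Module.End K (MvPolynomial σ K)) (MvPolynomial.C c)) (eul_derivExp v κ)
    simp only [coeff_eul, coeff_mul, LinearMap.sum_apply, Module.End.mul_apply] at h
    rw [Finset.sum_eq_zero, LinearMap.smul_apply, ← Nat.cast_smul_eq_nsmul K] at h
    · exact (smul_eq_zero_iff_right (Nat.cast_ne_zero.2 hk.ne')).1 h
    · intro p hp
      have hp' := Finset.HasAntidiagonal.mem_antidiagonal.1 hp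
      by_cases h0 : p.1 = 0
      · rw [h0]; simp
      · rw [ih p.2 (by omega)]
        split_ifs
        · rw [LinearMap.smul_apply, linSeries_apply_one, smul_zero]
        · simp

/-- The exponential of a derivation acts as a substitution. -/
theorem coeff_taylor {v : ℕ+ → σ} (hv : Function.Injective v) (κ : ℕ → K) (f : MvPolynomial σ K)
    (k : ℕ) : (taylor v κ f).coeff k = coeff k (derivExp v κ) f := by
  induction f using MvPolynomial.induction_on generalizing k with
  | C a =>
    rw [derivExp_apply_C]
    simp only [taylor, MvPolynomial.aeval_C]
    simp [Polynomial.coeff_C]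
  | add p q hp hq => rw [map_add, map_add, Polynomial.coeff_add, hp, hq]
  | mul_X p s hp =>
    have hX : taylor v κ (MvPolynomial.X s) = Polynomial.C (MvPolynomial.X s) +
        (shiftOf v κ s).map (algebraMap K (MvPolynomial σ K)) := by simp [taylor]
    rw [map_mul, hX, mul_comm p, mul_add, Polynomial.coeff_add, Polynomial.coeff_mul_C, hp]
    by_cases h : ∃ n, v n = s
    · obtain ⟨n, rfl⟩ := h
      rw [shiftOf_apply hv, Polynomial.map_monomial, ← Polynomial.C_mul_X_pow_eq_monomial, ← mul_assoc,
        Polynomial.coeff_mul_X_pow', Polynomial.coeff_mul_C]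
      have := congrArg (fun F => (coeff k F : Module.End K (MvPolynomial σ K)) p) (derivExp_mul_X hv κ n)
      simp only [coeff_mul_C, coeff_C_mul, map_add, coeff_smul, Module.End.mul_apply,
        LinearMap.add_apply, LinearMap.smul_apply, LinearMap.mulLeft_apply,
        coeff_X_pow_mul'] at this
      rw [this, mul_comm]
      congr 1
      split_ifs
      · rw [hp, mul_comm, Algebra.smul_def]
      · simp
    · have h' : ∀ n, v n ≠ s := by simpa using h
      rw [shiftOf_of_ne κ h']
      have := congrArg (fun F => (coeff k F : Module.End K (MvPolynomial σ K)) p) (derivExp_mul_X_of_ne κ h')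
      simp only [coeff_mul_C, coeff_C_mul, Module.End.mul_apply, LinearMap.mulLeft_apply] at this
      rw [this]
      simp [mul_comm]

end Taylor

end

end CoupledHL

namespace CoupledHL

noncomputable section

open PowerSeries

/-! ### The action of exponentials of derivations on the polynomials `qₙ` -/

/-- The weights `1 - tⁿ`. -/
def wt (n : ℕ) : K := 1 - tParam ^ n

/-! ### Logarithmic derivatives of products of factors 1 − az and their inverses. -/

section Logarithm

/-- The series `∑_{n ≥ 1} aⁿ zⁿ`. -/
def geomTail (a : K) : PowerSeries K := PowerSeries.mk fun n => if n = 0 then 0 else a ^ n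

theorem eul_one_sub (a : K) :
    eul ((1 : PowerSeries K) - C a * X) = -geomTail a * (1 - C a * X) := by
  have h1 : eul (1 - C a * X : PowerSeries K) = -(C a * X) := by
    have := eul_X_pow (A := K) 1
    rw [map_sub, eul_one, eul_C_mul, ← pow_one (X : PowerSeries K), this]; simp
  rw [h1, neg_mul, neg_inj]
  ext n
  rw [mul_sub, mul_one, map_sub, ← mul_assoc, mul_comm _ (C a), mul_assoc]
  rcases n with _ | n
  · simp [geomTail]
  · rw [coeff_C_mul, coeff_C_mul, coeff_succ_mul_X, coeff_X]
    rcases n with _ | n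
    · simp [geomTail]
    · simp [geomTail, pow_succ']

theorem eul_inv {F G : PowerSeries K} (hF : constantCoeff F ≠ 0) (h : eul F = G * F) :
    eul F⁻¹ = -G * F⁻¹ := by
  have h1 : F * F⁻¹ = 1 := PowerSeries.mul_inv_cancel F hF
  have h2 : eul F * F⁻¹ + F * eul F⁻¹ = 0 := by rw [← eul_mul, h1, eul_one]
  calc eul F⁻¹ = F⁻¹ * (eul F * F⁻¹ + F * eul F⁻¹) - F⁻¹ * (G * (F * F⁻¹))
      + (F * F⁻¹ - 1) * (- eul F⁻¹) := by rw [h]; ring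
    _ = -G * F⁻¹ := by rw [h1, h2]; ring

theorem eul_mul_of {F G F' G' : PowerSeries K} (h : eul F = G * F) (h' : eul F' = G' * F') :
    eul (F * F') = (G + G') * (F * F') := by
  rw [eul_mul, h, h']; ring

theorem eul_one_sub_inv (a : K) :
    eul ((1 : PowerSeries K) - C a * X)⁻¹ = geomTail a * (1 - C a * X)⁻¹ := by
  rw [eul_inv (by simp) (eul_one_sub a), neg_neg]

end Logarithm

/-- The expansion of `(1 - z) / (1 - t z)`. -/
def raiseSeries : PowerSeries K := (1 - X) * (1 - C tParam * X)⁻¹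

/-- The expansion of `(1 - z) (1 - t² z) / (1 - t z)²`. -/
def lowerSeries : PowerSeries K :=
  (1 - X) * (1 - C tParam * X)⁻¹ * ((1 - C (tParam ^ 2) * X) * (1 - C tParam * X)⁻¹)

/-- The expansion of `(1 - t z) / (1 - z)`. -/
def contrSeries : PowerSeries K := (1 - C tParam * X) * (1 - X)⁻¹

/-- `γ` is the series by which `exp (∑ₙ κₙ wⁿ ∂̃ₙ)` multiplies the generating series of the `qₙ`. -/
structure IsFactor (κ : ℕ → K) (γ : PowerSeries K) : Prop where
  const : coeff 0 γ = 1
  eul_eq : eul γ = (PowerSeries.mk fun n => wt n * κ n) * γ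

/-- The logarithmic derivative of (1−tz)/(1−z) is ∑ (1−tⁿ) zⁿ; the next statement is the case of the
opposite sign. -/
theorem isFactor_contr : IsFactor 1 contrSeries := by
  refine ⟨by simp [contrSeries], ?_⟩
  have h := eul_mul_of (eul_one_sub tParam) (eul_one_sub_inv 1)
  simp only [map_one, one_mul] at h
  rw [contrSeries, h]
  congr 1
  ext n
  rcases n with _ | n <;> simp [geomTail, wt]
  ring

theorem isFactor_raise : IsFactor (-1) raiseSeries := by
  refine ⟨by simp [raiseSeries], ?_⟩
  have h := eul_mul_of (eul_one_sub 1) (eul_one_sub_inv tParam)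
  simp only [map_one, one_mul] at h
  rw [raiseSeries, h]
  congr 1
  ext n
  rcases n with _ | n <;> simp [geomTail, wt]
  ring

/-- Since −(1−tⁿ)² = −1 + 2tⁿ − t²ⁿ, the exponents of 1−z, 1−tz and 1−t²z are 1, −2 and 1. This is
the origin of the coupling factor in the definition of Q_{[λ,μ]}. -/
theorem isFactor_lower : IsFactor (fun n => -wt n) lowerSeries := by
  refine ⟨by simp [lowerSeries], ?_⟩
  have h := eul_mul_of (eul_mul_of (eul_one_sub 1) (eul_one_sub_inv tParam))
    (eul_mul_of (eul_one_sub (tParam ^ 2)) (eul_one_sub_inv tParam))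
  simp only [map_one, one_mul] at h
  rw [lowerSeries, h]
  congr 1
  ext n
  rcases n with _ | n <;> simp [geomTail, wt]
  ring

/-- All coefficients after the constant one agree, so the commutator of D⁺ with H_n is 1−t times a
plain sum of operators H_{n−b} composed with D⁺. -/
theorem coeff_contrSeries (n : ℕ) : coeff n contrSeries = if n = 0 then 1 else 1 - tParam := by
  have h : contrSeries = PowerSeries.mk fun n => if n = 0 then 1 else 1 - tParam := by
    rw [contrSeries, eq_comm, PowerSeries.eq_mul_inv_iff_mul_eq (by simp)]
    ext n
    rw [mul_sub, mul_one, map_sub, map_sub]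
    rcases n with _ | _ | n
    · simp
    · rw [coeff_succ_mul_X, ← mul_one (C tParam), mul_assoc, coeff_C_mul]; simp [coeff_one]
    · rw [coeff_succ_mul_X, coeff_C_mul]; simp [coeff_X, coeff_one]
  rw [h, coeff_mk]

theorem raiseSeries_mul : raiseSeries * (1 - C tParam * X) = 1 - X := by
  rw [raiseSeries, mul_assoc, PowerSeries.inv_mul_cancel _ (by simp), mul_one]

theorem coeff_raiseSeries (k : ℕ) : coeff k raiseSeries = raiseCoeff k := rfl

/-- The shift of x_n by (κ_n/n) wⁿ adds ∑ (1−tⁿ) κ_n wⁿ zⁿ to the logarithmic derivative, and this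
is the logarithmic derivative of γ(wz). -/
theorem expSeries_shift {B : Type*} [CommRing B] [Algebra K B] {κ : ℕ → K} {γ : PowerSeries K}
    (hγ : IsFactor κ γ) (x : ℕ+ → B) (w : B) :
    expSeries (linSeries wt fun n => x n + (κ n / (n : ℕ)) • w ^ (n : ℕ)) =
      expSeries (linSeries wt x) *
        PowerSeries.mk fun n => coeff n γ • w ^ n := by
  have hr : (PowerSeries.mk fun n => coeff n γ • w ^ n) =
      rescale w (PowerSeries.map (algebraMap K B) γ) := by
    ext n; simp [coeff_rescale, Algebra.smul_def, mul_comm]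
  have he : ∀ F : PowerSeries B, eul (rescale w F) = rescale w (eul F) := by
    intro F; ext n; simp [coeff_rescale]; ring
  rw [hr]
  refine eq_of_eul_eq (G := eul (linSeries wt fun n => x n + (κ n / (n : ℕ)) • w ^ (n : ℕ)))
    (by simp) ?_ (eul_expSeries _ _ fun _ _ => mul_comm _ _) ?_
  · rw [coeff_zero_expSeries, coeff_mul]
    have h0 := hγ.const
    simp only [coeff_zero_eq_constantCoeff] at *
    simp [coeff_rescale, h0]
  · rw [eul_mul, eul_expSeries _ _ fun _ _ => mul_comm _ _, he, eul_map, hγ.eul_eq, map_mul,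
      map_mul]
    have h1 : eul (linSeries wt fun n => x n + (κ n / (n : ℕ)) • w ^ (n : ℕ)) =
        eul (linSeries wt x) + rescale w (PowerSeries.map (algebraMap K B)
          (PowerSeries.mk fun n => wt n * κ n)) := by
      ext n
      have e : ∀ c : K, w ^ n * algebraMap K B c = c • w ^ n := fun c => by
        rw [Algebra.smul_def, mul_comm]
      rw [map_add, coeff_rescale, coeff_map, coeff_mk, e]
      rcases Nat.eq_zero_or_pos n with rfl | hn
      · rw [coeff_eul, coeff_eul]; simp [wt]
      · lift n to ℕ+ using hn
        have hn : ((n : ℕ) : K) ≠ 0 := Nat.cast_ne_zero.2 n.pos.ne'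
        rw [coeff_eul, coeff_eul, coeff_linSeries, coeff_linSeries, smul_add, smul_add,
          add_right_inj, ← Nat.cast_smul_eq_nsmul K, smul_smul, smul_smul]
        congr 1
        field_simp
    rw [h1]; ring

/-! ### Action of exponentials of derivations on q_n and on products. -/

section QAction

variable {σ : Type*}

/-- The polynomials `qₙ` in the variables `v`. -/
def qAt (v : ℕ+ → σ) (n : ℤ) : MvPolynomial σ K := MvPolynomial.rename v (qInt n)

/-- The generating series of the `qₙ` in the variables `v`. -/
def qSeries (v : ℕ+ → σ) : PowerSeries (MvPolynomial σ K) :=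
  expSeries (linSeries wt fun n => MvPolynomial.X (v n))

theorem qPoly_eq (n : ℕ) : qPoly n = coeff n (qSeries id) := rfl

theorem qInt_natCast (n : ℕ) : qInt n = qPoly n := by simp [qInt]

theorem qInt_of_neg {n : ℤ} (h : n < 0) : qInt n = 0 := by simp [qInt, h]

theorem qAt_of_neg (v : ℕ+ → σ) {n : ℤ} (h : n < 0) : qAt v n = 0 := by
  simp [qAt, qInt_of_neg h]

theorem coeff_qSeries (v : ℕ+ → σ) (n : ℕ) : coeff n (qSeries v) = qAt v n := by
  have h : qSeries v = PowerSeries.map ((MvPolynomial.rename v : PolyOne →ₐ[K] _) :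
      PolyOne →+* MvPolynomial σ K) (qSeries id) := by
    rw [qSeries, qSeries, map_expSeries, map_linSeries]
    simp
  rw [h, coeff_map, qAt, qInt_natCast, qPoly_eq]
  rfl

theorem qAt_zero (v : ℕ+ → σ) : qAt v 0 = 1 := by
  have := coeff_qSeries v 0
  rw [qSeries, coeff_zero_expSeries] at this
  exact this.symm

/-- The exponential of a derivation acts on the `qₙ` by a scalar series. -/
theorem coeff_taylor_qAt {v : ℕ+ → σ} (hv : Function.Injective v) {κ : ℕ → K}
    {γ : PowerSeries K} (hγ : IsFactor κ γ) (n : ℤ) (k : ℕ) :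
    (taylor v κ (qAt v n)).coeff k = coeff k γ • qAt v (n - k) := by
  rcases lt_or_ge n 0 with hn | hn
  · rw [qAt_of_neg v hn, qAt_of_neg v (by omega)]; simp
  lift n to ℕ using hn
  -- The substitution is applied to the whole generating series, with w the polynomial variable; the
  -- claim is then the coefficient of zⁿ wᵏ.
  have h1 : PowerSeries.map
        (taylor v κ : MvPolynomial σ K →+* Polynomial (MvPolynomial σ K)) (qSeries v) =
      PowerSeries.map (Polynomial.C) (qSeries v) *
        PowerSeries.mk fun n => coeff n γ • (Polynomial.X : Polynomial (MvPolynomial σ K)) ^ n := by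
    have hC : PowerSeries.map
          (Polynomial.C : MvPolynomial σ K →+* Polynomial (MvPolynomial σ K)) (qSeries v) =
        expSeries (linSeries wt fun n => Polynomial.C (MvPolynomial.X (v n) : MvPolynomial σ K)) := by
      have := map_expSeries (Polynomial.CAlgHom (R := K) (A := MvPolynomial σ K))
        (linSeries wt fun n => (MvPolynomial.X (v n) : MvPolynomial σ K))
      rw [map_linSeries] at this
      exact this
    rw [hC, ← expSeries_shift hγ, qSeries, map_expSeries, map_linSeries]
    congr 2
    funext n
    rw [taylor, MvPolynomial.aeval_X, shiftOf_apply hv, Polynomial.map_monomial,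
      ← Polynomial.C_mul_X_pow_eq_monomial, Algebra.smul_def]
    rfl
  have h2 := congrArg (fun F => (coeff n F).coeff k) h1
  simp only [coeff_map, coeff_mul, Polynomial.finsetSum_coeff, coeff_mk] at h2
  rw [coeff_qSeries] at h2
  refine h2.trans ?_
  have h3 : ∀ p ∈ Finset.HasAntidiagonal.antidiagonal n,
      (Polynomial.C (coeff p.1 (qSeries v)) *
        (coeff p.2 γ • (Polynomial.X : Polynomial (MvPolynomial σ K)) ^ p.2)).coeff k =
      if p.2 = k then coeff k γ • qAt v (n - k) else 0 := by
    intro p hp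
    have hp' := Finset.HasAntidiagonal.mem_antidiagonal.1 hp
    rw [Polynomial.coeff_C_mul, Polynomial.coeff_smul, Polynomial.coeff_X_pow, coeff_qSeries]
    by_cases h : p.2 = k
    · subst h
      have : (n : ℤ) - (p.2 : ℤ) = (p.1 : ℤ) := by omega
      rw [if_pos rfl, if_pos rfl, this]; simp
    · rw [if_neg h, if_neg (Ne.symm h)]; simp
  refine (Finset.sum_congr rfl h3).trans ?_
  by_cases hk : k ≤ n
  · rw [Finset.sum_eq_single (n - k, k)]
    · simp
    · rintro ⟨a, b⟩ hp hne
      have hp' := Finset.HasAntidiagonal.mem_antidiagonal.1 hp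
      simp only at hp' ⊢
      refine if_neg fun hb => hne ?_
      subst hb; rw [Prod.mk.injEq]; omega
    · intro h
      exact absurd (Finset.HasAntidiagonal.mem_antidiagonal.2 (by simp [hk])) h
  · rw [qAt_of_neg v (by omega), smul_zero]
    simp

/-- An exponential of derivations is a substitution, hence multiplicative. -/
theorem derivExp_mul {v : ℕ+ → σ} (hv : Function.Injective v) (κ : ℕ → K)
    (f g : MvPolynomial σ K) (k : ℕ) :
    coeff k (derivExp v κ) (f * g) = ∑ p ∈ Finset.HasAntidiagonal.antidiagonal k,
      coeff p.1 (derivExp v κ) f * coeff p.2 (derivExp v κ) g := by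
  simp only [← coeff_taylor hv, map_mul, Polynomial.coeff_mul]

theorem derivExp_qAt {v : ℕ+ → σ} (hv : Function.Injective v) {κ : ℕ → K}
    {γ : PowerSeries K} (hγ : IsFactor κ γ) (n : ℤ) (k : ℕ) :
    coeff k (derivExp v κ) (qAt v n) = coeff k γ • qAt v (n - k) := by
  rw [← coeff_taylor hv, coeff_taylor_qAt hv hγ]

theorem derivExp_mul_qAt {v : ℕ+ → σ} (hv : Function.Injective v) {κ : ℕ → K}
    {γ : PowerSeries K} (hγ : IsFactor κ γ) (n : ℤ) :
    derivExp v κ * C (mulOp (qAt v n)) =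
      (PowerSeries.mk fun b : ℕ => coeff b γ • mulOp (qAt v (n - b))) * derivExp v κ := by
  ext1 k
  rw [coeff_mul_C, coeff_mul]
  refine LinearMap.ext fun f => ?_
  rw [Module.End.mul_apply, LinearMap.mulLeft_apply, derivExp_mul hv, LinearMap.sum_apply]
  refine Finset.sum_congr rfl fun p _ => ?_
  rw [derivExp_qAt hv hγ, coeff_mk, Module.End.mul_apply, LinearMap.smul_apply,
    LinearMap.mulLeft_apply, smul_mul_assoc]

theorem coeff_zero_derivExp (v : ℕ+ → σ) (κ : ℕ → K) : coeff 0 (derivExp v κ) = 1 :=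
  coeff_zero_expSeries _

/-- The substitution has values that are polynomials in w. This is what makes the infinite sums
defining the vertex operators finite on each polynomial. -/
theorem exists_derivExp_eq_zero {v : ℕ+ → σ} (hv : Function.Injective v) (κ : ℕ → K)
    (f : MvPolynomial σ K) : ∃ N, ∀ k, N ≤ k → coeff k (derivExp v κ) f = 0 := by
  refine ⟨(taylor v κ f).natDegree + 1, fun k hk => ?_⟩
  rw [← coeff_taylor hv]
  exact Polynomial.coeff_eq_zero_of_natDegree_lt (by omega)

end QAction

end

end CoupledHL

namespace CoupledHL

noncomputable section

open PowerSeries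

/-! ### Vertex operators of Hall-Littlewood functions -/

open Finset.HasAntidiagonal (antidiagonal mem_antidiagonal)

/-- The operators `exp (ξ(∂̃, w))`. -/
def dPlus : PowerSeries (Module.End K PolyOne) := derivExp id 1

/-- The operators `exp (-ξ(∂̃, w))`. -/
def dMinus : PowerSeries (Module.End K PolyOne) := derivExp id (-1)

/-- The sum `∑ₖ φₖ ∘ D⁻ₖ`, where `D⁻ₖ` are the coefficients of `exp (-ξ(∂̃, w))`. -/
def sumMinus (φ : ℕ → Module.End K PolyOne) : Module.End K PolyOne :=
  (Polynomial.lsum φ) ∘ₗ (taylor id (-1)).toLinearMap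

theorem sumMinus_apply (φ : ℕ → Module.End K PolyOne) {f : PolyOne} {N : ℕ}
    (hN : ∀ k, N ≤ k → coeff k dMinus f = 0) :
    sumMinus φ f = ∑ k ∈ Finset.range N, φ k (coeff k dMinus f) := by
  have h : ∀ k, (taylor id (-1) f).coeff k = coeff k dMinus f :=
    coeff_taylor Function.injective_id _ f
  rw [sumMinus, LinearMap.comp_apply, Polynomial.lsum_apply, AlgHom.toLinearMap_apply,
    Polynomial.sum_eq_of_subset (s := Finset.range N) _ (by simp)]
  · simp only [h]
  · intro k hk
    rw [Polynomial.mem_support_iff, h] at hk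
    rw [Finset.mem_range]
    by_contra hn
    exact hk (hN k (by omega))

theorem qAt_id (n : ℤ) : (qAt id n : PolyOne) = qInt n := by simp [qAt]

theorem dMinus_mul_q (n : ℤ) : dMinus * C (mulOp (qInt n)) =
    (PowerSeries.mk fun b : ℕ => raiseCoeff b • mulOp (qInt (n - b))) * dMinus := by
  have := derivExp_mul_qAt (σ := ℕ+) Function.injective_id isFactor_raise n
  simpa only [qAt_id] using! this

/-- The vertex operators `Hₙ = ∑ₖ qₙ₊ₖ D⁻ₖ`. -/
def hOp (n : ℤ) : Module.End K PolyOne := sumMinus fun k => mulOp (qInt (n + k))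

theorem exists_dMinus_eq_zero (f : PolyOne) : ∃ N, ∀ k, N ≤ k → coeff k dMinus f = 0 :=
  exists_derivExp_eq_zero Function.injective_id _ f

theorem hOp_apply (n : ℤ) {f : PolyOne} {N : ℕ} (hN : ∀ k, N ≤ k → coeff k dMinus f = 0) :
    hOp n f = ∑ k ∈ Finset.range N, qInt (n + k) * coeff k dMinus f :=
  sumMinus_apply _ hN

theorem coeff_zero_dMinus : coeff 0 dMinus = 1 := coeff_zero_derivExp _ _

/-- Commutation of an exponential of derivations with the vertex operators. -/
theorem derivExp_mul_hOp {κ : ℕ → K} {γ : PowerSeries K} (hγ : IsFactor κ γ) (n : ℤ) :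
    derivExp id κ * C (hOp n) =
      (PowerSeries.mk fun b : ℕ => coeff b γ • hOp (n - b)) * derivExp id κ := by
  ext1 k
  refine LinearMap.ext fun f => ?_
  obtain ⟨N, hN⟩ := exists_dMinus_eq_zero f
  -- Exponentials of derivations commute, so one bound N serves f and all its images at once.
  have hN' : ∀ c k, N ≤ k → coeff k dMinus (coeff c (derivExp id κ) f) = 0 := by
    intro c k hk
    have := LinearMap.congr_fun (commute_derivExp (id : ℕ+ → ℕ+) (-1) κ k c) f
    simp only [Module.End.mul_apply] at this
    rw [dMinus, this, ← dMinus, hN k hk, map_zero]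
  have hc : ∀ k c, coeff c (derivExp id κ) (coeff k dMinus f) =
      coeff k dMinus (coeff c (derivExp id κ) f) := by
    intro k c
    exact LinearMap.congr_fun (commute_derivExp (id : ℕ+ → ℕ+) κ (-1) c k) f
  have hq : ∀ m : ℤ, ∀ b, coeff b (derivExp id κ) (qInt m) = coeff b γ • qInt (m - b) := by
    intro m b
    have := derivExp_qAt (σ := ℕ+) Function.injective_id hγ m b
    simpa only [qAt_id] using this
  rw [coeff_mul_C, coeff_mul, Module.End.mul_apply, hOp_apply n hN, map_sum, LinearMap.sum_apply]
  simp only [coeff_mk, Module.End.mul_apply, LinearMap.smul_apply]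
  simp only [hOp_apply _ (hN' _), derivExp_mul Function.injective_id, hq, hc, Finset.smul_sum]
  rw [Finset.sum_comm]
  refine Finset.sum_congr rfl fun p _ => Finset.sum_congr rfl fun j _ => ?_
  rw [smul_mul_assoc, sub_add_eq_add_sub]

/-- The denominator of (1−R)/(1−tR) is cleared: the coefficients satisfy c_{b+1} − t c_b = 0 except
at b = 0, where the value is −1. -/
theorem raise_difference {A : Type*} [Ring A] [Algebra K A] (F : ℤ → A) (n : ℤ) :
    (PowerSeries.mk fun b : ℕ => raiseCoeff b • F (n - b)) -
      tParam • (X * PowerSeries.mk fun b : ℕ => raiseCoeff b • F (n - 1 - b)) =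
    C (F n) - X * C (F (n - 1)) := by
  have h0 : raiseCoeff 0 = 1 := by
    rw [← coeff_raiseSeries]; exact isFactor_raise.const
  have h : ∀ b, raiseCoeff (b + 1) - tParam * raiseCoeff b = if b = 0 then -1 else 0 := by
    intro b
    have := congrArg (coeff (b + 1)) raiseSeries_mul
    rw [mul_sub, mul_one, map_sub, mul_comm (C tParam), ← mul_assoc, coeff_mul_C,
      coeff_succ_mul_X, coeff_raiseSeries, coeff_raiseSeries, mul_comm] at this
    rw [this]
    rcases b with _ | b <;> simp [coeff_one, coeff_X]
  ext1 b
  rcases b with _ | b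
  · simp [h0]
  · rw [map_sub, coeff_smul, coeff_succ_X_mul, map_sub, coeff_succ_X_mul, coeff_mk, coeff_mk,
      smul_smul, show n - ((b + 1 : ℕ) : ℤ) = n - 1 - b by push_cast; ring, ← sub_smul, h,
      coeff_C, coeff_C]
    rcases b with _ | b <;> simp

theorem smul_X_mul {A : Type*} [Ring A] [Algebra K A] (c : K) (F G : PowerSeries A) :
    (c • (X * F)) * G = c • (X * (F * G)) := by rw [smul_mul_assoc, mul_assoc]

/-- Clearing the denominator replaces the full expansion of a commutation rule by a relation with
finitely many terms, which can be summed against q_{m+k}. -/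
theorem dMinus_difference (F : ℤ → Module.End K PolyOne) (n : ℤ)
    (h : ∀ n, dMinus * C (F n) =
      (PowerSeries.mk fun b : ℕ => raiseCoeff b • F (n - b)) * dMinus) :
    coeff 0 dMinus * F n = F n * coeff 0 dMinus ∧ ∀ k, coeff (k + 1) dMinus * F n =
      tParam • (coeff k dMinus * F (n - 1)) + F n * coeff (k + 1) dMinus -
        F (n - 1) * coeff k dMinus := by
  have h1 := congrArg (· * dMinus) (raise_difference F n)
  simp only [sub_mul, smul_X_mul, mul_assoc] at h1
  rw [← h, ← h] at h1
  refine ⟨by rw [coeff_zero_dMinus, one_mul, mul_one], fun k => ?_⟩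
  have h2 := congrArg (coeff (k + 1)) h1
  simp only [map_sub, coeff_smul, coeff_succ_X_mul, coeff_mul_C, coeff_C_mul] at h2
  rw [sub_eq_iff_eq_add] at h2
  rw [h2]; abel

theorem dMinus_hOp (n : ℤ) (k : ℕ) (f : PolyOne) : coeff (k + 1) dMinus (hOp n f) =
      tParam • coeff k dMinus (hOp (n - 1) f) + hOp n (coeff (k + 1) dMinus f) -
        hOp (n - 1) (coeff k dMinus f) :=
  LinearMap.congr_fun ((dMinus_difference hOp n
    fun n => derivExp_mul_hOp isFactor_raise n).2 k) f

theorem dMinus_q (n : ℤ) (k : ℕ) (f : PolyOne) : coeff (k + 1) dMinus (qInt n * f) =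
      tParam • coeff k dMinus (qInt (n - 1) * f) + qInt n * coeff (k + 1) dMinus f -
        qInt (n - 1) * coeff k dMinus f :=
  LinearMap.congr_fun ((dMinus_difference (fun n => mulOp (qInt n)) n dMinus_mul_q).2 k) f

/-- The operators `∑_{k,l} q_{m+k} q_{n+l} D⁻ₖ D⁻ₗ`. -/
def normalOrd (m n : ℤ) : Module.End K PolyOne := sumMinus fun k => mulOp (qInt (m + k)) * hOp n

theorem dMinus_dMinus_eq_zero {f : PolyOne} {N : ℕ} (hN : ∀ k, N ≤ k → coeff k dMinus f = 0)
    (c k : ℕ) (hk : N ≤ k) : coeff k dMinus (coeff c dMinus f) = 0 := by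
  have := LinearMap.congr_fun (commute_derivExp (id : ℕ+ → ℕ+) (-1) (-1) k c) f
  simp only [Module.End.mul_apply] at this
  rw [dMinus, this, ← dMinus, hN k hk, map_zero]

/-- In normal order all multiplications stand to the left of all derivations, and each of the two
groups is commutative. -/
theorem normalOrd_comm (m n : ℤ) : normalOrd m n = normalOrd n m := by
  refine LinearMap.ext fun f => ?_
  obtain ⟨N, hN⟩ := exists_dMinus_eq_zero f
  rw [normalOrd, normalOrd, sumMinus_apply _ hN, sumMinus_apply _ hN]
  simp only [Module.End.mul_apply, LinearMap.mulLeft_apply,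
    hOp_apply _ (dMinus_dMinus_eq_zero hN _), Finset.mul_sum]
  rw [Finset.sum_comm]
  refine Finset.sum_congr rfl fun i _ => Finset.sum_congr rfl fun j _ => ?_
  have : coeff i dMinus (coeff j dMinus f) = coeff j dMinus (coeff i dMinus f) :=
    LinearMap.congr_fun (commute_derivExp (id : ℕ+ → ℕ+) (-1) (-1) i j) f
  rw [this]; ring

/-- With R raising m and lowering n, the product H_m H_n is (1−R)/(1−tR) applied to the normally
ordered product; applying 1−tR leaves 1−R. -/
theorem hOp_hOp_sub (m n : ℤ) : hOp m * hOp n - tParam • (hOp (m + 1) * hOp (n - 1)) =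
    normalOrd m n - normalOrd (m + 1) (n - 1) := by
  refine LinearMap.ext fun f => ?_
  obtain ⟨N₁, hN₁⟩ := exists_dMinus_eq_zero f
  obtain ⟨N₂, hN₂⟩ := exists_dMinus_eq_zero (hOp n f)
  obtain ⟨N₃, hN₃⟩ := exists_dMinus_eq_zero (hOp (n - 1) f)
  set N := N₁ + N₂ + N₃
  have e : ∀ k : ℕ, m + ((k + 1 : ℕ) : ℤ) = m + 1 + k := fun k => by push_cast; ring
  simp only [LinearMap.sub_apply, LinearMap.smul_apply, Module.End.mul_apply]
  -- The sums starting at m run one step further than those starting at m + 1, so that splitting off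
  -- the term k = 0 aligns them.
  rw [hOp_apply m (N := N + 1) (fun k hk => hN₂ k (by omega)),
    hOp_apply (m + 1) (N := N) (fun k hk => hN₃ k (by omega)),
    normalOrd, normalOrd, sumMinus_apply _ (N := N + 1) (fun k hk => hN₁ k (by omega)),
    sumMinus_apply _ (N := N) (fun k hk => hN₁ k (by omega)), Finset.sum_range_succ',
    Finset.sum_range_succ']
  simp only [coeff_zero_dMinus, dMinus_hOp, e, Module.End.mul_apply, LinearMap.mulLeft_apply,
    mul_sub, mul_add, mul_smul_comm, Finset.sum_sub_distrib, Finset.sum_add_distrib,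
    ← Finset.smul_sum, Module.End.one_apply]
  abel

/-- The quadratic relation between the vertex operators. -/
theorem hOp_relation (m n : ℤ) :
    hOp m * hOp n - tParam • (hOp (m + 1) * hOp (n - 1)) + hOp (n - 1) * hOp (m + 1) -
      tParam • (hOp n * hOp m) = 0 := by
  have h1 := hOp_hOp_sub m n
  -- By symmetry of the normal order, the right side for the pair (n−1, m+1) is the negative of the
  -- one for (m, n).
  have h2 := hOp_hOp_sub (n - 1) (m + 1)
  rw [sub_add_cancel, add_sub_cancel_right, normalOrd_comm, normalOrd_comm n m] at h2
  rw [add_sub_assoc, h1, h2]; abel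

/-- The derivations inside H_n pass q_m with the same factor (1−R)/(1−tR) as they pass H_m, whose
denominator is cleared here; q_m carries no derivations of its own. -/
theorem hOp_q_relation (m n : ℤ) :
    hOp n * mulOp (qInt m) - tParam • (hOp (n + 1) * mulOp (qInt (m - 1))) =
      mulOp (qInt m) * hOp n - mulOp (qInt (m - 1)) * hOp (n + 1) := by
  refine LinearMap.ext fun f => ?_
  obtain ⟨N₁, hN₁⟩ := exists_dMinus_eq_zero f
  obtain ⟨N₂, hN₂⟩ := exists_dMinus_eq_zero (qInt m * f)
  obtain ⟨N₃, hN₃⟩ := exists_dMinus_eq_zero (qInt (m - 1) * f)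
  set N := N₁ + N₂ + N₃
  have e : ∀ k : ℕ, n + ((k + 1 : ℕ) : ℤ) = n + 1 + k := fun k => by push_cast; ring
  have e0 : ((0 : ℕ) : ℤ) = 0 := rfl
  simp only [LinearMap.sub_apply, LinearMap.smul_apply, Module.End.mul_apply,
    LinearMap.mulLeft_apply]
  rw [hOp_apply n (N := N + 1) (fun k hk => hN₂ k (by omega)),
    hOp_apply (n + 1) (N := N) (fun k hk => hN₃ k (by omega)),
    hOp_apply n (N := N + 1) (fun k hk => hN₁ k (by omega)),
    hOp_apply (n + 1) (N := N) (fun k hk => hN₁ k (by omega)),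
    Finset.sum_range_succ', Finset.sum_range_succ']
  simp only [coeff_zero_dMinus, dMinus_q, e, mul_sub, mul_add, mul_smul_comm,
    Finset.sum_sub_distrib, Finset.sum_add_distrib, ← Finset.smul_sum, Module.End.one_apply,
    Finset.mul_sum]
  have c1 : ∀ a b c : PolyOne, a * (b * c) = b * (a * c) := fun a b c => by ring
  simp only [c1 (qInt m), c1 (qInt (m - 1))]
  abel

theorem hOp_one (n : ℤ) : hOp n 1 = qInt n := by
  have h : ∀ k, 1 ≤ k → coeff k dMinus (1 : PolyOne) = 0 := by
    intro k hk
    have := derivExp_apply_C (id : ℕ+ → ℕ+) (-1) k 1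
    rw [if_neg (by omega), map_one] at this
    exact this
  rw [hOp_apply n h]
  simp [coeff_zero_dMinus]

theorem coeff_dPlus_one (k : ℕ) : coeff k dPlus (1 : PolyOne) = if k = 0 then 1 else 0 := by
  have := derivExp_apply_C (id : ℕ+ → ℕ+) 1 k 1
  rwa [map_one] at this

/-! ### Straightening rules implied by the quadratic relation. -/

section Consequences

variable {A : Type*} [Ring A] [Algebra K A] {F : ℤ → ℤ → A}

/-- For indices (a−1, a) the four terms of the quadratic relation coincide in pairs, and 2 is
invertible. -/
theorem adjacent_relation
    (h : ∀ m n, F m n - tParam • F (m + 1) (n - 1) + F (n - 1) (m + 1) - tParam • F n m = 0)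
    (a : ℤ) : F (a - 1) a = tParam • F a (a - 1) := by
  have h1 := h (a - 1) a
  rw [sub_add_cancel] at h1
  have h3 : (2 : K) • (F (a - 1) a - tParam • F a (a - 1)) = 0 := by
    rw [two_smul, ← h1]; abel
  exact sub_eq_zero.1 ((smul_eq_zero_iff_right (two_ne_zero (α := K))).1 h3)

/-- The quadratic relation for the pair (a−2−j, a) leads to the pair (a−1−j, a−1), whose gap is
smaller by 2. The induction therefore goes from j to j+2: the two ends of the antidiagonal come from
the relation, its interior from the smaller case. -/
theorem straightening_relation
    (h : ∀ m n, F m n - tParam • F (m + 1) (n - 1) + F (n - 1) (m + 1) - tParam • F n m = 0)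
    (j : ℕ) : ∀ a : ℤ, F (a - 2 - j) a + (1 - tParam) • (∑ p ∈ antidiagonal j,
      F (a - 1 - p.1) (a - 1 - p.2)) = tParam • F a (a - 2 - j) := by
  induction j using Nat.strong_induction_on with
  | _ j ih =>
    intro a
    have h1 := h (a - 2 - j) a
    rcases j with _ | _ | j
    · rw [Nat.cast_zero, sub_zero, show a - 2 + 1 = a - 1 by ring] at h1
      have : antidiagonal 0 = {(0, 0)} := rfl
      rw [this, Finset.sum_singleton, Nat.cast_zero, sub_zero, sub_zero, sub_smul, one_smul,
        ← sub_eq_zero, ← h1]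
      abel
    · have h2 := adjacent_relation h (a - 1)
      have : antidiagonal 1 = {(0, 1), (1, 0)} := rfl
      rw [zero_add, this, Finset.sum_pair (by simp)]
      simp only [zero_add, Nat.cast_one, Nat.cast_zero, sub_zero] at h1 ⊢
      rw [show a - 2 - 1 + 1 = a - 1 - 1 by ring, h2] at h1
      rw [h2, ← sub_eq_zero, ← h1]
      simp only [sub_smul, smul_add, one_smul]
      abel
    · have h3 := ih j (by omega) (a - 1)
      have e1 : a - 2 - ((j + 2 : ℕ) : ℤ) + 1 = a - 1 - 2 - j := by push_cast; ring
      have e2 : a - 1 - ((j + 2 : ℕ) : ℤ) = a - 1 - 2 - j := by push_cast; ring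
      rw [e1] at h1
      rw [Finset.Nat.antidiagonal_succ_succ', Finset.sum_cons, Finset.sum_cons, Finset.sum_map]
      have e3 : ∀ i : ℕ, a - 1 - ((Nat.succ i : ℕ) : ℤ) = a - 1 - 1 - i := fun i => by
        push_cast; ring
      simp only [Function.Embedding.prodMap, Function.Embedding.coeFn_mk, Prod.map, e2, e3,
        Nat.cast_zero, sub_zero, smul_add]
      have h4 : (1 - tParam) • ∑ p ∈ antidiagonal j, F (a - 1 - 1 - p.1) (a - 1 - 1 - p.2) =
          tParam • F (a - 1) (a - 1 - 2 - j) - F (a - 1 - 2 - j) (a - 1) :=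
        eq_sub_of_add_eq' h3
      rw [h4, ← sub_eq_zero, ← h1]
      simp only [sub_smul, one_smul]
      abel

end Consequences

/-! ### Relations between generating series -/

/-- `∑ⱼ wʲ Hₙ₋ⱼ`. -/
def hDown (n : ℤ) : PowerSeries (Module.End K PolyOne) := PowerSeries.mk fun j : ℕ => hOp (n - j)

/-- `∑ⱼ zʲ Hₙ₊ⱼ`. -/
def hUp (n : ℤ) : PowerSeries (Module.End K PolyOne) := PowerSeries.mk fun j : ℕ => hOp (n + j)

/-- Multiplication by `∑ₖ zᵏ qₖ`. -/
def qMul : PowerSeries (Module.End K PolyOne) := PowerSeries.mk fun k => mulOp (qPoly k)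

/-- The commutator of `exp (ξ(∂̃, w))` and `Hₙ`, divided by `1 - t`. -/
def eOp (n : ℤ) : PowerSeries (Module.End K PolyOne) := X * hDown (n - 1) * dPlus

theorem hDown_eq (n : ℤ) : hDown n = C (hOp n) + X * hDown (n - 1) := by
  ext1 j
  rcases j with _ | j
  · simp [hDown]
  · rw [map_add, coeff_succ_X_mul, coeff_C]
    simp only [hDown, coeff_mk, Nat.succ_ne_zero, if_false, zero_add]
    congr 1; push_cast; ring

theorem hUp_eq (n : ℤ) : hUp n = C (hOp n) + X * hUp (n + 1) := by
  ext1 j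
  rcases j with _ | j
  · simp [hUp]
  · rw [map_add, coeff_succ_X_mul, coeff_C]
    simp only [hUp, coeff_mk, Nat.succ_ne_zero, if_false, zero_add]
    congr 1; push_cast; ring

/-- The leading coefficient 1 of the factor (1−tw)/(1−w) gives the term H_n D⁺, and the constant
tail 1−t gives E_n. -/
theorem dPlus_mul_hOp (n : ℤ) :
    dPlus * C (hOp n) = C (hOp n) * dPlus + (1 - tParam) • eOp n := by
  have h := derivExp_mul_hOp isFactor_contr n
  rw [← dPlus] at h
  have h2 : (PowerSeries.mk fun b : ℕ => coeff b contrSeries • hOp (n - b)) =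
      C (hOp n) + (1 - tParam) • (X * hDown (n - 1)) := by
    ext1 j
    rcases j with _ | j
    · simp [coeff_contrSeries]
    · rw [map_add, coeff_smul, coeff_succ_X_mul, coeff_C]
      simp only [hDown, coeff_mk, Nat.succ_ne_zero, if_false, zero_add, coeff_contrSeries]
      congr 2; push_cast; ring
  rw [h, h2, add_mul, smul_mul_assoc, eOp]

/-- This is the recursion that the entry A of the monodromy matrix obeys when a site is added, with
H_n for B† and D⁺ for C̃. -/
theorem eOp_succ (n : ℤ) : eOp (n + 1) = X * (eOp n + C (hOp n) * dPlus) := by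
  rw [eOp, eOp, add_sub_cancel_right, hDown_eq n]
  simp only [add_mul, mul_add, mul_assoc]
  abel

/-- All straightening rules with larger index n, gathered in one identity; the constant coefficient
is the adjacent case. -/
theorem quadratic_series {F : ℤ → ℤ → Module.End K PolyOne} (G : ℤ → Module.End K PolyOne)
    (hF : F = fun m n => G m * G n)
    (h : ∀ m n, F m n - tParam • F (m + 1) (n - 1) + F (n - 1) (m + 1) - tParam • F n m = 0)
    (n : ℤ) :
    (PowerSeries.mk fun j : ℕ => G (n - 1 - j)) * C (G n) + (1 - tParam) •
        (X * ((PowerSeries.mk fun j : ℕ => G (n - 1 - j)) *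
          PowerSeries.mk fun j : ℕ => G (n - 1 - j))) =
      tParam • (C (G n) * PowerSeries.mk fun j : ℕ => G (n - 1 - j)) := by
  ext1 j
  rcases j with _ | j
  · have := adjacent_relation h n
    rw [hF] at this
    rw [map_add, coeff_smul, coeff_smul, coeff_zero_X_mul, coeff_mul_C, coeff_C_mul]
    simpa using this
  · have := straightening_relation h j n
    rw [hF] at this
    rw [map_add, coeff_smul, coeff_smul, coeff_succ_X_mul, coeff_mul_C, coeff_C_mul, coeff_mul]
    simp only [coeff_mk]
    rw [show n - 1 - ((j + 1 : ℕ) : ℤ) = n - 2 - j by push_cast; ring]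
    exact this

theorem hDown_mul_hOp (n : ℤ) :
    hDown (n - 1) * C (hOp n) + (1 - tParam) • (X * (hDown (n - 1) * hDown (n - 1))) =
      tParam • (C (hOp n) * hDown (n - 1)) :=
  quadratic_series hOp rfl hOp_relation n

/-- Moving D⁺ through H_n creates the term quadratic in the lower vertex operators that
`hDown_mul_hOp` absorbs. The resulting t-commutation produces the factors 1 − tʳ of the q-boson. -/
theorem eOp_mul_hOp (n : ℤ) : eOp n * C (hOp n) = tParam • (C (hOp n) * eOp n) := by
  have hX : ∀ G : PowerSeries (Module.End K PolyOne), G * X = X * G :=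
    fun G => PowerSeries.commute_X G
  have h := congrArg (fun G => X * (G * dPlus)) (hDown_mul_hOp n)
  rw [eOp, mul_assoc, dPlus_mul_hOp, eOp]
  simp only [add_mul, mul_add, smul_mul_assoc, mul_smul_comm] at h ⊢
  simp only [← mul_assoc, hX] at h ⊢
  rw [← h]


/-- Here the smaller index n is kept fixed: the straightening rule is used with larger index n + 2 +
j. -/
theorem hUp_mul_hOp (n : ℤ) :
    C (hOp n) * hUp (n + 1) + (1 - tParam) • (X * (hUp (n + 1) * hUp (n + 1))) =
      tParam • (hUp (n + 1) * C (hOp n)) := by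
  ext1 j
  have h := hOp_relation
  rcases j with _ | j
  · have := adjacent_relation (F := fun m n => hOp m * hOp n) h (n + 1)
    rw [add_sub_cancel_right] at this
    rw [map_add, coeff_smul, coeff_smul, coeff_zero_X_mul, coeff_mul_C, coeff_C_mul]
    simpa [hUp] using this
  · have := straightening_relation (F := fun m n => hOp m * hOp n) h j (n + 2 + j)
    rw [map_add, coeff_smul, coeff_smul, coeff_succ_X_mul, coeff_mul_C, coeff_C_mul, coeff_mul]
    simp only [hUp, coeff_mk]
    rw [show n + 1 + ((j + 1 : ℕ) : ℤ) = n + 2 + j by push_cast; ring]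
    rw [show n + 2 + (j : ℤ) - 2 - j = n by ring] at this
    -- The rule counts downwards from the larger index; on the antidiagonal, exchanging the two
    -- components turns this into counting upwards.
    have e : ∑ p ∈ antidiagonal j, hOp (n + 1 + p.1) * hOp (n + 1 + p.2) =
        ∑ p ∈ antidiagonal j, hOp (n + 2 + j - 1 - p.1) * hOp (n + 2 + j - 1 - p.2) := by
      rw [← Finset.sum_equiv (Equiv.prodComm ℕ ℕ) (s := antidiagonal j)
        (f := fun p => hOp (n + 1 + p.2) * hOp (n + 1 + p.1)) (by simp [add_comm]) (by simp)]
      refine Finset.sum_congr rfl fun p hp => ?_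
      have hp' := mem_antidiagonal.1 hp
      rw [show n + 1 + (p.1 : ℤ) = n + 2 + j - 1 - p.2 by omega,
        show n + 1 + (p.2 : ℤ) = n + 2 + j - 1 - p.1 by omega]
    rw [e]
    exact this

/-- Induction on the degree of q, for all n together: `hOp_q_relation` expresses q_{k+1} H_n through
q_k H_{n+1}, to which the previous degree applies. -/
theorem qMul_mul_hOp (n : ℤ) :
    qMul * C (hOp n) = (C (hOp n) + (1 - tParam) • (X * hUp (n + 1))) * qMul := by
  ext1 k
  induction k generalizing n with
  | zero =>
    have : qPoly 0 = 1 := by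
      have := qAt_zero (id : ℕ+ → ℕ+)
      rwa [qAt_id, ← Nat.cast_zero, qInt_natCast] at this
    rw [add_mul, smul_mul_assoc, map_add, coeff_smul, mul_assoc, coeff_zero_X_mul, coeff_mul_C,
      coeff_C_mul, smul_zero, add_zero, qMul, coeff_mk, this]
    refine LinearMap.ext fun f => ?_
    simp
  | succ k ih =>
    have h := hOp_q_relation (k + 1 : ℕ) n
    rw [show ((k + 1 : ℕ) : ℤ) - 1 = (k : ℕ) by push_cast; ring, qInt_natCast, qInt_natCast] at h
    have h1 := ih (n + 1)
    rw [add_mul, map_add, coeff_mul_C, coeff_C_mul, smul_mul_assoc, coeff_smul] at h1 ⊢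
    rw [mul_assoc, coeff_succ_X_mul, hUp_eq (n + 1), add_mul, map_add, coeff_C_mul, smul_add]
    have e : ∀ k, coeff k qMul = mulOp (qPoly k) := fun k => coeff_mk _ _
    rw [e] at h1 ⊢
    rw [← sub_eq_iff_eq_add'] at h1
    rw [← h1, e, ← sub_eq_zero]
    rw [← sub_eq_zero] at h
    rw [← neg_eq_zero, ← h]
    simp only [sub_smul, one_smul]
    abel

/-- Each further H_n contributes another power of t because E_n t-commutes with H_n, and (1−t)(1 + t
+ ⋯ + tʳ) = 1 − tʳ⁺¹. The counterpart in the Fock space is `lower_mul_creat_pow`. -/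
theorem dPlus_mul_hOp_pow (n : ℤ) (r : ℕ) :
    dPlus * C (hOp n) ^ (r + 1) =
      C (hOp n) ^ (r + 1) * dPlus + (1 - tParam ^ (r + 1)) • (C (hOp n) ^ r * eOp n) := by
  induction r with
  | zero => simpa using dPlus_mul_hOp n
  | succ r ih =>
    rw [pow_succ (C (hOp n)) (r + 1), ← mul_assoc, ih, add_mul, mul_assoc, dPlus_mul_hOp, smul_mul_assoc,
      mul_assoc (C (hOp n) ^ r), eOp_mul_hOp, mul_add, mul_smul_comm, mul_smul_comm, smul_smul,
      ← mul_assoc, ← mul_assoc, ← pow_succ, ← pow_succ, add_assoc, ← add_smul]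
    congr 2
    ring

/-- The part tʳ from moving E_n through H_nʳ and the part 1 − tʳ from moving D⁺ add up to 1, so no
power of t survives. -/
theorem eOp_succ_mul_hOp_pow (n : ℤ) (r : ℕ) :
    eOp (n + 1) * C (hOp n) ^ r = X * (C (hOp n) ^ r * (eOp n + C (hOp n) * dPlus)) := by
  have h1 : eOp n * C (hOp n) ^ r = tParam ^ r • (C (hOp n) ^ r * eOp n) := by
    induction r with
    | zero => simp
    | succ r ih =>
      rw [pow_succ, ← mul_assoc, ih, smul_mul_assoc, mul_assoc, eOp_mul_hOp, mul_smul_comm,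
        smul_smul, ← pow_succ, mul_assoc]
  rw [eOp_succ, mul_assoc, add_mul, mul_assoc, h1]
  rcases r with _ | r
  · simp
  · have hc : ∀ G, C (hOp n) ^ r * (C (hOp n) * G) = C (hOp n) * (C (hOp n) ^ r * G) := by
      intro G
      rw [← mul_assoc, ← pow_succ, pow_succ', mul_assoc]
    rw [dPlus_mul_hOp_pow]
    simp only [pow_succ' (C (hOp n)), mul_add, mul_smul_comm, mul_assoc, sub_smul, one_smul, mul_sub, hc]
    abel

/-- `∑_{j≥0} zʲ H_{n+j}`, transported through powers of `Hₙ`. -/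
theorem qMul_mul_hOp_pow (n : ℤ) (r : ℕ) :
    ∃ Y : PowerSeries (Module.End K PolyOne), qMul * C (hOp n) ^ (r + 1) = Y * qMul ∧
      Y = tParam ^ (r + 1) • C (hOp n) ^ (r + 1) +
        (1 - tParam ^ (r + 1)) • (hUp n * C (hOp n) ^ r) ∧
      Y * hUp n = hUp n * C (hOp n) ^ (r + 1) := by
  set H := C (hOp n)
  set S := hUp n
  -- Conjugation by q(z) turns H into Y₁, hence Hʳ⁺¹ into Y₁ʳ⁺¹. The exchange Y₁ S = S H, which
  -- encodes `hUp_mul_hOp`, collapses these powers to the two terms claimed.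
  set Y₁ : PowerSeries (Module.End K PolyOne) := tParam • H + (1 - tParam) • S with hY₁
  have hX : ∀ G : PowerSeries (Module.End K PolyOne), G * X = X * G :=
    fun G => PowerSeries.commute_X G
  have hS : S = H + X * hUp (n + 1) := hUp_eq n
  have h1 : qMul * H = Y₁ * qMul := by
    rw [qMul_mul_hOp, hY₁, hS]
    congr 1
    simp only [smul_add, sub_smul, one_smul]
    abel
  have h2 : Y₁ * S = S * H := by
    have h := congrArg (X * ·) (hUp_mul_hOp n)
    rw [hY₁, hS]
    change X * (H * _ + _) = X * (_ • (_ * H)) at h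
    simp only [mul_add, add_mul, smul_mul_assoc, mul_smul_comm, smul_add, ← mul_assoc, hX,
      sub_smul, one_smul, mul_sub, sub_mul] at h ⊢
    rw [← sub_eq_zero] at h ⊢
    rw [← h]
    abel
  induction r with
  | zero => exact ⟨Y₁, by simpa using h1, by simp [hY₁], by simpa using h2⟩
  | succ r ih =>
    obtain ⟨Y, hq, hY, hYS⟩ := ih
    refine ⟨Y₁ * Y, ?_, ?_, ?_⟩
    · rw [pow_succ', ← mul_assoc, h1, mul_assoc, hq, mul_assoc]
    · rw [hY, mul_add, mul_smul_comm, mul_smul_comm, ← mul_assoc, h2, mul_assoc, ← pow_succ', hY₁,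
        add_mul, smul_mul_assoc, smul_mul_assoc, ← pow_succ', smul_add, smul_smul, smul_smul,
        add_assoc, ← add_smul]
      congr 2
      ring
    · rw [mul_assoc, hYS, ← mul_assoc, h2, mul_assoc, ← pow_succ']

end

end CoupledHL

namespace CoupledHL

noncomputable section

open PowerSeries

/-! ### Expansion of raising operators -/

/-- The pairs `i < j` in `Fin l`. -/
abbrev Pairs (l : ℕ) : Type := {p : Fin l × Fin l // p.1 < p.2}

/-- The pairs in `Fin (l + 1)` are the pairs `0 < j` and the pairs of successors. -/
def pairsEquiv (l : ℕ) : Fin l ⊕ Pairs l ≃ Pairs (l + 1) where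
  toFun := Sum.elim (fun j => ⟨(0, j.succ), Fin.succ_pos j⟩)
    (fun p => ⟨(p.1.1.succ, p.1.2.succ), Fin.succ_lt_succ_iff.2 p.2⟩)
  invFun p := if h : p.1.1 = 0 then
      Sum.inl (p.1.2.pred fun h' => by have := p.2; rw [h, h'] at this; exact lt_irrefl _ this)
    else Sum.inr ⟨(p.1.1.pred h, p.1.2.pred fun h' => by
      have := p.2; rw [h'] at this; exact Fin.not_lt_zero _ this), by simpa using p.2⟩
  left_inv := by
    rintro (j | ⟨⟨i, j⟩, h⟩) <;> simp
  right_inv := by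
    rintro ⟨⟨i, j⟩, h⟩
    by_cases hi : i = 0
    · subst hi; simp
    · simp [hi]

/-- Exponents of the raising operators, split by the first index. -/
def raiseExpEquiv (l : ℕ) : (Fin l → ℕ) × RaiseExp l ≃ RaiseExp (l + 1) :=
  (Equiv.sumArrowEquivProdArrow _ _ _).symm.trans (Equiv.arrowCongr (pairsEquiv l) (Equiv.refl ℕ))

theorem raiseExpEquiv_apply {l : ℕ} (w : (Fin l → ℕ) × RaiseExp l) (s : Fin l ⊕ Pairs l) :
    raiseExpEquiv l w (pairsEquiv l s) = Sum.elim w.1 w.2 s := by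
  simp [raiseExpEquiv, Equiv.sumArrowEquivProdArrow]

theorem raiseExpEquiv_zero {l : ℕ} (w : (Fin l → ℕ) × RaiseExp l) (j : Fin l) (h) :
    raiseExpEquiv l w ⟨(0, j.succ), h⟩ = w.1 j := raiseExpEquiv_apply w (Sum.inl j)

theorem raiseExpEquiv_succ {l : ℕ} (w : (Fin l → ℕ) × RaiseExp l) (p : Pairs l) (h) :
    raiseExpEquiv l w ⟨(p.1.1.succ, p.1.2.succ), h⟩ = w.2 p := raiseExpEquiv_apply w (Sum.inr p)

/-- The vector obtained from `α` by `∏_{i<j} R_{ij}^{e_{ij}}`. -/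
def raiseVec {l : ℕ} (α : Fin l → ℤ) (e : RaiseExp l) (i : Fin l) : ℤ :=
  α i + ∑ p, (if p.1.1 = i then (e p : ℤ) else 0) - ∑ p, (if p.1.2 = i then (e p : ℤ) else 0)

theorem raiseVec_zero {l : ℕ} (α : Fin (l + 1) → ℤ) (w : (Fin l → ℕ) × RaiseExp l) :
    raiseVec α (raiseExpEquiv l w) 0 = α 0 + ∑ j, (w.1 j : ℤ) := by
  have h : ∀ F : Pairs (l + 1) → ℤ, ∑ p, F p = ∑ s, F (pairsEquiv l s) :=
    fun F => (Equiv.sum_comp (pairsEquiv l) F).symm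
  rw [raiseVec, h, h]
  simp only [raiseExpEquiv_zero, raiseExpEquiv_succ, Fintype.sum_sum_type, pairsEquiv, Equiv.coe_fn_mk, Sum.elim_inl,
    Sum.elim_inr, Fin.succ_ne_zero, if_true, if_false]
  simp

theorem raiseVec_succ {l : ℕ} (α : Fin (l + 1) → ℤ) (w : (Fin l → ℕ) × RaiseExp l) (i : Fin l) :
    raiseVec α (raiseExpEquiv l w) i.succ = raiseVec (fun j => α j.succ) w.2 i - w.1 i := by
  have h : ∀ F : Pairs (l + 1) → ℤ, ∑ p, F p = ∑ s, F (pairsEquiv l s) :=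
    fun F => (Equiv.sum_comp (pairsEquiv l) F).symm
  rw [raiseVec, h, h]
  simp only [raiseExpEquiv_zero, raiseExpEquiv_succ, Fintype.sum_sum_type, pairsEquiv, Equiv.coe_fn_mk, Sum.elim_inl,
    Sum.elim_inr, Fin.succ_inj, (Fin.succ_ne_zero _).symm, if_false]
  rw [raiseVec]
  simp
  ring

/-- An operator R_{0j} only lowers entry j. Nonnegativity therefore forces the raised tail to be
nonnegative, with finitely many possibilities by induction, and bounds the exponent of R_{0j} by the
j-th entry of that tail. -/
theorem finite_raiseVec_nonneg {l : ℕ} (α : Fin l → ℤ) :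
    {e : RaiseExp l | ∀ i, 0 ≤ raiseVec α e i}.Finite := by
  induction l with
  | zero =>
    have : IsEmpty (Pairs 0) := ⟨fun p => p.1.1.elim0⟩
    exact Set.toFinite _
  | succ l ih =>
    set S := {e : RaiseExp l | ∀ i, 0 ≤ raiseVec (fun j => α j.succ) e i}
    have hS : S.Finite := ih _
    have hT : (⋃ e ∈ S, (fun f : Fin l → ℕ => raiseExpEquiv l (f, e)) ''
        Set.Iic fun j => (raiseVec (fun j => α j.succ) e j).toNat).Finite :=
      hS.biUnion fun e _ => (Set.finite_Iic _).image _
    refine hT.subset fun e he => ?_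
    obtain ⟨w, rfl⟩ := (raiseExpEquiv l).surjective e
    have h : ∀ i, (w.1 i : ℤ) ≤ raiseVec (fun j => α j.succ) w.2 i := by
      intro i
      have := he i.succ
      rw [raiseVec_succ] at this
      omega
    refine Set.mem_biUnion (x := w.2) (fun i => ?_) ⟨w.1, fun i => ?_, rfl⟩
    · have := h i; omega
    · have := h i
      show w.1 i ≤ (raiseVec (fun j => α j.succ) w.2 i).toNat
      omega

theorem prod_qAt_eq_zero {σ : Type*} (v : ℕ+ → σ) {l : ℕ} {α : Fin l → ℤ}
    (h : ¬ ∀ i, 0 ≤ α i) : ∏ i, qAt v (α i) = 0 := by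
  push Not at h
  obtain ⟨i, hi⟩ := h
  exact Finset.prod_eq_zero (Finset.mem_univ i) (qAt_of_neg v hi)

/-- Expansion of the product of the substituted factors. The box of side N loses nothing, since
q_{β−a} = 0 for a ≥ N. -/
theorem coeff_derivExp_prod_qAt {σ : Type*} {v : ℕ+ → σ} (hv : Function.Injective v) {κ : ℕ → K}
    {γ : PowerSeries K} (hγ : IsFactor κ γ) {l : ℕ} (β : Fin l → ℤ) {N : ℕ} (hN : ∀ j, β j < N)
    (k : ℕ) : coeff k (derivExp v κ) (∏ j, qAt v (β j)) =
      ∑ f ∈ Fintype.piFinset (fun _ : Fin l => Finset.range N), if ∑ j, f j = k then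
        (∏ j, coeff (f j) γ) • ∏ j, qAt v (β j - f j) else 0 := by
  have h1 : ∀ j, taylor v κ (qAt v (β j)) = ∑ a ∈ Finset.range N,
      Polynomial.monomial a (coeff a γ • qAt v (β j - a)) := by
    intro j
    refine Polynomial.ext fun k => ?_
    rw [coeff_taylor_qAt hv hγ, Polynomial.finsetSum_coeff]
    simp only [Polynomial.coeff_monomial, Finset.sum_ite_eq']
    split_ifs with h
    · rfl
    · rw [qAt_of_neg v, smul_zero]
      have := hN j
      rw [Finset.mem_range] at h; omega
  rw [← coeff_taylor hv, map_prod]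
  simp only [h1]
  rw [Finset.prod_univ_sum, Polynomial.finsetSum_coeff]
  refine Finset.sum_congr rfl fun f _ => ?_
  have h2 : ∀ s : Finset (Fin l), ∏ j ∈ s,
      Polynomial.monomial (f j) (coeff (f j) γ • qAt v (β j - f j)) =
      Polynomial.monomial (∑ j ∈ s, f j) ((∏ j ∈ s, coeff (f j) γ) •
        ∏ j ∈ s, qAt v (β j - f j)) := by
    intro s
    induction s using Finset.cons_induction with
    | empty => simp
    | cons a s ha ih =>
      rw [Finset.prod_cons, ih, Polynomial.monomial_mul_monomial, Finset.sum_cons,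
        Finset.prod_cons, Finset.prod_cons, smul_mul_smul_comm]
  rw [h2, Polynomial.coeff_monomial]

/-- A sum of operators composed with an exponential of derivations, on a product of `qₙ`. -/
theorem sum_derivExp_prod_qAt {σ : Type*} {v : ℕ+ → σ} (hv : Function.Injective v) {κ : ℕ → K}
    {γ : PowerSeries K} (hγ : IsFactor κ γ) {l : ℕ} (β : Fin l → ℤ)
    (φ : ℕ → Module.End K (MvPolynomial σ K)) {M : ℕ}
    (hM : ∀ k, M ≤ k → coeff k (derivExp v κ) (∏ j, qAt v (β j)) = 0) :
    ∑ k ∈ Finset.range M, φ k (coeff k (derivExp v κ) (∏ j, qAt v (β j))) =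
      ∑ᶠ f : Fin l → ℕ, (∏ j, coeff (f j) γ) • φ (∑ j, f j) (∏ j, qAt v (β j - f j)) := by
  obtain ⟨N, hN⟩ : ∃ N : ℕ, ∀ j, β j < N := by
    refine ⟨(∑ j, (β j).toNat) + 1, fun j => ?_⟩
    have := Finset.single_le_sum (f := fun j => (β j).toNat) (fun _ _ => Nat.zero_le _)
      (Finset.mem_univ j)
    omega
  -- The range is enlarged to contain ∑ f_j for every f in the box of side N, so each f is counted
  -- exactly once.
  have h1 : ∑ k ∈ Finset.range M, φ k (coeff k (derivExp v κ) (∏ j, qAt v (β j))) =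
      ∑ k ∈ Finset.range (M + l * N + 1),
        φ k (coeff k (derivExp v κ) (∏ j, qAt v (β j))) := by
    refine Finset.sum_subset (fun a ha => ?_) fun k _ hk => ?_
    · simp only [Finset.mem_range] at ha ⊢; omega
    · rw [hM k (by simpa using hk), map_zero]
  rw [h1, finsum_eq_sum_of_support_subset (s := Fintype.piFinset fun _ => Finset.range N)]
  · simp only [coeff_derivExp_prod_qAt hv hγ β hN, map_sum]
    rw [Finset.sum_comm]
    refine Finset.sum_congr rfl fun f hf => ?_
    rw [Finset.sum_eq_single (∑ j, f j)]
    · rw [if_pos rfl, map_smul]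
    · intro b _ hb
      rw [if_neg hb.symm, map_zero]
    · intro h
      refine absurd (Finset.mem_range.2 ?_) h
      have : ∑ j, f j ≤ ∑ _j : Fin l, N := Finset.sum_le_sum fun j _ => by
        have := Fintype.mem_piFinset.1 hf j
        exact (Finset.mem_range.1 this).le
      simp only [Finset.sum_const, Finset.card_univ, Fintype.card_fin, smul_eq_mul] at this
      omega
  · intro f hf
    rw [Finset.mem_coe, Fintype.mem_piFinset]
    intro j
    rw [Finset.mem_range]
    by_contra hj
    refine hf ?_
    have : ∏ j, qAt v (β j - f j) = 0 := prod_qAt_eq_zero v (α := fun j => β j - f j) fun h => by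
      have := h j; have := hN j; omega
    simp only [this, map_zero, smul_zero]

/-- The function `∏_{i<j} (1 - R_{ij}) / (1 - t R_{ij}) q_α` for an integer vector `α`. -/
def vecQ {l : ℕ} (α : Fin l → ℤ) : PolyOne :=
  ∑ᶠ e : RaiseExp l, (∏ p, raiseCoeff (e p)) • ∏ i, qInt (raiseVec α e i)

theorem hallQ_eq_vecQ (lam : YoungDiagram) :
    hallQ lam = vecQ fun i => (lam.rowLens.get i : ℤ) := rfl

theorem prod_qInt_eq_zero {l : ℕ} {α : Fin l → ℤ} (h : ¬ ∀ i, 0 ≤ α i) :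
    ∏ i, qInt (α i) = 0 := by
  have := prod_qAt_eq_zero (id : ℕ+ → ℕ+) h
  simpa only [qAt_id] using! this

theorem finite_support_vecQ {l : ℕ} (α : Fin l → ℤ) : (Function.support fun e : RaiseExp l =>
    (∏ p, raiseCoeff (e p)) • ∏ i, qInt (raiseVec α e i)).Finite := by
  refine (finite_raiseVec_nonneg α).subset fun e he => ?_
  by_contra h
  refine he ?_
  simp only [prod_qInt_eq_zero (α := raiseVec α e) h, smul_zero]

theorem vecQ_zero (α : Fin 0 → ℤ) : vecQ α = 1 := by
  have : IsEmpty (Pairs 0) := ⟨fun p => p.1.1.elim0⟩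
  rw [vecQ, finsum_unique]
  simp

theorem hOp_prod_qInt {l : ℕ} (n : ℤ) (β : Fin l → ℤ) : hOp n (∏ j, qInt (β j)) =
    ∑ᶠ f : Fin l → ℕ, (∏ j, raiseCoeff (f j)) •
      (qInt (n + ∑ j, (f j : ℤ)) * ∏ j, qInt (β j - f j)) := by
  obtain ⟨N, hN⟩ := exists_dMinus_eq_zero (∏ j, qInt (β j))
  rw [hOp_apply n hN]
  have h := sum_derivExp_prod_qAt (v := (id : ℕ+ → ℕ+)) Function.injective_id isFactor_raise β
    (fun k => mulOp (qInt (n + k))) (M := N)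
    (by simp only [qAt_id]; exact hN)
  simp only [qAt_id, LinearMap.mulLeft_apply, Nat.cast_sum] at h
  exact h

/-- The recursion of Hall-Littlewood functions by vertex operators. -/
theorem vecQ_succ {l : ℕ} (α : Fin (l + 1) → ℤ) :
    vecQ α = hOp (α 0) (vecQ fun j => α j.succ) := by
  -- The exponents split into those of R_{0j} and those of the tail. The derivations inside the
  -- leading vertex operator, acting on the tail product, produce exactly the factors belonging to
  -- the R_{0j}.
  have hfin := (finite_support_vecQ α).preimage
    (((Equiv.prodComm _ _).trans (raiseExpEquiv l)).injective.injOn)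
  have e : ∀ w : RaiseExp l × (Fin l → ℕ),
      (∏ p, raiseCoeff (((Equiv.prodComm _ _).trans (raiseExpEquiv l)) w p)) •
        ∏ i, qInt (raiseVec α (((Equiv.prodComm _ _).trans (raiseExpEquiv l)) w) i) =
      (∏ p, raiseCoeff (w.1 p)) • ((∏ j, raiseCoeff (w.2 j)) •
        (qInt (α 0 + ∑ j, (w.2 j : ℤ)) *
          ∏ j, qInt (raiseVec (fun j => α j.succ) w.1 j - w.2 j))) := by
    rintro ⟨e', f⟩
    simp only [Equiv.trans_apply, Equiv.prodComm_apply, Prod.swap_prod_mk]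
    rw [Fin.prod_univ_succ, raiseVec_zero, ← Equiv.prod_comp (pairsEquiv l)]
    simp only [raiseVec_succ, raiseExpEquiv_apply, Fintype.prod_sum_type, Sum.elim_inl,
      Sum.elim_inr, smul_smul]
    rw [mul_comm (∏ j, raiseCoeff (f j))]
  rw [vecQ, ← finsum_comp_equiv ((Equiv.prodComm _ _).trans (raiseExpEquiv l)), finsum_curry _ hfin,
    vecQ, map_finsum _ (finite_support_vecQ _)]
  refine finsum_congr fun e' => ?_
  simp only [e]
  rw [← smul_finsum, map_smul, hOp_prod_qInt]

/-- The Hall-Littlewood function of a list of rows, as an iterated vertex operator. -/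
theorem vecQ_get (w : List ℕ) :
    vecQ (fun i => (w.get i : ℤ)) = w.foldr (fun (n : ℕ) f => hOp (n : ℤ) f) 1 := by
  induction w with
  | nil => exact vecQ_zero _
  | cons n w ih => rw [vecQ_succ, List.foldr_cons, ← ih]; rfl

theorem hallQ_eq_foldr (lam : YoungDiagram) :
    hallQ lam = lam.rowLens.foldr (fun (n : ℕ) f => hOp (n : ℤ) f) 1 := by
  rw [hallQ_eq_vecQ, vecQ_get]

end

end CoupledHL

namespace CoupledHL

noncomputable section

open PowerSeries
open scoped TensorProduct

/-! ### The twisting automorphism of `ℂ(t)[𝐱,𝐲]` -/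

open scoped IsMulCommutative in
/-- Evaluation of a polynomial at pairwise commuting elements of an algebra. -/
def evalComm {σ A : Type*} [Ring A] [Algebra K A] (a : σ → A)
    (h : ∀ n m, a n * a m = a m * a n) : MvPolynomial σ K →ₐ[K] A :=
  haveI : IsMulCommutative (Algebra.adjoin K (Set.range a)) :=
    Algebra.isMulCommutative_adjoin K (by rintro _ ⟨n, rfl⟩ _ ⟨m, rfl⟩; exact h n m)
  (Algebra.adjoin K (Set.range a)).val.comp
    (MvPolynomial.aeval (R := K) fun n =>
      (⟨a n, Algebra.subset_adjoin ⟨n, rfl⟩⟩ : Algebra.adjoin K (Set.range a)))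

open scoped IsMulCommutative in
theorem evalComm_X {σ A : Type*} [Ring A] [Algebra K A] (a : σ → A)
    (h : ∀ n m, a n * a m = a m * a n) (n : σ) :
    evalComm a h (MvPolynomial.X n) = a n := by
  simp [evalComm]

/-- The index of a variable within its family. -/
def varIdx (s : ℕ+ ⊕ ℕ+) : ℕ+ := Sum.elim id id s

/-- The operator `(1/n) ∂/∂s`, where `n` is the index of the variable `s`. -/
def varDeriv (s : ℕ+ ⊕ ℕ+) : Module.End K PolyTwo :=
  ((varIdx s : ℕ) : K)⁻¹ • (MvPolynomial.pderiv s : Derivation K PolyTwo PolyTwo).toLinearMap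

theorem dTilde_inl (n : ℕ+) : dTilde Sum.inl n = varDeriv (Sum.inl n) := rfl

theorem dTilde_inr (n : ℕ+) : dTilde Sum.inr n = varDeriv (Sum.inr n) := rfl

theorem varDeriv_X_mul (r s : ℕ+ ⊕ ℕ+) (f : PolyTwo) :
    varDeriv r (MvPolynomial.X s * f) = MvPolynomial.X s * varDeriv r f +
      if r = s then ((varIdx s : ℕ) : K)⁻¹ • f else 0 := by
  simp only [varDeriv, LinearMap.smul_apply, Derivation.coeFn_coe,
    Derivation.leibniz, MvPolynomial.pderiv_X, smul_add, Pi.single_apply, smul_eq_mul]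
  rw [mul_smul_comm]
  congr 1
  by_cases h : r = s
  · subst h; simp
  · rw [if_neg h, if_neg (fun h' => h h'.symm)]; simp

theorem varDeriv_comm (r s : ℕ+ ⊕ ℕ+) (f : PolyTwo) :
    varDeriv r (varDeriv s f) = varDeriv s (varDeriv r f) := by
  simp only [varDeriv, LinearMap.smul_apply, Derivation.coeFn_coe, map_smul]
  rw [pderiv_comm r s, smul_comm]

/-- The operators `xₙ + ε (1/n) ∂/∂yₙ` and `yₙ + ε (1/n) ∂/∂xₙ`. -/
def twistShift (ε : K) (s : ℕ+ ⊕ ℕ+) : Module.End K PolyTwo :=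
  mulOp (MvPolynomial.X s) + ε • varDeriv s.swap

theorem twistShift_apply (ε : K) (s : ℕ+ ⊕ ℕ+) (f : PolyTwo) :
    twistShift ε s f = MvPolynomial.X s * f + ε • varDeriv s.swap f := rfl

/-- The only possible obstruction is the pair x_n, y_n, where the two cross commutators are both ε/n
and cancel. -/
theorem twistShift_comm (ε : K) (r s : ℕ+ ⊕ ℕ+) :
    twistShift ε r * twistShift ε s = twistShift ε s * twistShift ε r := by
  refine LinearMap.ext fun f => ?_
  have h : (if r.swap = s then ((varIdx s : ℕ) : K)⁻¹ • f else 0) =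
      if s.swap = r then ((varIdx r : ℕ) : K)⁻¹ • f else 0 := by
    by_cases h : r.swap = s
    · subst h
      have : varIdx r.swap = varIdx r := by cases r <;> rfl
      simp [this]
    · rw [if_neg h, if_neg fun h' => h (by rw [← h', Sum.swap_swap])]
  simp only [Module.End.mul_apply, twistShift_apply, map_add, map_smul, varDeriv_X_mul, smul_add,
    varDeriv_comm r.swap s.swap, h]
  rw [mul_left_comm]
  abel

/-- The linear map `F ↦ F(𝐱 + ε ∂̃_𝐲, 𝐲 + ε ∂̃_𝐱) · 1`. -/
def twist (ε : K) : Module.End K PolyTwo :=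
  (LinearMap.applyₗ (1 : PolyTwo)) ∘ₗ (evalComm (twistShift ε) (twistShift_comm ε)).toLinearMap

theorem twist_apply (ε : K) (f : PolyTwo) :
    twist ε f = evalComm (twistShift ε) (twistShift_comm ε) f 1 := rfl

theorem twist_C (ε : K) (c : K) : twist ε (MvPolynomial.C c) = MvPolynomial.C c := by
  rw [twist_apply, ← MvPolynomial.algebraMap_eq, AlgHom.commutes, Module.algebraMap_end_apply,
    Algebra.smul_def, mul_one]

theorem twist_one (ε : K) : twist ε 1 = 1 := by
  have := twist_C ε 1
  rwa [map_one] at this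

theorem twist_X_mul (ε : K) (s : ℕ+ ⊕ ℕ+) (f : PolyTwo) :
    twist ε (MvPolynomial.X s * f) = twistShift ε s (twist ε f) := by
  rw [twist_apply, map_mul, evalComm_X]; rfl

/-- A derivation has the same commutator with the shifted variable as with the variable itself,
because derivations commute with each other. -/
theorem varDeriv_twist (ε : K) (r : ℕ+ ⊕ ℕ+) (f : PolyTwo) :
    varDeriv r (twist ε f) = twist ε (varDeriv r f) := by
  induction f using MvPolynomial.induction_on with
  | C a => rw [twist_C]; simp [varDeriv]
  | add p q hp hq => simp only [map_add, hp, hq]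
  | mul_X p s hp =>
    rw [mul_comm, twist_X_mul, varDeriv_X_mul, map_add, twist_X_mul, twistShift_apply,
      twistShift_apply, map_add, map_smul, varDeriv_X_mul, varDeriv_comm r, hp]
    split_ifs
    · rw [map_smul]; abel
    · rw [map_zero]; abel

/-- Twists commute with derivations, so on multiplication by a variable the two parameters add.
Opposite parameters give inverse maps. -/
theorem twist_twist {ε ε' : K} (h : ε + ε' = 0) (f : PolyTwo) : twist ε (twist ε' f) = f := by
  induction f using MvPolynomial.induction_on with
  | C a => rw [twist_C, twist_C]
  | add p q hp hq => simp only [map_add, hp, hq]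
  | mul_X p s hp =>
    rw [mul_comm, twist_X_mul, twistShift_apply, map_add, map_smul, twist_X_mul, twistShift_apply,
      varDeriv_twist, varDeriv_twist, hp, ← varDeriv_twist, ← varDeriv_twist, hp, add_assoc,
      ← add_smul, h, zero_smul, add_zero]

/-- The automorphism `F ↦ F(𝐱 - ∂̃_𝐲, 𝐲 - ∂̃_𝐱) · 1`. -/
def twistEquiv : PolyTwo ≃ₗ[K] PolyTwo where
  toLinearMap := twist (-1)
  invFun := twist 1
  left_inv := twist_twist (add_neg_cancel 1)
  right_inv := twist_twist (neg_add_cancel 1)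

theorem twistEquiv_apply (f : PolyTwo) : twistEquiv f = twist (-1) f := rfl

theorem xShift_eq (n : ℕ+) : xShift n = twistShift (-1) (Sum.inl n) := by
  have h : (-1 : K) • varDeriv (Sum.inr n) = -varDeriv (Sum.inr n) := by
    refine eq_neg_of_add_eq_zero_left ?_
    rw [← one_smul K (varDeriv (Sum.inr n)), smul_smul, ← add_smul, mul_one, neg_add_cancel,
      zero_smul]
  rw [xShift, twistShift, Sum.swap_inl, h, ← sub_eq_add_neg]; rfl

theorem yShift_eq (n : ℕ+) : yShift n = twistShift (-1) (Sum.inr n) := by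
  have h : (-1 : K) • varDeriv (Sum.inl n) = -varDeriv (Sum.inl n) := by
    refine eq_neg_of_add_eq_zero_left ?_
    rw [← one_smul K (varDeriv (Sum.inl n)), smul_smul, ← add_smul, mul_one, neg_add_cancel,
      zero_smul]
  rw [yShift, twistShift, Sum.swap_inr, h, ← sub_eq_add_neg]; rfl

theorem atX_X (n : ℕ+) : atX (MvPolynomial.X n) = xShift n := commEval_X _ _ n

theorem atY_X (n : ℕ+) : atY (MvPolynomial.X n) = yShift n := commEval_X _ _ n

/-- The twist carries multiplication by x_n to x_n − ∂̃_{y_n}, hence multiplication by p(x) to p(x −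
∂̃_y). -/
theorem atX_twist (p : PolyOne) (f : PolyTwo) :
    atX p (twistEquiv f) = twistEquiv (MvPolynomial.rename Sum.inl p * f) := by
  induction p using MvPolynomial.induction_on generalizing f with
  | C a =>
    rw [← MvPolynomial.algebraMap_eq, AlgHom.commutes, Module.algebraMap_end_apply,
      AlgHom.commutes, ← Algebra.smul_def, map_smul]
  | add p q hp hq => simp only [map_add, add_mul, LinearMap.add_apply, hp, hq]
  | mul_X p n hp =>
    rw [mul_comm p, map_mul, atX_X, Module.End.mul_apply, hp, map_mul (MvPolynomial.rename _),
      MvPolynomial.rename_X,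
      mul_assoc, xShift_eq, twistEquiv_apply, twistEquiv_apply, twist_X_mul]

theorem atY_twist (p : PolyOne) (f : PolyTwo) :
    atY p (twistEquiv f) = twistEquiv (MvPolynomial.rename Sum.inr p * f) := by
  induction p using MvPolynomial.induction_on generalizing f with
  | C a =>
    rw [← MvPolynomial.algebraMap_eq, AlgHom.commutes, Module.algebraMap_end_apply,
      AlgHom.commutes, ← Algebra.smul_def, map_smul]
  | add p q hp hq => simp only [map_add, add_mul, LinearMap.add_apply, hp, hq]
  | mul_X p n hp =>
    rw [mul_comm p, map_mul, atY_X, Module.End.mul_apply, hp, map_mul (MvPolynomial.rename _),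
      MvPolynomial.rename_X,
      mul_assoc, yShift_eq, twistEquiv_apply, twistEquiv_apply, twist_X_mul]

theorem cross_eq_twist (f g : PolyOne) : atX f (atY g 1) =
    twistEquiv (MvPolynomial.rename Sum.inl f * MvPolynomial.rename Sum.inr g) := by
  have h1 : twistEquiv 1 = 1 := twist_one (-1)
  rw [← h1, atY_twist, atX_twist, mul_one]

/-- The isomorphism `f ⊗ g ↦ f(𝐱 - ∂̃_𝐲) g(𝐲 - ∂̃_𝐱) · 1`. -/
def crossEquiv : PolyOne ⊗[K] PolyOne ≃ₗ[K] PolyTwo :=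
  (MvPolynomial.tensorEquivSum K ℕ+ ℕ+ K).toLinearEquiv.trans twistEquiv

theorem tensorEquivSum_tmul (f g : PolyOne) : MvPolynomial.tensorEquivSum K ℕ+ ℕ+ K (f ⊗ₜ g) =
    MvPolynomial.rename Sum.inl f * MvPolynomial.rename Sum.inr g := by
  have h1 : ((MvPolynomial.tensorEquivSum K ℕ+ ℕ+ K).toAlgHom.comp
      (Algebra.TensorProduct.includeLeft : PolyOne →ₐ[K] PolyOne ⊗[K] PolyOne)) =
      MvPolynomial.rename Sum.inl := by
    refine MvPolynomial.algHom_ext fun n => ?_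
    simp
  have h2 : ((MvPolynomial.tensorEquivSum K ℕ+ ℕ+ K).toAlgHom.comp
      (Algebra.TensorProduct.includeRight : PolyOne →ₐ[K] PolyOne ⊗[K] PolyOne)) =
      MvPolynomial.rename Sum.inr := by
    refine MvPolynomial.algHom_ext fun n => ?_
    simp
  rw [← h1, ← h2, ← mul_one f, ← one_mul g, ← Algebra.TensorProduct.tmul_mul_tmul, map_mul]
  simp

theorem crossEquiv_tmul (f g : PolyOne) : crossEquiv (f ⊗ₜ g) = atX f (atY g 1) := by
  rw [cross_eq_twist, ← tensorEquivSum_tmul]; rfl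

/-- The vectors f(x − ∂̃_y) g(y − ∂̃_x)·1 span, being the images of pure tensors under an
isomorphism; this gives uniqueness of the substituted operators. -/
theorem cross_ext {W : Type*} [AddCommGroup W] [Module K W] {U V : PolyTwo →ₗ[K] W}
    (h : ∀ f g : PolyOne, U (atX f (atY g 1)) = V (atX f (atY g 1))) : U = V := by
  have : U ∘ₗ crossEquiv.toLinearMap = V ∘ₗ crossEquiv.toLinearMap := by
    refine TensorProduct.ext' fun f g => ?_
    simp only [LinearMap.comp_apply, LinearEquiv.coe_coe, crossEquiv_tmul, h]
  refine LinearMap.ext fun f => ?_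
  have h2 := LinearMap.congr_fun this (crossEquiv.symm f)
  simpa using h2

/-- The operator `S(𝐱 - ∂̃_𝐲)`. -/
def rhoX : Module.End K PolyOne →ₐ[K] Module.End K PolyTwo :=
  ((crossEquiv.conjAlgEquiv K : _ ≃ₐ[K] _) : _ →ₐ[K] _).comp
    (Module.End.rTensorAlgHom K PolyOne PolyOne)

/-- The operator `S(𝐲 - ∂̃_𝐱)`. -/
def rhoY : Module.End K PolyOne →ₐ[K] Module.End K PolyTwo :=
  ((crossEquiv.conjAlgEquiv K : _ ≃ₐ[K] _) : _ →ₐ[K] _).comp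
    (Module.End.lTensorAlgHom K PolyOne PolyOne)

theorem rhoX_cross (S : Module.End K PolyOne) (f g : PolyOne) :
    rhoX S (atX f (atY g 1)) = atX (S f) (atY g 1) := by
  rw [← crossEquiv_tmul, ← crossEquiv_tmul]
  change crossEquiv ((S.rTensor PolyOne) (crossEquiv.symm (crossEquiv (f ⊗ₜ g)))) = _
  rw [LinearEquiv.symm_apply_apply, LinearMap.rTensor_tmul]

theorem rhoY_cross (S : Module.End K PolyOne) (f g : PolyOne) :
    rhoY S (atX f (atY g 1)) = atX f (atY (S g) 1) := by
  rw [← crossEquiv_tmul, ← crossEquiv_tmul]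
  change crossEquiv ((S.lTensor PolyOne) (crossEquiv.symm (crossEquiv (f ⊗ₜ g)))) = _
  rw [LinearEquiv.symm_apply_apply, LinearMap.lTensor_tmul]

theorem isSubstX_iff (S : Module.End K PolyOne) (U : Module.End K PolyTwo) :
    IsSubstX S U ↔ U = rhoX S :=
  ⟨fun h => cross_ext fun f g => by rw [h, rhoX_cross], fun h => h ▸ rhoX_cross S⟩

theorem isSubstY_iff (S : Module.End K PolyOne) (U : Module.End K PolyTwo) :
    IsSubstY S U ↔ U = rhoY S :=
  ⟨fun h => cross_ext fun f g => by rw [h, rhoY_cross], fun h => h ▸ rhoY_cross S⟩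

theorem rhoX_mulOp (p : PolyOne) : rhoX (mulOp p) = atX p := by
  refine cross_ext fun f g => ?_
  rw [rhoX_cross, LinearMap.mulLeft_apply, map_mul, Module.End.mul_apply]

theorem rhoY_mulOp (p : PolyOne) : rhoY (mulOp p) = atY p := by
  refine cross_ext fun f g => ?_
  rw [rhoY_cross, LinearMap.mulLeft_apply, cross_eq_twist, cross_eq_twist, atY_twist, map_mul (MvPolynomial.rename _)]
  refine congrArg twistEquiv ?_
  ring

theorem pderiv_rename_of_ne {v : ℕ+ → ℕ+ ⊕ ℕ+} {s : ℕ+ ⊕ ℕ+} (h : ∀ n, v n ≠ s) (f : PolyOne) :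
    MvPolynomial.pderiv s (MvPolynomial.rename v f : PolyTwo) = 0 := by
  induction f using MvPolynomial.induction_on with
  | C a => simp
  | add p q hp hq => rw [map_add, map_add, hp, hq, add_zero]
  | mul_X p n hp =>
    rw [map_mul, MvPolynomial.rename_X, Derivation.leibniz, hp, MvPolynomial.pderiv_X_of_ne (h n)]
    simp

/-- Derivations commute with the twist and are unchanged by the substitution, which is why Γ⁺
contains ∂̃_x alone. -/
theorem rhoX_divDeriv (n : ℕ+) : rhoX (divDeriv id n) = dTilde Sum.inl n := by
  refine cross_ext fun f g => ?_
  have h : varDeriv (Sum.inl n) (twistEquiv (MvPolynomial.rename Sum.inl f *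
      MvPolynomial.rename Sum.inr g)) = twistEquiv (varDeriv (Sum.inl n)
        (MvPolynomial.rename Sum.inl f * MvPolynomial.rename Sum.inr g)) := varDeriv_twist _ _ _
  rw [rhoX_cross, dTilde_inl, cross_eq_twist, cross_eq_twist, h]
  refine congrArg twistEquiv ?_
  simp only [varDeriv, divDeriv, LinearMap.smul_apply, Derivation.coeFn_coe, map_smul,
    Derivation.leibniz, id_eq]
  rw [pderiv_rename_of_ne (fun _ => Sum.inr_ne_inl), MvPolynomial.pderiv_rename Sum.inl_injective,
    smul_zero, zero_add, smul_eq_mul, smul_mul_assoc, mul_comm]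
  rfl

theorem rhoY_divDeriv (n : ℕ+) : rhoY (divDeriv id n) = dTilde Sum.inr n := by
  refine cross_ext fun f g => ?_
  have h : varDeriv (Sum.inr n) (twistEquiv (MvPolynomial.rename Sum.inl f *
      MvPolynomial.rename Sum.inr g)) = twistEquiv (varDeriv (Sum.inr n)
        (MvPolynomial.rename Sum.inl f * MvPolynomial.rename Sum.inr g)) := varDeriv_twist _ _ _
  rw [rhoY_cross, dTilde_inr, cross_eq_twist, cross_eq_twist, h]
  refine congrArg twistEquiv ?_
  simp only [varDeriv, divDeriv, LinearMap.smul_apply, Derivation.coeFn_coe, map_smul,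
    Derivation.leibniz, id_eq]
  rw [pderiv_rename_of_ne (fun _ => Sum.inl_ne_inr), MvPolynomial.pderiv_rename Sum.inr_injective,
    smul_zero, add_zero, smul_eq_mul, mul_smul_comm]
  rfl

theorem coeff_gammaMinus₁ (k : ℕ) : coeff k gammaMinus₁ = rhoX (mulOp (qPoly k)) := by
  rw [rhoX_mulOp, qPoly_eq, gammaMinus₁, xiSeries_eq_linSeries,
    expSeries_linSeries_eq_map _ xShift (shift_comm _ _ fun _ _ => Sum.inl_ne_inr)]
  rfl

theorem coeff_gammaMinus₂ (k : ℕ) : coeff k gammaMinus₂ = rhoY (mulOp (qPoly k)) := by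
  rw [rhoY_mulOp, qPoly_eq, gammaMinus₂, xiSeries_eq_linSeries,
    expSeries_linSeries_eq_map _ yShift (shift_comm _ _ fun _ _ => Sum.inr_ne_inl)]
  rfl

theorem xiSeries_zero {A : Type*} [Ring A] [Algebra K A] (a : ℕ+ → A) :
    xiSeries 0 a = linSeries 1 a := by
  ext n
  rw [xiSeries_eq_linSeries, linSeries, linSeries, coeff_mk, coeff_mk]
  split_ifs with h
  · simp [h.ne']
  · rfl

/-- An algebra homomorphism carries exponentials to exponentials, so it is enough to know the images
of the derivations. -/
theorem coeff_gammaPlus₁ (k : ℕ) : coeff k gammaPlus₁ = rhoX (coeff k dPlus) := by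
  rw [gammaPlus₁, xiSeries_zero]
  have h := map_expSeries rhoX (linSeries 1 (divDeriv (id : ℕ+ → ℕ+)))
  rw [map_linSeries] at h
  simp only [rhoX_divDeriv] at h
  rw [← h]; rfl

theorem coeff_gammaPlus₂ (k : ℕ) : coeff k gammaPlus₂ = rhoY (coeff k dPlus) := by
  rw [gammaPlus₂, xiSeries_zero]
  have h := map_expSeries rhoY (linSeries 1 (divDeriv (id : ℕ+ → ℕ+)))
  rw [map_linSeries] at h
  simp only [rhoY_divDeriv] at h
  rw [← h]; rfl

end

end CoupledHL

namespace CoupledHL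

noncomputable section

open PowerSeries

/-! ### Coupled functions as images of products -/

/-- The operators `exp (-ξ_t(∂̃_𝐲, z))`. -/
def lowerExp : PowerSeries (Module.End K PolyTwo) := derivExp Sum.inr fun n => -wt n

theorem commute_mulOp_divDeriv (f : PolyOne) (n : ℕ+) :
    Commute (mulOp (MvPolynomial.rename Sum.inl f : PolyTwo)) (divDeriv Sum.inr n) := by
  refine LinearMap.ext fun g => ?_
  simp only [Module.End.mul_apply, LinearMap.mulLeft_apply, divDeriv, LinearMap.smul_apply,
    Derivation.coeFn_coe, Derivation.leibniz,
    pderiv_rename_of_ne (v := Sum.inl) (fun _ => Sum.inl_ne_inr) f, smul_eq_mul, mul_smul_comm]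
  rw [mul_zero, add_zero]

theorem coeff_zero_eul {A : Type*} [Ring A] (F : PowerSeries A) : coeff 0 (eul F) = 0 := by
  rw [coeff_eul, zero_smul]

/-- Normal ordering of `qₙ(𝐱 - ∂̃_𝐲)`. -/
theorem expSeries_xShift : expSeries (linSeries wt xShift) =
    (PowerSeries.mk fun n : ℕ => mulOp (qAt Sum.inl n : PolyTwo)) * lowerExp := by
  have hA : (PowerSeries.mk fun n : ℕ => mulOp (qAt Sum.inl n : PolyTwo)) =
      expSeries (linSeries wt fun n => mulOp (MvPolynomial.X (Sum.inl n) : PolyTwo)) := by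
    have h := map_expSeries (Algebra.lmul K PolyTwo)
      (linSeries wt fun n => (MvPolynomial.X (Sum.inl n) : PolyTwo))
    rw [map_linSeries] at h
    refine Eq.trans ?_ h
    ext1 n
    rw [coeff_mk, coeff_map, ← qSeries, coeff_qSeries]
    rfl
  have hL : linSeries wt xShift =
      linSeries wt (fun n => mulOp (MvPolynomial.X (Sum.inl n) : PolyTwo)) +
        linSeries (fun n => -wt n) (divDeriv Sum.inr) := by
    ext1 n
    rcases Nat.eq_zero_or_pos n with rfl | hn
    · rw [map_add, coeff_zero_linSeries, coeff_zero_linSeries, coeff_zero_linSeries, add_zero]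
    · lift n to ℕ+ using hn
      rw [map_add, coeff_linSeries, coeff_linSeries, coeff_linSeries, neg_smul, ← sub_eq_add_neg,
        ← smul_sub]
      rfl
  set A := PowerSeries.mk fun n : ℕ => mulOp (qAt Sum.inl n : PolyTwo)
  -- Multiplication by polynomials in x commutes with ∂_y, so the product on the right solves the
  -- differential equation of the left side and no scalar factor appears.
  have hcomm : A * eul (linSeries (fun n => -wt n) (divDeriv (Sum.inr : ℕ+ → ℕ+ ⊕ ℕ+))) =
      eul (linSeries (fun n => -wt n) (divDeriv Sum.inr)) * A := by
    ext1 k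
    rw [coeff_mul, coeff_mul, ← Finset.sum_equiv (Equiv.prodComm ℕ ℕ)
      (s := Finset.HasAntidiagonal.antidiagonal k)
      (f := fun p => coeff p.2 A *
        coeff p.1 (eul (linSeries (fun n => -wt n) (divDeriv (Sum.inr : ℕ+ → ℕ+ ⊕ ℕ+)))))
      (by simp [add_comm]) (by simp)]
    refine Finset.sum_congr rfl fun p _ => ?_
    rw [coeff_eul, coeff_mk]
    rcases Nat.eq_zero_or_pos p.1 with h | h
    · simp [h]
    · obtain ⟨m, hm⟩ : ∃ m : ℕ+, (m : ℕ) = p.1 := ⟨⟨p.1, h⟩, rfl⟩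
      rw [← hm, coeff_linSeries, mul_smul_comm, smul_mul_assoc, mul_smul_comm, smul_mul_assoc]
      have := (commute_mulOp_divDeriv (qInt p.2) m).eq
      rw [← qAt] at this
      rw [this]
  have hx := eul_expSeries wt xShift (shift_comm _ _ fun _ _ => Sum.inl_ne_inr)
  have hA' : eul A = eul (linSeries wt fun n => mulOp (MvPolynomial.X (Sum.inl n) : PolyTwo)) *
      A := by
    rw [hA]
    refine eul_expSeries _ _ fun n m => LinearMap.ext fun f => ?_
    simp only [Module.End.mul_apply, LinearMap.mulLeft_apply]
    ring
  refine eq_of_eul_eq (coeff_zero_eul _) ?_ hx ?_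
  · rw [coeff_zero_expSeries, coeff_mul]
    simp only [Finset.Nat.antidiagonal_zero, Finset.sum_singleton]
    rw [hA, coeff_zero_expSeries, lowerExp, coeff_zero_derivExp, one_mul]
  · rw [eul_mul, hA', lowerExp, eul_derivExp, hL, map_add, add_mul, ← mul_assoc, ← mul_assoc,
      ← mul_assoc, hcomm]

theorem atX_qInt_apply (n : ℤ) {f : PolyTwo} {M : ℕ}
    (hM : ∀ k, M ≤ k → coeff k lowerExp f = 0) : atX (qInt n) f =
      ∑ k ∈ Finset.range M, qAt Sum.inl (n - k) * coeff k lowerExp f := by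
  rcases lt_or_ge n 0 with hn | hn
  · rw [qInt_of_neg hn, map_zero, LinearMap.zero_apply, Finset.sum_eq_zero]
    intro k _
    rw [qAt_of_neg _ (by omega), zero_mul]
  lift n to ℕ using hn
  have h1 : atX (qInt n) = coeff n (expSeries (linSeries wt xShift)) := by
    rw [qInt_natCast, qPoly_eq,
      expSeries_linSeries_eq_map _ xShift (shift_comm _ _ fun _ _ => Sum.inl_ne_inr)]
    rfl
  -- The sum may be cut at M, where the derivations vanish on f, or at n, where q_{n−k} vanishes;
  -- both cuts are compared with one common larger range.
  have h2 : ∑ k ∈ Finset.range M, (qAt Sum.inl (n - k) : PolyTwo) * coeff k lowerExp f =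
      ∑ k ∈ Finset.range (M + n + 1), qAt Sum.inl (n - k) * coeff k lowerExp f := by
    refine Finset.sum_subset (fun a ha => ?_) fun k _ hk => ?_
    · simp only [Finset.mem_range] at ha ⊢; omega
    · rw [hM k (by simpa using hk), mul_zero]
  have h3 : ∑ k ∈ Finset.range (n + 1), (qAt Sum.inl (n - k) : PolyTwo) * coeff k lowerExp f =
      ∑ k ∈ Finset.range (M + n + 1), qAt Sum.inl (n - k) * coeff k lowerExp f := by
    refine Finset.sum_subset (fun a ha => ?_) fun k _ hk => ?_
    · simp only [Finset.mem_range] at ha ⊢; omega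
    · rw [Finset.mem_range] at hk
      rw [qAt_of_neg _ (by omega), zero_mul]
  rw [h2, ← h3, h1, expSeries_xShift, coeff_mul, LinearMap.sum_apply]
  rw [Finset.Nat.sum_antidiagonal_eq_sum_range_succ (f := fun i j =>
    (coeff i (PowerSeries.mk fun n : ℕ => mulOp (qAt Sum.inl n : PolyTwo)) *
      coeff j lowerExp) f), ← Finset.sum_range_reflect]
  refine Finset.sum_congr rfl fun k hk => ?_
  rw [Finset.mem_range] at hk
  rw [coeff_mk, Module.End.mul_apply, LinearMap.mulLeft_apply]
  have e1 : n + 1 - 1 - k = n - k := by omega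
  have e2 : n - (n - k) = k := by omega
  rw [e1, e2, Nat.cast_sub (by omega)]

theorem lowerExp_rename_mul (f : PolyOne) (g : PolyTwo) (k : ℕ) :
    coeff k lowerExp (MvPolynomial.rename Sum.inl f * g) =
      MvPolynomial.rename Sum.inl f * coeff k lowerExp g := by
  have h : (taylor Sum.inr fun n => -wt n).comp (MvPolynomial.rename Sum.inl) =
      (Polynomial.CAlgHom (R := K) (A := PolyTwo)).comp
        (MvPolynomial.rename Sum.inl : PolyOne →ₐ[K] PolyTwo) := by
    refine MvPolynomial.algHom_ext fun n => ?_
    rw [AlgHom.comp_apply, AlgHom.comp_apply, MvPolynomial.rename_X, taylor,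
      MvPolynomial.aeval_X, shiftOf_of_ne _ fun _ => Sum.inr_ne_inl, Polynomial.map_zero, add_zero]
    rfl
  have h2 : taylor Sum.inr (fun n => -wt n) (MvPolynomial.rename Sum.inl f) =
      Polynomial.C (MvPolynomial.rename Sum.inl f : PolyTwo) := AlgHom.congr_fun h f
  rw [lowerExp, ← coeff_taylor Sum.inr_injective, map_mul, h2, Polynomial.coeff_C_mul,
    coeff_taylor Sum.inr_injective]

/-- The action of `∏ D_{ia}^{d_{ia}}` on the product of the `qₙ`. -/
def lowerProd {l m : ℕ} (α : Fin l → ℤ) (β : Fin m → ℤ) (d : Fin l × Fin m → ℕ) : PolyTwo :=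
  (∏ i, MvPolynomial.rename Sum.inl (qInt (α i - ∑ a, (d (i, a) : ℤ)))) *
    ∏ a, MvPolynomial.rename Sum.inr (qInt (β a - ∑ i, (d (i, a) : ℤ)))

theorem lowerProd_eq_zero {l m : ℕ} {α : Fin l → ℤ} {β : Fin m → ℤ} {d : Fin l × Fin m → ℕ}
    (h : ¬ ((∀ i, ∑ a, (d (i, a) : ℤ) ≤ α i) ∧ ∀ a, ∑ i, (d (i, a) : ℤ) ≤ β a)) :
    lowerProd α β d = 0 := by
  rw [not_and_or] at h
  rcases h with h | h
  · have := prod_qAt_eq_zero (Sum.inl : ℕ+ → ℕ+ ⊕ ℕ+) (α := fun i => α i - ∑ a, (d (i, a) : ℤ))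
      (by simpa using h)
    rw [lowerProd]
    exact mul_eq_zero_of_left this _
  · have := prod_qAt_eq_zero (Sum.inr : ℕ+ → ℕ+ ⊕ ℕ+) (α := fun a => β a - ∑ i, (d (i, a) : ℤ))
      (by simpa using h)
    rw [lowerProd]
    exact mul_eq_zero_of_right _ this

theorem le_of_sum_le {ι : Type*} [Fintype ι] {f : ι → ℕ} {n : ℤ} (h : ∑ i, (f i : ℤ) ≤ n) (i : ι) :
    f i ≤ n.toNat := by
  have := Finset.single_le_sum (f := fun i => (f i : ℤ)) (fun i _ => Int.natCast_nonneg (f i))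
    (Finset.mem_univ i)
  have := this.trans h
  omega

theorem finite_support_lowerProd {l m : ℕ} (α : Fin l → ℤ) (β : Fin m → ℤ) :
    (Function.support fun d : Fin l × Fin m → ℕ =>
      (∏ p, lowerCoeff (d p)) • lowerProd α β d).Finite := by
  refine (Set.finite_Iic fun p : Fin l × Fin m => (α p.1).toNat).subset fun d hd => ?_
  by_contra h
  refine hd ?_
  simp only
  rw [lowerProd_eq_zero, smul_zero]
  rintro ⟨h1, -⟩
  exact h fun p => le_of_sum_le (h1 p.1) p.2

/-- The pairs in `Fin (l + 1) × Fin m`. -/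
def prodSuccEquiv (l m : ℕ) : Fin m ⊕ Fin l × Fin m ≃ Fin (l + 1) × Fin m where
  toFun := Sum.elim (fun a => (0, a)) fun p => (p.1.succ, p.2)
  invFun p := if h : p.1 = 0 then Sum.inl p.2 else Sum.inr (p.1.pred h, p.2)
  left_inv := by rintro (a | ⟨i, a⟩) <;> simp
  right_inv := by
    rintro ⟨i, a⟩
    by_cases hi : i = 0
    · subst hi; simp
    · simp [hi]

/-- Exponents of the lowering operators, split by the first index. -/
def lowerExpEquiv (l m : ℕ) :
    (Fin l × Fin m → ℕ) × (Fin m → ℕ) ≃ (Fin (l + 1) × Fin m → ℕ) :=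
  (Equiv.prodComm _ _).trans ((Equiv.sumArrowEquivProdArrow _ _ _).symm.trans
    (Equiv.arrowCongr (prodSuccEquiv l m) (Equiv.refl ℕ)))

theorem lowerExpEquiv_apply {l m : ℕ} (w : (Fin l × Fin m → ℕ) × (Fin m → ℕ))
    (s : Fin m ⊕ Fin l × Fin m) :
    lowerExpEquiv l m w (prodSuccEquiv l m s) = Sum.elim w.2 w.1 s := by
  simp [lowerExpEquiv, Equiv.sumArrowEquivProdArrow]

theorem lowerExpEquiv_zero {l m : ℕ} (w : (Fin l × Fin m → ℕ) × (Fin m → ℕ)) (a : Fin m) :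
    lowerExpEquiv l m w (0, a) = w.2 a := lowerExpEquiv_apply w (Sum.inl a)

theorem lowerExpEquiv_succ {l m : ℕ} (w : (Fin l × Fin m → ℕ) × (Fin m → ℕ)) (i : Fin l)
    (a : Fin m) : lowerExpEquiv l m w (i.succ, a) = w.1 (i, a) :=
  lowerExpEquiv_apply w (Sum.inr (i, a))

/-- Expansion of `q_α(𝐱 - ∂̃_𝐲) q_β(𝐲)` by lowering operators. -/
theorem atX_prod_qInt {l m : ℕ} (α : Fin l → ℤ) (β : Fin m → ℤ) :
    atX (∏ i, qInt (α i)) (∏ a, qAt Sum.inr (β a)) =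
      ∑ᶠ d : Fin l × Fin m → ℕ, (∏ p, lowerCoeff (d p)) • lowerProd α β d := by
  induction l with
  | zero =>
    rw [finsum_unique]
    simp [lowerProd, qAt]
  | succ l ih =>
    have hfin := (finite_support_lowerProd α β).preimage (lowerExpEquiv l m).injective.injOn
    -- The first factor is applied last. Its derivations in y pass the remaining factors in x and
    -- act only on the product in y, which yields the operators D_{0a}.
    rw [Fin.prod_univ_succ, map_mul, Module.End.mul_apply, ih,
      map_finsum _ (finite_support_lowerProd _ _), ← finsum_comp_equiv (lowerExpEquiv l m),
      finsum_curry _ hfin]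
    refine finsum_congr fun d => ?_
    set P : PolyOne := ∏ i : Fin l, qInt (α i.succ - ∑ a, (d (i, a) : ℤ))
    set B : Fin m → ℤ := fun a => β a - ∑ i, (d (i, a) : ℤ)
    have hP : lowerProd (fun i => α (Fin.succ i)) β d =
        MvPolynomial.rename Sum.inl P * ∏ a, qAt Sum.inr (B a) := by
      rw [lowerProd, map_prod]; rfl
    obtain ⟨M, hM⟩ := exists_derivExp_eq_zero (Sum.inr_injective (α := ℕ+) (β := ℕ+))
      (fun n => -wt n) (∏ a, qAt Sum.inr (B a))
    rw [map_smul, hP, atX_qInt_apply (M := M)]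
    · simp only [lowerExp_rename_mul]
      have h := sum_derivExp_prod_qAt (Sum.inr_injective (α := ℕ+) (β := ℕ+)) isFactor_lower B
        (fun k => mulOp (qAt Sum.inl (α 0 - k) * MvPolynomial.rename Sum.inl P)) hM
      rw [← lowerExp] at h
      simp only [LinearMap.mulLeft_apply, mul_assoc] at h
      rw [h, smul_finsum]
      refine finsum_congr fun f => ?_
      rw [smul_smul, ← Equiv.prod_comp (prodSuccEquiv l m)]
      simp only [lowerExpEquiv_apply, Fintype.prod_sum_type, Sum.elim_inl, Sum.elim_inr]
      rw [mul_comm]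
      congr 1
      rw [lowerProd, Fin.prod_univ_succ]
      simp only [lowerExpEquiv_zero, lowerExpEquiv_succ, Fin.sum_univ_succ, P, map_prod, mul_assoc,
        Nat.cast_sum]
      congr 2
      simp only [B, qAt]
      refine Finset.prod_congr rfl fun a _ => ?_
      congr 2
      ring
    · intro k hk
      rw [lowerExp_rename_mul, lowerExp, hM k hk, mul_zero]

/-- In a nonzero term the raised entries dominate sums of nonnegative lowering exponents. Both
raised vectors are thus nonnegative, which leaves finitely many raising exponents, and these bound
the lowering ones. -/
theorem finite_support_coupledQ {l m : ℕ} (α : Fin l → ℤ) (β : Fin m → ℤ) :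
    (Function.support fun w : RaiseExp l × RaiseExp m × (Fin l × Fin m → ℕ) =>
      ((∏ p, raiseCoeff (w.1 p)) * (∏ p, raiseCoeff (w.2.1 p)) * (∏ p, lowerCoeff (w.2.2 p))) •
        lowerProd (raiseVec α w.1) (raiseVec β w.2.1) w.2.2).Finite := by
  set S := {e : RaiseExp l | ∀ i, 0 ≤ raiseVec α e i}
  set S' := {e : RaiseExp m | ∀ i, 0 ≤ raiseVec β e i}
  have hS : S.Finite := finite_raiseVec_nonneg _
  have hS' : S'.Finite := finite_raiseVec_nonneg _
  have hT : (⋃ e ∈ S, (fun w : RaiseExp m × (Fin l × Fin m → ℕ) => (e, w)) ''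
      (S' ×ˢ Set.Iic fun p : Fin l × Fin m => (raiseVec α e p.1).toNat)).Finite :=
    hS.biUnion fun e _ => (hS'.prod (Set.finite_Iic _)).image _
  refine hT.subset fun w hw => ?_
  have h : (∀ i, ∑ a, (w.2.2 (i, a) : ℤ) ≤ raiseVec α w.1 i) ∧
      ∀ a, ∑ i, (w.2.2 (i, a) : ℤ) ≤ raiseVec β w.2.1 a := by
    by_contra h
    refine hw ?_
    simp only
    rw [lowerProd_eq_zero h, smul_zero]
  have hs : ∀ i, 0 ≤ ∑ a, (w.2.2 (i, a) : ℤ) := fun i =>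
    Finset.sum_nonneg fun a _ => Int.natCast_nonneg _
  have hs' : ∀ a, 0 ≤ ∑ i, (w.2.2 (i, a) : ℤ) := fun i =>
    Finset.sum_nonneg fun a _ => Int.natCast_nonneg _
  exact Set.mem_biUnion (x := w.1) (fun i => (hs i).trans (h.1 i))
    ⟨w.2, ⟨fun i => (hs' i).trans (h.2 i), fun p => le_of_sum_le (h.1 p.1) p.2⟩, rfl⟩

theorem atY_apply_one (f : PolyOne) : atY f 1 = MvPolynomial.rename Sum.inr f := by
  induction f using MvPolynomial.induction_on with
  | C a =>
    rw [← MvPolynomial.algebraMap_eq, AlgHom.commutes, Module.algebraMap_end_apply,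
      AlgHom.commutes, Algebra.smul_def, mul_one]
  | add p q hp hq => simp only [map_add, LinearMap.add_apply, hp, hq]
  | mul_X p n hp =>
    rw [mul_comm, map_mul, Module.End.mul_apply, hp, atY_X, map_mul, MvPolynomial.rename_X]
    simp only [yShift, LinearMap.sub_apply, mulVar, dTilde, LinearMap.mulLeft_apply,
      LinearMap.smul_apply, Derivation.coeFn_coe,
      pderiv_rename_of_ne (v := Sum.inr) (fun _ => Sum.inr_ne_inl) p]
    rw [smul_zero, sub_zero]

/-- The coupled Hall-Littlewood functions are the images of products under twisting. -/
theorem coupledQ_eq (lam mu : YoungDiagram) :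
    coupledQ lam mu = atX (hallQ lam) (atY (hallQ mu) 1) := by
  set α : Fin lam.rowLens.length → ℤ := fun i => (lam.rowLens.get i : ℤ)
  set β : Fin mu.rowLens.length → ℤ := fun i => (mu.rowLens.get i : ℤ)
  have h : coupledQ lam mu = ∑ᶠ w : RaiseExp lam.rowLens.length × RaiseExp mu.rowLens.length ×
        (Fin lam.rowLens.length × Fin mu.rowLens.length → ℕ),
      ((∏ p, raiseCoeff (w.1 p)) * (∏ p, raiseCoeff (w.2.1 p)) * (∏ p, lowerCoeff (w.2.2 p))) •
        lowerProd (raiseVec α w.1) (raiseVec β w.2.1) w.2.2 := rfl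
  rw [h, finsum_curry₃ _ (finite_support_coupledQ α β), atY_apply_one, hallQ_eq_vecQ, hallQ_eq_vecQ,
    vecQ, vecQ, map_finsum _ (finite_support_vecQ α), map_finsum _ (finite_support_vecQ β)]
  have h2 : (Function.support fun f : RaiseExp mu.rowLens.length =>
      MvPolynomial.rename (Sum.inr : ℕ+ → ℕ+ ⊕ ℕ+)
        ((∏ p, raiseCoeff (f p)) • ∏ i, qInt (raiseVec β f i))).Finite := by
    refine (finite_support_vecQ β).subset fun f hf h0 => hf ?_
    simp only at h0 ⊢
    rw [h0, map_zero]
  have h3 : (Function.support fun e : RaiseExp lam.rowLens.length =>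
      atX ((∏ p, raiseCoeff (e p)) • ∏ i, qInt (raiseVec α e i))).Finite := by
    refine (finite_support_vecQ α).subset fun f hf h0 => hf ?_
    simp only at h0 ⊢
    rw [h0, map_zero]
  set R := ∑ᶠ f : RaiseExp mu.rowLens.length, MvPolynomial.rename (Sum.inr : ℕ+ → ℕ+ ⊕ ℕ+)
        ((∏ p, raiseCoeff (f p)) • ∏ i, qInt (raiseVec β f i)) with hR
  -- Evaluation at the fixed polynomial `R` is linear in the operator, so the finite sum over the
  -- raising exponents of λ can be taken outside.
  have h4 := map_finsum (LinearMap.applyₗ (R := K) R : Module.End K PolyTwo →ₗ[K] PolyTwo) h3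
  rw [LinearMap.applyₗ_apply_apply] at h4
  rw [h4]
  refine finsum_congr fun e => ?_
  rw [LinearMap.applyₗ_apply_apply, hR, map_finsum _ h2]
  refine finsum_congr fun f => ?_
  have h5 : MvPolynomial.rename (Sum.inr : ℕ+ → ℕ+ ⊕ ℕ+) (∏ i, qInt (raiseVec β f i)) =
      ∏ a, qAt Sum.inr (raiseVec β f a) := map_prod _ _ _
  rw [map_smul, map_smul, LinearMap.smul_apply, map_smul, h5, atX_prod_qInt, smul_smul, smul_finsum]
  simp only [smul_smul]

end

end CoupledHL

namespace CoupledHL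

noncomputable section

open PowerSeries

/-! ### The monodromy matrix as a pair of power series -/

theorem laurent_coeff_T_mul {A : Type*} [Semiring A] (d : ℤ) (F : A[T;T⁻¹]) (n : ℤ) :
    (LaurentPolynomial.T d * F).coeff n = F.coeff (n - d) := by
  have := AddMonoidAlgebra.coeff_single_mul_eq_mul_coeff (x := F) (r := (1 : A)) (m := d) (m₁ := n)
    (n - d) (fun m' _ => ⟨fun h => by omega, fun h => by omega⟩)
  rwa [one_mul] at this

section Chain

variable {A : Type*} [Ring A]

theorem coeffAtPow_add (F G : PowerSeries A) (d n : ℤ) :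
    coeffAtPow (F + G) d n = coeffAtPow F d n + coeffAtPow G d n := by
  unfold coeffAtPow
  split_ifs <;> simp

theorem coeffAtPow_one {d : ℤ} (hd : d ≠ 0) (n : ℤ) :
    coeffAtPow (1 : PowerSeries A) d n = if n = 0 then 1 else 0 := by
  unfold coeffAtPow
  by_cases h : d ∣ n
  · obtain ⟨k, rfl⟩ := h
    rw [Int.mul_ediv_cancel_left _ hd]
    simp only [dvd_mul_right, true_and, coeff_one, mul_eq_zero, hd, false_or]
    split_ifs <;> first | rfl | omega
  · rw [if_neg (by tauto), if_neg]
    rintro rfl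
    exact h (dvd_zero d)

theorem coeffAtPow_C_mul (a : A) (F : PowerSeries A) (d n : ℤ) :
    coeffAtPow (C a * F) d n = a * coeffAtPow F d n := by
  unfold coeffAtPow
  split_ifs <;> simp

theorem coeffAtPow_X_mul (F : PowerSeries A) {d : ℤ} (hd : d ≠ 0) (n : ℤ) :
    coeffAtPow (X * F) d n = coeffAtPow F d (n - d) := by
  unfold coeffAtPow
  by_cases h : d ∣ n
  · obtain ⟨k, rfl⟩ := h
    rw [show d * k - d = d * (k - 1) by ring, Int.mul_ediv_cancel_left _ hd,
      Int.mul_ediv_cancel_left _ hd]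
    simp only [dvd_mul_right, true_and]
    rcases lt_trichotomy k 0 with hk | rfl | hk
    · rw [if_neg (by omega), if_neg (by omega)]
    · simp
    · rw [if_pos (by omega), if_pos (by omega), show k.toNat = (k - 1).toNat + 1 by omega,
        coeff_succ_X_mul]
  · rw [if_neg (by tauto), if_neg]
    rintro ⟨h', -⟩
    exact h ((dvd_sub_self_right).1 h')

/-- The series obtained from `(1, X)` by the steps `(F, G) ↦ (F + pₘ G, X (G + rₘ F))`. -/
def chain (p r : ℕ → A) : ℕ → PowerSeries A × PowerSeries A
  | 0 => (1, X)
  | m + 1 => ((chain p r m).1 + C (p m) * (chain p r m).2,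
      X * ((chain p r m).2 + C (r m) * (chain p r m).1))

/-- The coefficients are noncommutative polynomials in the operators of the first m sites. It is
applied to stabilisers of subspaces and to centralisers. -/
theorem coeff_chain_mem (S : Subring A) {p r : ℕ → A} {m : ℕ} (hp : ∀ j < m, p j ∈ S)
    (hr : ∀ j < m, r j ∈ S) (k : ℕ) :
    coeff k (chain p r m).1 ∈ S ∧ coeff k (chain p r m).2 ∈ S := by
  induction m generalizing k with
  | zero =>
    simp only [chain, coeff_one, coeff_X]
    constructor <;> split_ifs <;> first | exact one_mem S | exact zero_mem S
  | succ m ih =>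
    have ih' := ih (fun j hj => hp j (by omega)) (fun j hj => hr j (by omega))
    refine ⟨?_, ?_⟩
    · rw [chain, map_add, coeff_C_mul]
      exact add_mem (ih' k).1 (mul_mem (hp m (by omega)) (ih' k).2)
    · rw [chain]
      rcases k with _ | k
      · rw [coeff_zero_X_mul]; exact zero_mem S
      · rw [coeff_succ_X_mul, map_add, coeff_C_mul]
        exact add_mem (ih' k).2 (mul_mem (hr m (by omega)) (ih' k).1)

theorem coeff_chain_eq_zero (p r : ℕ → A) (m : ℕ) :
    (∀ k, m < k → coeff k (chain p r m).1 = 0) ∧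
      (∀ k, m + 1 < k → coeff k (chain p r m).2 = 0) := by
  induction m with
  | zero =>
    refine ⟨fun k hk => ?_, fun k hk => ?_⟩
    · rw [chain, coeff_one, if_neg (by omega)]
    · rw [chain, coeff_X, if_neg (by omega)]
  | succ m ih =>
    refine ⟨fun k hk => ?_, fun k hk => ?_⟩
    · rw [chain, map_add, coeff_C_mul, ih.1 k (by omega), ih.2 k (by omega), mul_zero, add_zero]
    · obtain ⟨k, rfl⟩ : ∃ j, k = j + 1 := ⟨k - 1, by omega⟩
      rw [chain, coeff_succ_X_mul, map_add, coeff_C_mul, ih.1 k (by omega), ih.2 k (by omega),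
        mul_zero, add_zero]

theorem coeff_top_chain_snd (p r : ℕ → A) (m : ℕ) : coeff (m + 1) (chain p r m).2 = 1 := by
  induction m with
  | zero => rw [chain, coeff_X, if_pos rfl]
  | succ m ih =>
    rw [chain, coeff_succ_X_mul, map_add, ih, coeff_C_mul,
      (coeff_chain_eq_zero p r m).1 _ (by omega), mul_zero, add_zero]

/-- For C̃ this isolates the annihilation operator of the last site, the key to injectivity. -/
theorem coeff_top_chain_fst (p r : ℕ → A) (m : ℕ) :
    coeff (m + 1) (chain p r (m + 1)).1 = p m := by
  rw [chain, map_add, coeff_C_mul, coeff_top_chain_snd, (coeff_chain_eq_zero p r m).1 _ (by omega),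
    mul_one, zero_add]

/-- The product `L_m ⋯ L₁ L₀` for sequences of operators. -/
def monoProd (up dn : ℕ → A) (m : ℕ) : Matrix (Fin 2) (Fin 2) A[T;T⁻¹] :=
  ((List.ofFn fun i : Fin m => lMatrix (up i) (dn i)).reverse).prod * lMatrix 1 1

theorem monoProd_succ (up dn : ℕ → A) (m : ℕ) :
    monoProd up dn (m + 1) = lMatrix (up m) (dn m) * monoProd up dn m := by
  rw [monoProd, List.ofFn_succ', List.concat_eq_append, List.reverse_append, List.reverse_singleton,
    List.singleton_append, List.prod_cons, mul_assoc]
  rfl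

theorem laurent_coeff_C_mul (a : A) (F : A[T;T⁻¹]) (n : ℤ) :
    (LaurentPolynomial.C a * F).coeff n = a * F.coeff n := by
  rw [← LaurentPolynomial.single_eq_C]
  exact AddMonoidAlgebra.coeff_single_mul_eq_mul_coeff n (by simp)

/-- Normalisation: C and A are uᵐ and uᵐ⁺¹ times series in u⁻², B and D are u⁻ᵐ and u⁻ᵐ⁻¹ times
series in u². The pairs (C, A) and (B, D) obey the same recursion with the roles of `up` and `dn`
exchanged. -/
theorem coeff_monoProd (up dn : ℕ → A) (m : ℕ) :
    (∀ n, (monoProd up dn m 1 0).coeff n = coeffAtPow (chain dn up m).1 (-2) (n - m)) ∧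
    (∀ n, (monoProd up dn m 0 0).coeff n = coeffAtPow (chain dn up m).2 (-2) (n - m - 1)) ∧
    (∀ n, (monoProd up dn m 0 1).coeff n = coeffAtPow (chain up dn m).1 2 (n + m)) ∧
    (∀ n, (monoProd up dn m 1 1).coeff n = coeffAtPow (chain up dn m).2 2 (n + m + 1)) := by
  induction m with
  | zero =>
    have h0 : monoProd up dn 0 = lMatrix 1 1 := by simp [monoProd]
    have hX : ∀ d n : ℤ, d ≠ 0 → coeffAtPow (X : PowerSeries A) d n = if d = n then 1 else 0 := by
      intro d n hd
      rw [← mul_one X, coeffAtPow_X_mul _ hd, coeffAtPow_one hd]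
      exact if_congr (by omega) rfl rfl
    simp only [h0, chain, lMatrix, Matrix.of_apply, Matrix.cons_val_zero, Matrix.cons_val_one,
      LaurentPolynomial.C_apply, LaurentPolynomial.T_apply,
      coeffAtPow_one (show (-2 : ℤ) ≠ 0 by norm_num),
      coeffAtPow_one (show (2 : ℤ) ≠ 0 by norm_num), hX _ _ (show (-2 : ℤ) ≠ 0 by norm_num),
      hX _ _ (show (2 : ℤ) ≠ 0 by norm_num)]
    refine ⟨fun n => ?_, fun n => ?_, fun n => ?_, fun n => ?_⟩ <;> refine if_congr ?_ rfl rfl <;>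
      omega
  | succ m ih =>
    obtain ⟨h1, h2, h3, h4⟩ := ih
    simp only [monoProd_succ, Matrix.mul_apply, Fin.sum_univ_two, lMatrix, Matrix.of_apply,
      Matrix.cons_val_zero, Matrix.cons_val_one, AddMonoidAlgebra.coeff_add, Finsupp.add_apply,
      laurent_coeff_C_mul, laurent_coeff_T_mul, h1, h2, h3, h4, chain, coeffAtPow_add,
      coeffAtPow_C_mul, coeffAtPow_X_mul _ (show (-2 : ℤ) ≠ 0 by norm_num),
      coeffAtPow_X_mul _ (show (2 : ℤ) ≠ 0 by norm_num)]
    push_cast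
    refine ⟨fun n => ?_, fun n => ?_, fun n => ?_, fun n => ?_⟩
    · rw [add_comm]; ring_nf
    · ring_nf
    · ring_nf
    · rw [add_comm]; ring_nf

end Chain

end

end CoupledHL

namespace CoupledHL

noncomputable section

open PowerSeries
open Finset.HasAntidiagonal (antidiagonal mem_antidiagonal)

/-! ### The `q`-boson Fock space -/

theorem one_sub_tParam_pow_ne_zero {n : ℕ} (hn : n ≠ 0) : (1 : K) - tParam ^ n ≠ 0 := by
  intro h
  have h1 : algebraMap (Polynomial ℂ) K (1 - Polynomial.X ^ n) = algebraMap (Polynomial ℂ) K 0 := by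
    rw [map_sub, map_one, map_pow, RatFunc.algebraMap_X, map_zero]; exact h
  have h2 := congrArg (Polynomial.eval 0) (IsFractionRing.injective (Polynomial ℂ) K h1)
  simp [hn] at h2

section Fock

variable {ι : Type} [DecidableEq ι]

theorem creat_single (i : ι) (n : ι → ℕ) (c : K) :
    creat i (Finsupp.single n c : Fock ι) = Finsupp.single (Function.update n i (n i + 1)) c := by
  simp [creat, Finsupp.linearCombination_single]

/-- The operator `(1 - t) B`. -/
def lower (i : ι) : Module.End K (Fock ι) := (1 - tParam) • annih i

/-- The factor 1−t clears the denominator of the q-number. At `n i = 0` the truncated subtraction is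
harmless, because the coefficient 1 − t⁰ vanishes. -/
theorem lower_single (i : ι) (n : ι → ℕ) (c : K) :
    lower i (Finsupp.single n c : Fock ι) =
      Finsupp.single (Function.update n i (n i - 1)) (c * (1 - tParam ^ n i)) := by
  have h : (1 : K) - tParam ≠ 0 := by simpa using one_sub_tParam_pow_ne_zero one_ne_zero
  rw [lower, LinearMap.smul_apply, annih, Finsupp.linearCombination_single, Finsupp.smul_single,
    Finsupp.smul_single, smul_eq_mul, smul_eq_mul, qNumber]
  congr 1
  field_simp

theorem creat_mul_creat (i j : ι) : creat i * creat j = creat j * creat i := by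
  rcases eq_or_ne i j with rfl | h
  · rfl
  refine Finsupp.lhom_ext fun n c => ?_
  simp only [Module.End.mul_apply, creat_single, Function.update_of_ne h,
    Function.update_of_ne h.symm]
  rw [Function.update_comm h]

theorem lower_mul_lower (i j : ι) : lower i * lower j = lower j * lower i := by
  rcases eq_or_ne i j with rfl | h
  · rfl
  refine Finsupp.lhom_ext fun n c => ?_
  simp only [Module.End.mul_apply, lower_single, Function.update_of_ne h,
    Function.update_of_ne h.symm]
  rw [Function.update_comm h, mul_right_comm]

theorem lower_mul_creat_of_ne {i j : ι} (h : i ≠ j) :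
    lower i * creat j = creat j * lower i := by
  refine Finsupp.lhom_ext fun n c => ?_
  simp only [Module.End.mul_apply, lower_single, creat_single, Function.update_of_ne h,
    Function.update_of_ne h.symm]
  rw [Function.update_comm h]

theorem lower_mul_creat_self (i : ι) :
    lower i * creat i = (1 - tParam) • 1 + tParam • (creat i * lower i) := by
  refine Finsupp.lhom_ext fun n c => ?_
  simp only [Module.End.mul_apply, lower_single, creat_single, Function.update_self,
    LinearMap.add_apply, LinearMap.smul_apply, Module.End.one_apply, Finsupp.smul_single,
    Function.update_idem, smul_eq_mul, Nat.add_sub_cancel, Function.update_eq_self]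
  rcases hn : n i with _ | k
  · simp [mul_comm]
  · rw [show k + 1 - 1 + 1 = n i by omega, Function.update_eq_self, ← Finsupp.single_add]
    congr 1
    ring

theorem lower_mul_creat_pow (i : ι) (r : ℕ) : lower i * creat i ^ (r + 1) =
    (1 - tParam ^ (r + 1)) • creat i ^ r + tParam ^ (r + 1) • (creat i ^ (r + 1) * lower i) := by
  induction r with
  | zero => simpa using lower_mul_creat_self i
  | succ r ih =>
    rw [pow_succ, ← mul_assoc, ih, add_mul, smul_mul_assoc, smul_mul_assoc, mul_assoc,
      lower_mul_creat_self, mul_add, mul_smul_comm, mul_smul_comm, mul_one, smul_add, smul_smul,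
      smul_smul, ← mul_assoc, ← pow_succ, ← pow_succ, ← add_assoc, ← add_smul]
    congr 2
    ring

/-! ### Chains of sites, their operator series, and vectors with empty far sites. -/

variable {M : ℕ} (site : Fin M → ι)

/-- The creation operators of a chain of `M` sites, continued by zero. -/
def upSeq (j : ℕ) : Module.End K (Fock ι) := if h : j < M then creat (site ⟨j, h⟩) else 0

/-- The operators `(1 - t) B` of a chain of `M` sites, continued by zero. -/
def dnSeq (j : ℕ) : Module.End K (Fock ι) := if h : j < M then lower (site ⟨j, h⟩) else 0

theorem upSeq_of_lt {j : ℕ} (h : j < M) : upSeq site j = creat (site ⟨j, h⟩) := dif_pos h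

theorem dnSeq_of_lt {j : ℕ} (h : j < M) : dnSeq site j = lower (site ⟨j, h⟩) := dif_pos h

theorem monodromy_eq : monodromy M site = monoProd (upSeq site) (dnSeq site) M := by
  have : (fun i : Fin M => lMatrix (creat (site i)) ((1 - tParam) • annih (site i))) =
      fun i : Fin M => lMatrix (upSeq site i) (dnSeq site i) := by
    funext i
    rw [upSeq_of_lt site i.2, dnSeq_of_lt site i.2]
    rfl
  rw [monodromy, this]
  rfl

/-- The series of the operator `B̃`. -/
def bSeries (m : ℕ) : PowerSeries (Module.End K (Fock ι)) :=
  (chain (upSeq site) (dnSeq site) m).1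

/-- The series of the operator `D`, normalised. -/
def dSeries (m : ℕ) : PowerSeries (Module.End K (Fock ι)) :=
  (chain (upSeq site) (dnSeq site) m).2

/-- The series of the operator `C̃`. -/
def cSeries (m : ℕ) : PowerSeries (Module.End K (Fock ι)) :=
  (chain (dnSeq site) (upSeq site) m).1

/-- The series of the operator `A`, normalised. -/
def aSeries (m : ℕ) : PowerSeries (Module.End K (Fock ι)) :=
  (chain (dnSeq site) (upSeq site) m).2

theorem coeff_T_mul_monodromy_lower (n : ℤ) :
    (LaurentPolynomial.T (-(M : ℤ)) * monodromy M site 1 0 :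
      (Module.End K (Fock ι))[T;T⁻¹]).coeff n = coeffAtPow (cSeries site M) (-2) n := by
  have h := (coeff_monoProd (upSeq site) (dnSeq site) M).1 (n - -M)
  rw [← monodromy_eq, sub_neg_eq_add, add_sub_cancel_right] at h
  refine (laurent_coeff_T_mul (A := Module.End K (Fock ι)) _ _ _).trans ?_
  rw [sub_neg_eq_add]
  exact h

theorem coeff_T_mul_monodromy_upper (n : ℤ) :
    (LaurentPolynomial.T (M : ℤ) * monodromy M site 0 1 :
      (Module.End K (Fock ι))[T;T⁻¹]).coeff n = coeffAtPow (bSeries site M) 2 n := by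
  have h := (coeff_monoProd (upSeq site) (dnSeq site) M).2.2.1 (n - M)
  rw [← monodromy_eq, sub_add_cancel] at h
  exact (laurent_coeff_T_mul (A := Module.End K (Fock ι)) _ _ _).trans h

/-- The vectors for which the sites from the `m`-th on are empty. -/
def vac (m : ℕ) : Submodule K (Fock ι) :=
  Finsupp.supported K K {n | ∀ j : Fin M, m ≤ j → n (site j) = 0}

omit [DecidableEq ι] in
theorem single_mem_vac {m : ℕ} {n : ι → ℕ} (h : ∀ j : Fin M, m ≤ j → n (site j) = 0) (c : K) :
    (Finsupp.single n c : Fock ι) ∈ vac site m := Finsupp.single_mem_supported K c h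

omit [DecidableEq ι] in
theorem vac_eq_span (m : ℕ) : vac site m = Submodule.span K
    ((fun n : ι → ℕ => (Finsupp.single n 1 : Fock ι)) '' {n | ∀ j : Fin M, m ≤ j → n (site j) = 0}) :=
  Finsupp.supported_eq_span_single K _

omit [DecidableEq ι] in
theorem vac_mono {m m' : ℕ} (h : m ≤ m') : vac site m ≤ vac site m' :=
  Finsupp.supported_mono fun _ hn j hj => hn j (h.trans hj)

omit [DecidableEq ι] in
theorem vac_top : vac site M = ⊤ := by
  rw [vac, ← Finsupp.supported_univ]
  congr 1
  exact Set.eq_univ_of_forall fun n j hj => absurd j.2 (by omega)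

theorem dnSeq_vac {m j : ℕ} (h : m ≤ j) {v : Fock ι} (hv : v ∈ vac site m) :
    dnSeq site j v = 0 := by
  unfold dnSeq
  split_ifs with hj
  · rw [vac_eq_span] at hv
    induction hv using Submodule.span_induction with
    | zero => simp
    | add x y _ _ hx hy => rw [map_add, hx, hy, add_zero]
    | smul a x _ hx => rw [map_smul, hx, smul_zero]
    | mem x hx =>
      obtain ⟨n, hn, rfl⟩ := hx
      simp [lower_single, hn ⟨j, hj⟩ h]
  · rfl

theorem creat_pow_single (i : ι) (r : ℕ) (n : ι → ℕ) (c : K) :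
    (creat i ^ r) (Finsupp.single n c : Fock ι) =
      Finsupp.single (Function.update n i (n i + r)) c := by
  induction r with
  | zero => simp
  | succ r ih =>
    rw [pow_succ', Module.End.mul_apply, ih, creat_single, Function.update_self,
      Function.update_idem, add_assoc]

/-- A basis vector with r particles at site `m` is the r-th power of the creation operator applied
to the vector with that site emptied. -/
theorem vac_succ_le {m : ℕ} (hm : m < M) : vac site (m + 1) ≤
    Submodule.span K {w | ∃ r : ℕ, ∃ v ∈ vac site m, w = (upSeq site m ^ r) v} := by
  rw [vac_eq_span, Submodule.span_le]
  rintro _ ⟨n, hn, rfl⟩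
  refine Submodule.subset_span ⟨n (site ⟨m, hm⟩),
    Finsupp.single (Function.update n (site ⟨m, hm⟩) 0) 1, single_mem_vac site (fun j hj => ?_) 1, ?_⟩
  · rcases eq_or_ne (site j) (site ⟨m, hm⟩) with h | h
    · rw [h, Function.update_self]
    · rw [Function.update_of_ne h]
      refine hn j ?_
      have : j ≠ ⟨m, hm⟩ := fun h' => h (by rw [h'])
      have : (j : ℕ) ≠ m := fun h' => this (Fin.ext h')
      omega
  · rw [upSeq_of_lt site hm, creat_pow_single]
    simp

/-- To prove an identity on `vac (m + 1)` it is enough to prove it on powers of `B†`. -/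
theorem eq_on_vac_succ {m : ℕ} (hm : m < M) {N : Type*} [AddCommGroup N] [Module K N]
    (f g : Fock ι →ₗ[K] N)
    (h : ∀ (r : ℕ), ∀ v ∈ vac site m, f ((upSeq site m ^ r) v) = g ((upSeq site m ^ r) v))
    {v : Fock ι} (hv : v ∈ vac site (m + 1)) : f v = g v := by
  refine LinearMap.eqOn_span' ?_ (vac_succ_le site hm hv)
  rintro _ ⟨r, v, hv, rfl⟩
  exact h r v hv

variable {site}

theorem upSeq_mul_upSeq (i j : ℕ) :
    upSeq site i * upSeq site j = upSeq site j * upSeq site i := by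
  unfold upSeq
  split_ifs <;> simp [creat_mul_creat]

theorem dnSeq_mul_dnSeq (i j : ℕ) :
    dnSeq site i * dnSeq site j = dnSeq site j * dnSeq site i := by
  unfold dnSeq
  split_ifs <;> simp [lower_mul_lower]

theorem dnSeq_mul_upSeq (hs : Function.Injective site) {i j : ℕ} (h : i ≠ j) :
    dnSeq site i * upSeq site j = upSeq site j * dnSeq site i := by
  unfold dnSeq upSeq
  split_ifs with hi hj
  · exact lower_mul_creat_of_ne fun h' => h (congrArg Fin.val (hs h'))
  all_goals simp

theorem dnSeq_mul_upSeq_pow {m : ℕ} (hm : m < M) (r : ℕ) :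
    dnSeq site m * upSeq site m ^ (r + 1) = (1 - tParam ^ (r + 1)) • upSeq site m ^ r +
      tParam ^ (r + 1) • (upSeq site m ^ (r + 1) * dnSeq site m) := by
  rw [dnSeq_of_lt site hm, upSeq_of_lt site hm, lower_mul_creat_pow]

/-- The endomorphisms that preserve a submodule. -/
def stabSubring {V : Type*} [AddCommGroup V] [Module K V] (N : Submodule K V) :
    Subring (Module.End K V) where
  carrier := {x | ∀ v ∈ N, x v ∈ N}
  mul_mem' hx hy v hv := hx _ (hy v hv)
  one_mem' _ hv := hv
  add_mem' hx hy v hv := add_mem (hx v hv) (hy v hv)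
  zero_mem' _ _ := zero_mem N
  neg_mem' hx v hv := neg_mem (hx v hv)

theorem upSeq_mem_vac (hs : Function.Injective site) {m j : ℕ} (h : j < m) {v : Fock ι}
    (hv : v ∈ vac site m) : upSeq site j v ∈ vac site m := by
  unfold upSeq
  split_ifs with hj
  · rw [vac_eq_span] at hv
    induction hv using Submodule.span_induction with
    | zero => simp
    | add x y _ _ hx hy => rw [map_add]; exact add_mem hx hy
    | smul a x _ hx => rw [map_smul]; exact Submodule.smul_mem _ _ hx
    | mem x hx =>
      obtain ⟨n, hn, rfl⟩ := hx
      rw [creat_single]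
      refine single_mem_vac site (fun i hi => ?_) 1
      rw [Function.update_of_ne fun h' => ?_]
      · exact hn i hi
      · have := congrArg Fin.val (hs h'); simp only at this; omega
  · exact zero_mem _

theorem dnSeq_mem_vac (hs : Function.Injective site) {m j : ℕ} {v : Fock ι}
    (hv : v ∈ vac site m) : dnSeq site j v ∈ vac site m := by
  rcases lt_or_ge j m with h | h
  swap
  · rw [dnSeq_vac site h hv]; exact zero_mem _
  unfold dnSeq
  split_ifs with hj
  · rw [vac_eq_span] at hv
    induction hv using Submodule.span_induction with
    | zero => simp
    | add x y _ _ hx hy => rw [map_add]; exact add_mem hx hy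
    | smul a x _ hx => rw [map_smul]; exact Submodule.smul_mem _ _ hx
    | mem x hx =>
      obtain ⟨n, hn, rfl⟩ := hx
      rw [lower_single]
      refine single_mem_vac site (fun i hi => ?_) _
      rw [Function.update_of_ne fun h' => ?_]
      · exact hn i hi
      · have := congrArg Fin.val (hs h'); simp only at this; omega
  · exact zero_mem _

theorem upSeq_pow_mem_vac (hs : Function.Injective site) {m j : ℕ} (h : j < m) (r : ℕ) {v : Fock ι}
    (hv : v ∈ vac site m) : (upSeq site j ^ r) v ∈ vac site m := by
  induction r with
  | zero => exact hv
  | succ r ih => rw [pow_succ', Module.End.mul_apply]; exact upSeq_mem_vac hs h ih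

theorem coeff_ac_mem_vac (hs : Function.Injective site) {m : ℕ} (k : ℕ) {v : Fock ι}
    (hv : v ∈ vac site m) :
    coeff k (cSeries site m) v ∈ vac site m ∧ coeff k (aSeries site m) v ∈ vac site m := by
  have := coeff_chain_mem (stabSubring (vac site m)) (p := dnSeq site) (r := upSeq site)
    (fun j _ v hv => dnSeq_mem_vac hs hv) (fun j hj v hv => upSeq_mem_vac hs hj hv) k
  exact ⟨this.1 v hv, this.2 v hv⟩

theorem coeff_bd_mem_vac (hs : Function.Injective site) {m : ℕ} (k : ℕ) {v : Fock ι}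
    (hv : v ∈ vac site m) :
    coeff k (bSeries site m) v ∈ vac site m ∧ coeff k (dSeries site m) v ∈ vac site m := by
  have := coeff_chain_mem (stabSubring (vac site m)) (p := upSeq site) (r := dnSeq site)
    (fun j hj v hv => upSeq_mem_vac hs hj hv) (fun j hj v hv => dnSeq_mem_vac hs hv) k
  exact ⟨this.1 v hv, this.2 v hv⟩

/-- An operator commuting with the operators of the first `m` sites commutes with the entries of
the monodromy matrix. -/
theorem commute_coeff_series {m : ℕ} {x : Module.End K (Fock ι)}
    (hu : ∀ j < m, x * upSeq site j = upSeq site j * x)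
    (hd : ∀ j < m, x * dnSeq site j = dnSeq site j * x) (k : ℕ) :
    (Commute x (coeff k (aSeries site m)) ∧ Commute x (coeff k (bSeries site m))) ∧
      (Commute x (coeff k (cSeries site m)) ∧ Commute x (coeff k (dSeries site m))) := by
  have hu' : ∀ j < m, upSeq site j ∈ Subring.centralizer {x} := fun j hj =>
    Subring.mem_centralizer_iff.2 fun g hg => by rw [Set.mem_singleton_iff.1 hg, hu j hj]
  have hd' : ∀ j < m, dnSeq site j ∈ Subring.centralizer {x} := fun j hj =>
    Subring.mem_centralizer_iff.2 fun g hg => by rw [Set.mem_singleton_iff.1 hg, hd j hj]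
  have h1 := coeff_chain_mem _ hu' hd' k
  have h2 := coeff_chain_mem _ hd' hu' k
  exact ⟨⟨Subring.mem_centralizer_iff.1 h2.2 x rfl, Subring.mem_centralizer_iff.1 h1.1 x rfl⟩,
    ⟨Subring.mem_centralizer_iff.1 h2.1 x rfl, Subring.mem_centralizer_iff.1 h1.2 x rfl⟩⟩

end Fock

end

end CoupledHL

namespace CoupledHL

noncomputable section

open PowerSeries
open Finset.HasAntidiagonal (antidiagonal mem_antidiagonal)

/-! ### Intertwining of the monodromy matrix and the vertex operators -/

section Act

variable {W : Type*} [AddCommGroup W] [Module K W] (ρ : Module.End K PolyOne →ₐ[K] Module.End K W)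

/-- The action of series of operators on series of vectors. -/
def act (F : PowerSeries (Module.End K PolyOne)) (s : ℕ → W) (k : ℕ) : W :=
  ∑ p ∈ antidiagonal k, ρ (coeff p.1 F) (s p.2)

theorem act_mul (F G : PowerSeries (Module.End K PolyOne)) (s : ℕ → W) :
    act ρ (F * G) s = act ρ F (act ρ G s) := by
  funext k
  simp only [act, coeff_mul, map_sum, map_mul, LinearMap.sum_apply, Module.End.mul_apply]
  rw [Finset.sum_sigma', Finset.sum_sigma']
  refine Finset.sum_nbij' (fun x => ⟨(x.2.1, x.2.2 + x.1.2), (x.2.2, x.1.2)⟩)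
    (fun x => ⟨(x.1.1 + x.2.1, x.2.2), (x.1.1, x.2.1)⟩) ?_ ?_ ?_ ?_ ?_
  · rintro ⟨⟨a, b⟩, ⟨c, d⟩⟩ hx
    simp only [Finset.mem_sigma, mem_antidiagonal] at hx ⊢
    obtain ⟨rfl, rfl⟩ := hx
    exact ⟨by simp only [add_assoc], trivial⟩
  · rintro ⟨⟨a, b⟩, ⟨c, d⟩⟩ hx
    simp only [Finset.mem_sigma, mem_antidiagonal] at hx ⊢
    obtain ⟨rfl, rfl⟩ := hx
    exact ⟨by simp only [add_assoc], trivial⟩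
  · rintro ⟨⟨a, b⟩, ⟨c, d⟩⟩ hx
    simp only [Finset.mem_sigma, mem_antidiagonal] at hx ⊢
    obtain ⟨rfl, rfl⟩ := hx
    rfl
  · rintro ⟨⟨a, b⟩, ⟨c, d⟩⟩ hx
    simp only [Finset.mem_sigma, mem_antidiagonal] at hx ⊢
    obtain ⟨rfl, rfl⟩ := hx
    rfl
  · rintro ⟨⟨a, b⟩, ⟨c, d⟩⟩ hx
    rfl

theorem act_add (F G : PowerSeries (Module.End K PolyOne)) (s : ℕ → W) :
    act ρ (F + G) s = act ρ F s + act ρ G s := by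
  funext k
  simp [act, Finset.sum_add_distrib]

theorem act_sub (F G : PowerSeries (Module.End K PolyOne)) (s : ℕ → W) :
    act ρ (F - G) s = act ρ F s - act ρ G s := by
  funext k
  simp [act, Finset.sum_sub_distrib]

theorem act_smul (c : K) (F : PowerSeries (Module.End K PolyOne)) (s : ℕ → W) :
    act ρ (c • F) s = c • act ρ F s := by
  funext k
  simp [act, Finset.smul_sum]

theorem act_add_right (F : PowerSeries (Module.End K PolyOne)) (s s' : ℕ → W) :
    act ρ F (s + s') = act ρ F s + act ρ F s' := by
  funext k
  simp [act, Finset.sum_add_distrib]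

theorem act_smul_right (c : K) (F : PowerSeries (Module.End K PolyOne)) (s : ℕ → W) :
    act ρ F (c • s) = c • act ρ F s := by
  funext k
  simp [act, Finset.smul_sum]

theorem act_C (a : Module.End K PolyOne) (s : ℕ → W) :
    act ρ (C a) s = fun k => ρ a (s k) := by
  funext k
  rw [act, Finset.Nat.sum_antidiagonal_eq_sum_range_succ (fun i j => ρ (coeff i (C a)) (s j)),
    Finset.sum_range_succ']
  simp [coeff_C]

theorem act_X_succ (s : ℕ → W) (k : ℕ) : act ρ X s (k + 1) = s k := by
  rw [act, Finset.sum_eq_single (1, k)]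
  · simp
  · rintro ⟨a, b⟩ hp hab
    rw [mem_antidiagonal] at hp
    rw [coeff_X, if_neg, map_zero, LinearMap.zero_apply]
    rintro rfl
    exact hab (Prod.ext rfl (by simp only at hp ⊢; omega))
  · intro hn
    exact absurd (mem_antidiagonal.2 (add_comm 1 k)) hn

theorem act_X_zero (s : ℕ → W) : act ρ X s 0 = 0 := by
  simp [act]

theorem act_single (F : PowerSeries (Module.End K PolyOne)) (w : W) :
    act ρ F (Pi.single 0 w) = fun k => ρ (coeff k F) w := by
  funext k
  rw [act, Finset.sum_eq_single (k, 0)]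
  · simp
  · rintro ⟨a, b⟩ hp hab
    rw [mem_antidiagonal] at hp
    rw [Pi.single_eq_of_ne, map_zero]
    rintro rfl
    exact hab (Prod.ext (by simpa using hp) rfl)
  · intro hn
    exact absurd (mem_antidiagonal.2 (add_zero k)) hn

end Act

variable {ι : Type} [DecidableEq ι] {M : ℕ}

/-- `J` sends the creation operators of the chain `site` to vertex operators. -/
structure IsRealization (site : Fin M → ι) {W : Type*} [AddCommGroup W] [Module K W]
    (ρ : Module.End K PolyOne →ₐ[K] Module.End K W) (J : Fock ι →ₗ[K] W) : Prop where
  injective : Function.Injective site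
  -- When this chain is empty, J v behaves like 1 in the variables on which ρ acts; the other chain
  -- may be in any state.
  vacuum : ∀ v ∈ vac site 0, ∀ S S' : Module.End K PolyOne, S 1 = S' 1 → ρ S (J v) = ρ S' (J v)
  -- Sites are counted from 0, so site m creates a row of length m + 1. Emptiness of the later sites
  -- makes it a longest row, which a vertex operator adds in front.
  creation : ∀ m < M, ∀ v ∈ vac site (m + 1),
    J (upSeq site m v) = ρ (hOp ((m + 1 : ℕ) : ℤ)) (J v)

namespace IsRealization

variable {site : Fin M → ι} {W : Type*} [AddCommGroup W] [Module K W]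
  {ρ : Module.End K PolyOne →ₐ[K] Module.End K W} {J : Fock ι →ₗ[K] W}
  (h : IsRealization site ρ J)
include h

theorem creation_pow {m : ℕ} (hm : m < M) (r : ℕ) {v : Fock ι} (hv : v ∈ vac site (m + 1)) :
    J ((upSeq site m ^ r) v) = ρ (hOp ((m + 1 : ℕ) : ℤ) ^ r) (J v) := by
  induction r with
  | zero => simp
  | succ r ih =>
    rw [pow_succ', Module.End.mul_apply,
      h.creation m hm _ (upSeq_pow_mem_vac h.injective (Nat.lt_succ_self m) r hv), ih, pow_succ',
      map_mul, Module.End.mul_apply]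

theorem commute_up {m : ℕ} (r k : ℕ) :
    (Commute (upSeq site m ^ r) (coeff k (aSeries site m)) ∧
      Commute (upSeq site m ^ r) (coeff k (bSeries site m))) ∧
    (Commute (upSeq site m ^ r) (coeff k (cSeries site m)) ∧
      Commute (upSeq site m ^ r) (coeff k (dSeries site m))) :=
  commute_coeff_series
    (fun _ _ => ((show Commute _ _ from upSeq_mul_upSeq m _).pow_left r).eq)
    (fun j hj => ((show Commute _ _ from
      (dnSeq_mul_upSeq h.injective (ne_of_lt hj)).symm).pow_left r).eq) k

theorem commute_dn {m i : ℕ} (hi : m ≤ i) (k : ℕ) :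
    (Commute (dnSeq site i) (coeff k (aSeries site m)) ∧
      Commute (dnSeq site i) (coeff k (bSeries site m))) ∧
    (Commute (dnSeq site i) (coeff k (cSeries site m)) ∧
      Commute (dnSeq site i) (coeff k (dSeries site m))) :=
  commute_coeff_series
    (fun j hj => dnSeq_mul_upSeq h.injective (by omega))
    (fun j _ => dnSeq_mul_dnSeq i j) k

end IsRealization

/-- `B` of an empty site after `(B†)ʳ`. -/
theorem dnSeq_upSeq_pow {site : Fin M → ι} {m : ℕ} (hm : m < M) (r : ℕ) {v : Fock ι}
    (hv : v ∈ vac site m) :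
    dnSeq site m ((upSeq site m ^ (r + 1)) v) =
      (1 - tParam ^ (r + 1)) • (upSeq site m ^ r) v := by
  have := LinearMap.congr_fun (dnSeq_mul_upSeq_pow (site := site) hm r) v
  simpa only [Module.End.mul_apply, LinearMap.add_apply, LinearMap.smul_apply,
    dnSeq_vac site le_rfl hv, map_zero, smul_zero, add_zero] using this

/-- Annihilation at the site multiplies a basis vector with r > 0 particles there by 1 − tʳ ≠ 0 and
sends distinct such vectors to distinct ones, so its kernel contains only vectors with that site
empty. -/
theorem mem_vac_of_dnSeq_eq_zero {site : Fin M → ι} {m : ℕ} (hm : m < M) {v : Fock ι} (hv : v ∈ vac site (m + 1))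
    (hd : dnSeq site m v = 0) : v ∈ vac site m := by
  rw [vac, Finsupp.mem_supported] at hv ⊢
  intro n hn j hj
  rcases Nat.lt_or_ge m j with hj' | hj'
  · exact hv hn j hj'
  have hjm : j = ⟨m, hm⟩ := Fin.ext (le_antisymm hj' hj)
  by_contra h0
  rw [Finset.mem_coe, Finsupp.mem_support_iff] at hn
  refine hn ?_
  set i := site ⟨m, hm⟩ with hi
  rw [hjm, ← hi] at h0
  have e : ∀ w : Fock ι, lower i w (Function.update n i (n i - 1)) = (1 - tParam ^ n i) * w n := by
    intro w
    induction w using Finsupp.induction_linear with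
    | zero => simp
    | add x y hx hy => rw [map_add, Finsupp.add_apply, hx, hy, Finsupp.add_apply, mul_add]
    | single n' c =>
      classical
      rw [lower_single, Finsupp.single_apply, Finsupp.single_apply]
      by_cases hn' : n' = n
      · subst hn'
        rw [if_pos rfl, if_pos rfl, mul_comm]
      · rw [if_neg hn', mul_zero]
        -- Truncated subtraction could identify occupation number 0 with occupation number 1; the
        -- weight 1 − t⁰ = 0 removes that case.
        split_ifs with h2
        · have h3 : n' i - 1 = n i - 1 := by simpa using congrFun h2 i
          have h4 : n' i = 0 := by
            by_contra h4
            refine hn' ?_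
            have h5 : n' i = n i := by omega
            funext a
            rcases eq_or_ne a i with rfl | ha
            · exact h5
            · simpa [Function.update_of_ne ha] using congrFun h2 a
          rw [h4, pow_zero, sub_self, mul_zero]
        · rfl
  have := e v
  rw [dnSeq_of_lt site hm, ← hi] at hd
  rw [hd, Finsupp.zero_apply] at this
  exact (mul_eq_zero.1 this.symm).resolve_left (one_sub_tParam_pow_ne_zero h0)

theorem exists_dnSeq_pow_eq_zero {site : Fin M → ι} {m : ℕ} (hm : m < M) (v : Fock ι) :
    ∃ N, (dnSeq site m ^ N) v = 0 := by
  have hle : ∀ N N', N ≤ N' → ∀ x : Fock ι, (dnSeq site m ^ N) x = 0 →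
      (dnSeq site m ^ N') x = 0 := by
    intro N N' hN x hx
    rw [← Nat.sub_add_cancel hN, pow_add, Module.End.mul_apply, hx, map_zero]
  induction v using Finsupp.induction_linear with
  | zero => exact ⟨0, map_zero _⟩
  | add x y hx hy =>
    obtain ⟨N, hN⟩ := hx
    obtain ⟨N', hN'⟩ := hy
    refine ⟨N + N', ?_⟩
    rw [map_add, hle N _ (by omega) x hN, hle N' _ (by omega) y hN', add_zero]
  | single n c =>
    rw [dnSeq_of_lt site hm]
    generalize site ⟨m, hm⟩ = i
    obtain ⟨r, hr⟩ : ∃ r, r = n i := ⟨_, rfl⟩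
    refine ⟨r + 1, ?_⟩
    induction r generalizing n c with
    | zero => simp [lower_single, ← hr]
    | succ r ih =>
      rw [pow_succ, Module.End.mul_apply, lower_single]
      exact ih _ _ (by rw [Function.update_self]; omega)

theorem qInt_zero : qInt 0 = 1 := by rw [← qAt_id, qAt_zero]

/-- D⁺ fixes 1, and H_{−j}·1 = q_{−j} vanishes for j > 0. This is the value of the entry A before
any site is added. -/
theorem coeff_eOp_one (k : ℕ) : coeff k (eOp 1) (1 : PolyOne) = if k = 1 then 1 else 0 := by
  rcases k with _ | k
  · simp [eOp, mul_assoc]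
  · rw [eOp, mul_assoc, coeff_succ_X_mul, coeff_mul, LinearMap.sum_apply,
      Finset.sum_eq_single (k, 0)]
    · rw [Module.End.mul_apply, coeff_dPlus_one, if_pos rfl, hDown, coeff_mk, hOp_one]
      rcases k with _ | k
      · simpa using qInt_zero
      · rw [qInt_of_neg (by push_cast; omega), if_neg (by omega)]
    · rintro ⟨a, b⟩ hp hab
      rw [mem_antidiagonal] at hp
      rw [Module.End.mul_apply, coeff_dPlus_one, if_neg, map_zero]
      rintro rfl
      exact hab (Prod.ext (by simpa using hp) rfl)
    · intro hn
      exact absurd (mem_antidiagonal.2 (add_zero k)) hn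

theorem coeff_X_mul_eq {A : Type*} [Semiring A] (F : PowerSeries A) (k : ℕ) :
    coeff k (X * F) = if k = 0 then 0 else coeff (k - 1) F := by
  rcases k with _ | k
  · rw [coeff_zero_X_mul, if_pos rfl]
  · rw [coeff_succ_X_mul, if_neg (Nat.succ_ne_zero k), Nat.add_sub_cancel]

/-! ### The intertwining relations for C̃ and B̃, and injectivity. -/

namespace IsRealization

variable {site : Fin M → ι} {W : Type*} [AddCommGroup W] [Module K W]
  {ρ : Module.End K PolyOne →ₐ[K] Module.End K W} {J : Fock ι →ₗ[K] W}
  (h : IsRealization site ρ J)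
include h

/-- C̃ and A must be treated together, since each new site mixes them. On (B†)ʳ v with the new site
empty in v, the recursion for C̃ gives (B†)ʳ C̃ v + (1 − tʳ)(B†)ʳ⁻¹ A v for r > 0, which is the
pattern of `dPlus_mul_hOp_pow`; the recursion for A matches `eOp_succ_mul_hOp_pow`. -/
theorem lower_intertwine {m : ℕ} (hm : m ≤ M) : ∀ v ∈ vac site m, ∀ k,
    J (coeff k (cSeries site m) v) = ρ (coeff k dPlus) (J v) ∧
      J (coeff k (aSeries site m) v) = ρ (coeff k (eOp ((m + 1 : ℕ) : ℤ))) (J v) := by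
  induction m with
  | zero =>
    intro v hv k
    have e1 := h.vacuum v hv (coeff k dPlus) (if k = 0 then 1 else 0) (by
      rw [coeff_dPlus_one]; split_ifs <;> rfl)
    have e2 := h.vacuum v hv (coeff k (eOp 1)) (if k = 1 then 1 else 0) (by
      rw [coeff_eOp_one]; split_ifs <;> rfl)
    rw [zero_add, Nat.cast_one, e1, e2, cSeries, aSeries, chain, coeff_one, coeff_X]
    constructor <;> split_ifs <;> simp
  | succ m ih =>
    intro v hv k
    have ih := ih (by omega)
    have hmono := vac_mono site (Nat.le_succ m)
    have hc : cSeries site (m + 1) = cSeries site m + C (dnSeq site m) * aSeries site m := rfl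
    have ha : aSeries site (m + 1) = X * (aSeries site m + C (upSeq site m) * cSeries site m) := rfl
    refine ⟨eq_on_vac_succ site hm (J ∘ₗ coeff k (cSeries site (m + 1)))
      (ρ (coeff k dPlus) ∘ₗ J) (fun r v hv => ?_) hv,
      eq_on_vac_succ site hm (J ∘ₗ coeff k (aSeries site (m + 1)))
      (ρ (coeff k (eOp ((m + 1 + 1 : ℕ) : ℤ))) ∘ₗ J) (fun r v hv => ?_) hv⟩
    · have hcv := (coeff_ac_mem_vac h.injective k hv).1
      have hav := (coeff_ac_mem_vac h.injective k hv).2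
      rw [LinearMap.comp_apply, LinearMap.comp_apply, h.creation_pow hm r (hmono hv), hc, map_add,
        coeff_C_mul, LinearMap.add_apply, Module.End.mul_apply,
        ← Module.End.mul_apply (coeff k (cSeries site m)), ← (h.commute_up r k).2.1.eq,
        ← Module.End.mul_apply (coeff k (aSeries site m)), ← (h.commute_up r k).1.1.eq,
        Module.End.mul_apply, Module.End.mul_apply, map_add, h.creation_pow hm r (hmono hcv),
        (ih v hv k).1]
      rcases r with _ | r
      · rw [pow_zero, pow_zero, Module.End.one_apply, dnSeq_vac site le_rfl hav, map_zero, add_zero,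
          map_one, Module.End.one_apply, Module.End.one_apply]
      · rw [dnSeq_upSeq_pow hm r hav, map_smul, h.creation_pow hm r (hmono hav), (ih v hv k).2]
        have e := congrArg (coeff k) (dPlus_mul_hOp_pow ((m + 1 : ℕ) : ℤ) r)
        rw [← map_pow, ← map_pow, coeff_mul_C, map_add, coeff_C_mul, coeff_smul, coeff_C_mul] at e
        simp only [← Module.End.mul_apply, ← map_mul, e]
        simp only [map_add, map_smul, LinearMap.add_apply, LinearMap.smul_apply]
    · rw [LinearMap.comp_apply, LinearMap.comp_apply, h.creation_pow hm r (hmono hv), ha]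
      have e := congrArg (coeff k) (eOp_succ_mul_hOp_pow ((m + 1 : ℕ) : ℤ) r)
      rw [← map_pow, coeff_mul_C, mul_add, ← mul_assoc, ← map_mul, coeff_X_mul_eq, map_add,
        coeff_C_mul, coeff_C_mul] at e
      rw [← Module.End.mul_apply (ρ _), ← map_mul, Nat.cast_succ (m + 1), e, coeff_X_mul_eq]
      split_ifs
      · simp
      · have hcv := (coeff_ac_mem_vac h.injective (k - 1) hv).1
        have hav := (coeff_ac_mem_vac h.injective (k - 1) hv).2
        rw [map_add, LinearMap.add_apply, coeff_C_mul, Module.End.mul_apply,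
          ← Module.End.mul_apply (coeff (k - 1) (cSeries site m)), ← (h.commute_up r (k - 1)).2.1.eq,
          ← Module.End.mul_apply (coeff (k - 1) (aSeries site m)),
          ← (h.commute_up r (k - 1)).1.1.eq, Module.End.mul_apply, Module.End.mul_apply,
          ← Module.End.mul_apply (upSeq site m), ← pow_succ', map_add,
          h.creation_pow hm r (hmono hav), h.creation_pow hm (r + 1) (hmono hcv), (ih v hv _).1,
          (ih v hv _).2, map_add, LinearMap.add_apply, map_mul, Module.End.mul_apply, map_mul,
          Module.End.mul_apply, ← pow_succ]

/-- Multiplication by q(z) also creates rows longer than m, which m sites cannot hold; the term with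
D accounts for them. The induction uses that conjugation of H_{m+1}ʳ by q(z) is known explicitly
from `qMul_mul_hOp_pow`. -/
theorem upper_intertwine {m : ℕ} (hm : m ≤ M) : ∀ v ∈ vac site m,
    act ρ qMul (Pi.single 0 (J v)) = (fun k => J (coeff k (bSeries site m) v)) +
      act ρ (hUp ((m + 1 : ℕ) : ℤ)) (fun k => J (coeff k (dSeries site m) v)) := by
  induction m with
  | zero =>
    intro v hv
    have e1 : (fun k => J (coeff k (bSeries site 0) v)) = Pi.single 0 (J v) := by
      funext k
      rw [bSeries, chain, coeff_one]
      rcases k with _ | k <;> simp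
    have e2 : (fun k => J (coeff k (dSeries site 0) v)) = act ρ X (Pi.single 0 (J v)) := by
      funext k
      simp only [dSeries, chain, act_single, coeff_X]
      split_ifs <;> simp
    rw [e1, e2, ← act_mul, act_single, act_single]
    funext k
    have e3 := h.vacuum v hv (coeff k qMul) (coeff k (1 + hUp 1 * X)) (by
      rw [qMul, coeff_mk, LinearMap.mulLeft_apply, mul_one, map_add, LinearMap.add_apply]
      rcases k with _ | k
      · simp [← qInt_natCast, qInt_zero]
      · rw [coeff_succ_mul_X, hUp, coeff_mk, hOp_one, coeff_one, if_neg (Nat.succ_ne_zero k),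
          LinearMap.zero_apply, zero_add, ← qInt_natCast, Nat.cast_succ, add_comm])
    rw [e3, zero_add, Nat.cast_one, map_add, map_add, LinearMap.add_apply, Pi.add_apply, coeff_one]
    rcases k with _ | k <;> simp
  | succ m ih =>
    intro v hv
    have ih := ih (by omega)
    have hmono := vac_mono site (Nat.le_succ m)
    have hb : bSeries site (m + 1) = bSeries site m + C (upSeq site m) * dSeries site m := rfl
    have hd : dSeries site (m + 1) = X * (dSeries site m + C (dnSeq site m) * bSeries site m) := rfl
    have key : ∀ r : ℕ, ∀ v ∈ vac site m, act ρ qMul (Pi.single 0 (J ((upSeq site m ^ r) v))) =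
        (fun k => J (coeff k (bSeries site (m + 1)) ((upSeq site m ^ r) v))) +
        act ρ (hUp ((m + 1 + 1 : ℕ) : ℤ))
          (fun k => J (coeff k (dSeries site (m + 1)) ((upSeq site m ^ r) v))) := by
      intro r v hv
      have hbv := fun k => (coeff_bd_mem_vac h.injective k hv).1
      have hdv := fun k => (coeff_bd_mem_vac h.injective k hv).2
      have hbu : ∀ k r, coeff k (bSeries site m) ((upSeq site m ^ r) v) =
          (upSeq site m ^ r) (coeff k (bSeries site m) v) := fun k r =>
        (LinearMap.congr_fun (h.commute_up r k).1.2.eq v).symm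
      have hdu : ∀ k r, coeff k (dSeries site m) ((upSeq site m ^ r) v) =
          (upSeq site m ^ r) (coeff k (dSeries site m) v) := fun k r =>
        (LinearMap.congr_fun (h.commute_up r k).2.2.eq v).symm
      have ih := ih v hv
      set β := fun k => J (coeff k (bSeries site m) v) with hβ
      set δ := fun k => J (coeff k (dSeries site m) v) with hδ
      set H := hOp ((m + 1 : ℕ) : ℤ) with hH
      have e0 : Pi.single 0 (J ((upSeq site m ^ r) v)) =
          act ρ (C (H ^ r)) (Pi.single 0 (J v)) := by
        rw [h.creation_pow hm r (hmono hv), act_C]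
        funext k
        rcases k with _ | k <;> simp [hH]
      have e1 : (fun k => J (coeff k (bSeries site (m + 1)) ((upSeq site m ^ r) v))) =
          act ρ (C (H ^ r)) β + act ρ (C (H ^ (r + 1))) δ := by
        funext k
        rw [hb, map_add, coeff_C_mul, LinearMap.add_apply, Module.End.mul_apply, hbu, hdu,
          ← Module.End.mul_apply (upSeq site m), ← pow_succ', map_add,
          h.creation_pow hm r (hmono (hbv k)), h.creation_pow hm (r + 1) (hmono (hdv k)), act_C,
          act_C]
        rfl
      -- At r = 0 the exponent `r - 1` is meaningless, but its coefficient 1 − t⁰ is zero.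
      have e2 : (fun k => J (coeff k (dSeries site (m + 1)) ((upSeq site m ^ r) v))) =
          act ρ X (act ρ (C (H ^ r)) δ + (1 - tParam ^ r) • act ρ (C (H ^ (r - 1))) β) := by
        funext k
        rcases k with _ | k
        · rw [act_X_zero, hd, coeff_zero_X_mul, LinearMap.zero_apply, map_zero]
        · rw [act_X_succ, hd, coeff_succ_X_mul, map_add, coeff_C_mul, LinearMap.add_apply,
            Module.End.mul_apply, hbu, hdu, map_add, h.creation_pow hm r (hmono (hdv k)), act_C,
            act_C, Pi.add_apply, Pi.smul_apply]
          congr 1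
          rcases r with _ | r
          · rw [pow_zero, pow_zero, sub_self, zero_smul, Module.End.one_apply,
              dnSeq_vac site le_rfl (hbv k), map_zero]
          · rw [dnSeq_upSeq_pow hm r (hbv k), map_smul, h.creation_pow hm r (hmono (hbv k)),
              Nat.add_sub_cancel]
      have hX : ∀ G : PowerSeries (Module.End K PolyOne), G * X = X * G :=
        fun G => PowerSeries.commute_X G
      -- The factor X of the new D lowers the starting index of the correction by one; the
      -- subtracted H-term cancels the creation term of the new B̃.
      have hS : hUp ((m + 1 + 1 : ℕ) : ℤ) * X = hUp ((m + 1 : ℕ) : ℤ) - C H := by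
        rw [hX, hUp_eq ((m + 1 : ℕ) : ℤ), ← hH, add_sub_cancel_left, Nat.cast_succ (m + 1)]
      rw [e0, e1, e2, ← act_mul, ← act_mul, hS]
      rcases r with _ | r
      · rw [pow_zero, pow_zero, sub_self, zero_smul, add_zero, map_one, mul_one, ih, zero_add,
          pow_one, ← act_mul, mul_one, act_sub, ← map_one C, act_C]
        simp only [map_one, Module.End.one_apply]
        abel
      · obtain ⟨Y, hq, hY, hYS⟩ := qMul_mul_hOp_pow ((m + 1 : ℕ) : ℤ) r
        rw [← hH, ← map_pow] at hq hYS
        rw [← hH, ← map_pow, ← map_pow] at hY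
        rw [hq, act_mul, ih, act_add_right, ← act_mul, hYS, hY, act_add, act_smul, act_smul,
          act_add_right, ← act_mul, act_smul_right, ← act_mul, sub_mul, sub_mul, ← map_mul,
          ← map_mul, ← pow_succ', Nat.add_sub_cancel, ← pow_succ', act_sub, act_sub]
        simp only [sub_smul, one_smul, smul_sub]
        abel
    funext k
    -- Coefficient by coefficient both sides are linear in the vector, so powers of the creation
    -- operator suffice.
    have e := eq_on_vac_succ site hm (ρ (coeff k qMul) ∘ₗ J)
      (J ∘ₗ coeff k (bSeries site (m + 1)) + ∑ p ∈ antidiagonal k,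
        ρ (coeff p.1 (hUp ((m + 1 + 1 : ℕ) : ℤ))) ∘ₗ J ∘ₗ coeff p.2 (dSeries site (m + 1)))
      (fun r v hv => ?_) hv
    · rw [act_single]
      simpa only [act, LinearMap.add_apply, LinearMap.sum_apply, LinearMap.comp_apply,
        Pi.add_apply] using e
    · have := congrFun (key r v hv) k
      rw [act_single] at this
      simpa only [act, LinearMap.add_apply, LinearMap.sum_apply, LinearMap.comp_apply,
        Pi.add_apply] using this

/-- The operator `C̃` acts by the coefficients of `exp (ξ(∂̃, w))`. -/
theorem lower_eq (v : Fock ι) (k : ℕ) :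
    J (coeff k (cSeries site M) v) = ρ (coeff k dPlus) (J v) :=
  (h.lower_intertwine le_rfl v (by rw [vac_top]; trivial) k).1

/-- Multiplication by `q_k` in terms of the operators `B̃` and `D`. -/
theorem upper_eq (v : Fock ι) (k : ℕ) :
    ρ (mulOp (qPoly k)) (J v) = J (coeff k (bSeries site M) v) + ∑ p ∈ antidiagonal k,
      ρ (hOp ((M + 1 + p.1 : ℕ) : ℤ)) (J (coeff p.2 (dSeries site M) v)) := by
  have := congrFun (h.upper_intertwine le_rfl v (by rw [vac_top]; trivial)) k
  rw [act_single] at this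
  simpa only [qMul, hUp, coeff_mk, act, Pi.add_apply, ← Nat.cast_add] using this

/-- Each empty site beyond the L-th contributes a bare factor X to D, because its annihilation
operator commutes with B̃ of the earlier sites and kills v. -/
theorem dSeries_eq_zero {L m k : ℕ} (hk : k + L < m) {v : Fock ι} (hv : v ∈ vac site L) :
    coeff k (dSeries site m) v = 0 := by
  induction m generalizing k with
  | zero => omega
  | succ m ih =>
    have hd : dSeries site (m + 1) = X * (dSeries site m + C (dnSeq site m) * bSeries site m) := rfl
    rw [hd]
    rcases k with _ | k
    · rw [coeff_zero_X_mul, LinearMap.zero_apply]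
    · rw [coeff_succ_X_mul, map_add, coeff_C_mul, LinearMap.add_apply, ih (by omega),
        (h.commute_dn le_rfl k).1.2.eq, Module.End.mul_apply, dnSeq_vac site (by omega) hv,
        map_zero, add_zero]

/-- Far from the occupied sites, `B̃` acts by multiplication by `q_k`. -/
theorem upper_eq_of_lt {L k : ℕ} (hk : k + L < M) {v : Fock ι} (hv : v ∈ vac site L) :
    J (coeff k (bSeries site M) v) = ρ (mulOp (qPoly k)) (J v) := by
  rw [h.upper_eq, Finset.sum_eq_zero, add_zero]
  intro p hp
  rw [mem_antidiagonal] at hp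
  rw [h.dSeries_eq_zero (by omega) hv, map_zero, map_zero]

/-- The top coefficient of C̃ is the annihilation operator of the last site, so the kernel of J is
stable under it. This operator is locally nilpotent, and an inner induction shows that it kills v;
then the last site is empty in v and m drops by one. -/
theorem eq_zero_of_map_eq_zero (h0 : ∀ v ∈ vac site 0, J v = 0 → v = 0) {m : ℕ} (hm : m ≤ M) :
    ∀ v ∈ vac site m, J v = 0 → v = 0 := by
  induction m with
  | zero => exact h0
  | succ m ih =>
    intro v hv hJ
    obtain ⟨N, hN⟩ := exists_dnSeq_pow_eq_zero (site := site) hm v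
    induction N generalizing v with
    | zero => exact hN
    | succ N ihN =>
      refine ih (by omega) v (mem_vac_of_dnSeq_eq_zero hm hv
        (ihN _ (dnSeq_mem_vac h.injective hv) ?_ ?_)) hJ
      · have := (h.lower_intertwine hm v hv (m + 1)).1
        have e : coeff (m + 1) (cSeries site (m + 1)) = dnSeq site m := coeff_top_chain_fst _ _ _
        rwa [e, hJ, map_zero] at this
      · rw [← Module.End.mul_apply, ← pow_succ, hN]

/-- `J` is injective if it is injective on the vacuum vectors. -/
theorem injective_of_vacuum (h0 : ∀ v ∈ vac site 0, J v = 0 → v = 0) : Function.Injective J :=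
  (injective_iff_map_eq_zero J).2 fun v =>
    h.eq_zero_of_map_eq_zero h0 le_rfl v (by rw [vac_top]; trivial)

end IsRealization

end

end CoupledHL

namespace CoupledHL

noncomputable section

open PowerSeries
open Finset.HasAntidiagonal (antidiagonal mem_antidiagonal)

/-! ### Occupation numbers and Young diagrams -/

theorem rowLens_injective : Function.Injective YoungDiagram.rowLens := fun lam mu h => by
  have e : ∀ {l l' : List ℕ} (hl : l.SortedGE) (hl' : l'.SortedGE), l = l' →
      YoungDiagram.ofRowLens l hl = YoungDiagram.ofRowLens l' hl' := by
    rintro l _ hl hl' rfl; rfl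
  rw [← lam.ofRowLens_to_rowLens_eq_self, ← mu.ofRowLens_to_rowLens_eq_self]
  exact e _ _ h

theorem rowLen_zero_eq_headD (lam : YoungDiagram) : lam.rowLen 0 = lam.rowLens.headD 0 := by
  rcases h : lam.rowLens with _ | ⟨a, l⟩
  · rw [List.headD_nil]
    by_contra h0
    have h1 : (0, 0) ∈ lam := YoungDiagram.mem_iff_lt_rowLen.2 (Nat.pos_of_ne_zero h0)
    have h2 : 0 < lam.rowLens.length := by
      rw [YoungDiagram.length_rowLens]
      exact YoungDiagram.mem_iff_lt_colLen.1 h1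
    rw [h] at h2
    exact absurd h2 (lt_irrefl 0)
  · have h0 : 0 < lam.rowLens.length := by rw [h]; simp
    have h1 := YoungDiagram.get_rowLens (μ := lam) (h := h0)
    rw [← h1, List.headD_cons]
    simp [h]

theorem rowLen_zero_le_iff (lam : YoungDiagram) (M : ℕ) :
    lam.rowLen 0 ≤ M ↔ ∀ x ∈ lam.rowLens, x ≤ M := by
  constructor
  · intro h x hx
    obtain ⟨i, hi, rfl⟩ := List.getElem_of_mem hx
    rw [YoungDiagram.get_rowLens]
    exact (lam.rowLen_anti 0 i (Nat.zero_le _)).trans h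
  · intro h
    rw [rowLen_zero_eq_headD]
    rcases hl : lam.rowLens with _ | ⟨a, l⟩
    · simp
    · exact h a (by rw [hl]; simp)

/-- The multiset of the parts of `1^{n₁} 2^{n₂} ⋯`. -/
def partsOf {M : ℕ} (n : Fin M → ℕ) : Multiset ℕ := ∑ i, n i • {(i : ℕ) + 1}

theorem count_partsOf {M : ℕ} (n : Fin M → ℕ) (i : Fin M) :
    (partsOf n).count ((i : ℕ) + 1) = n i := by
  rw [partsOf, Multiset.count_sum', Finset.sum_eq_single i]
  · simp
  · intro j _ hj
    rw [Multiset.count_nsmul, Multiset.count_singleton, if_neg, mul_zero]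
    intro h
    exact hj (Fin.ext (by omega))
  · simp

theorem mem_partsOf {M : ℕ} (n : Fin M → ℕ) (x : ℕ) :
    x ∈ partsOf n ↔ ∃ i : Fin M, n i ≠ 0 ∧ x = i + 1 := by
  rw [partsOf, Multiset.mem_sum]
  simp [Multiset.mem_nsmul]

theorem partsOf_update {M : ℕ} (n : Fin M → ℕ) (i : Fin M) :
    partsOf (Function.update n i (n i + 1)) = ((i : ℕ) + 1) ::ₘ partsOf n := by
  rw [partsOf, partsOf, ← Finset.add_sum_erase _ _ (Finset.mem_univ i),
    ← Finset.add_sum_erase _ (fun i => n i • ({(i : ℕ) + 1} : Multiset ℕ)) (Finset.mem_univ i),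
    Function.update_self, succ_nsmul', add_assoc, Multiset.singleton_add]
  congr 2
  refine Finset.sum_congr rfl fun j hj => ?_
  rw [Function.update_of_ne (Finset.ne_of_mem_erase hj)]

theorem rowLens_diagramOf {M : ℕ} (n : Fin M → ℕ) :
    (diagramOf n).rowLens = (partsOf n).sort (· ≥ ·) := by
  refine YoungDiagram.rowLens_ofRowLens_eq_self fun x hx => ?_
  rw [Multiset.mem_sort] at hx
  obtain ⟨i, -, rfl⟩ := (mem_partsOf n x).1 hx
  exact Nat.succ_pos _

theorem coe_rowLens_diagramOf {M : ℕ} (n : Fin M → ℕ) :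
    ((diagramOf n).rowLens : Multiset ℕ) = partsOf n := by
  rw [rowLens_diagramOf, Multiset.sort_eq]

theorem diagramOf_injective (M : ℕ) :
    Function.Injective (diagramOf : (Fin M → ℕ) → YoungDiagram) := by
  intro n n' h
  funext i
  rw [← count_partsOf n, ← count_partsOf n', ← coe_rowLens_diagramOf, ← coe_rowLens_diagramOf, h]

theorem rowLen_diagramOf_le {M : ℕ} (n : Fin M → ℕ) : (diagramOf n).rowLen 0 ≤ M := by
  rw [rowLen_zero_le_iff]
  intro x hx
  rw [← Multiset.mem_coe, coe_rowLens_diagramOf] at hx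
  obtain ⟨i, -, rfl⟩ := (mem_partsOf n x).1 hx
  exact i.2

theorem exists_diagramOf_eq {M : ℕ} {lam : YoungDiagram} (h : lam.rowLen 0 ≤ M) :
    ∃ n : Fin M → ℕ, diagramOf n = lam := by
  refine ⟨fun i => lam.rowLens.count ((i : ℕ) + 1), rowLens_injective ?_⟩
  rw [rowLens_diagramOf]
  have e : partsOf (fun i : Fin M => lam.rowLens.count ((i : ℕ) + 1)) = lam.rowLens := by
    refine Multiset.ext.2 fun x => ?_
    rw [Multiset.coe_count]
    by_cases hx : x ∈ lam.rowLens
    · have h1 := lam.pos_of_mem_rowLens x hx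
      have h2 := (rowLen_zero_le_iff lam M).1 h x hx
      obtain ⟨y, rfl⟩ : ∃ y, x = y + 1 := ⟨x - 1, by omega⟩
      exact count_partsOf _ (⟨y, h2⟩ : Fin M)
    · rw [List.count_eq_zero_of_not_mem hx, Multiset.count_eq_zero, mem_partsOf]
      rintro ⟨i, hi, rfl⟩
      exact hi (List.count_eq_zero_of_not_mem hx)
  rw [e]
  exact (Multiset.coe_eq_coe.1 (Multiset.sort_eq _ _)).eq_of_pairwise
    (fun a b _ _ h h' => le_antisymm h' h) (Multiset.pairwise_sort _ _)
    lam.rowLens_sorted.pairwise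

theorem hallQ_diagramOf_zero (M : ℕ) : hallQ (diagramOf (0 : Fin M → ℕ)) = 1 := by
  have : partsOf (0 : Fin M → ℕ) = 0 := by simp [partsOf]
  rw [hallQ_eq_foldr, rowLens_diagramOf, this, Multiset.sort_zero, List.foldr_nil]

/-- No row exceeds the new one, so it comes first in the sorted list and contributes the outermost
vertex operator. -/
theorem hallQ_diagramOf_update {M : ℕ} (n : Fin M → ℕ) (i : Fin M) (h : ∀ j, i < j → n j = 0) :
    hallQ (diagramOf (Function.update n i (n i + 1))) =
      hOp (((i : ℕ) + 1 : ℕ) : ℤ) (hallQ (diagramOf n)) := by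
  rw [hallQ_eq_foldr, hallQ_eq_foldr, rowLens_diagramOf, rowLens_diagramOf, partsOf_update,
    Multiset.sort_cons, List.foldr_cons]
  intro x hx
  obtain ⟨j, hj, rfl⟩ := (mem_partsOf n x).1 hx
  have : j ≤ i := not_lt.1 fun h' => hj (h j h')
  have : (j : ℕ) ≤ i := this
  show (j : ℕ) + 1 ≤ i + 1
  omega

theorem exists_hallQ_eq_hOp {lam : YoungDiagram} {L : ℕ} (hL : 0 < L) (h : lam.rowLen 0 ≤ L) :
    ∃ lam' : YoungDiagram, lam'.rowLen 0 = L ∧ hallQ lam' = hOp (L : ℤ) (hallQ lam) := by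
  obtain ⟨n, rfl⟩ := exists_diagramOf_eq h
  obtain ⟨L, rfl⟩ : ∃ l, L = l + 1 := ⟨L - 1, by omega⟩
  refine ⟨diagramOf (Function.update n (Fin.last L) (n (Fin.last L) + 1)), ?_,
    hallQ_diagramOf_update n (Fin.last L) fun j hj => absurd hj (Fin.le_last j).not_gt⟩
  refine le_antisymm (rowLen_diagramOf_le _) ?_
  refine (rowLen_zero_le_iff _ _).1 le_rfl _ ?_
  rw [← Multiset.mem_coe, coe_rowLens_diagramOf, partsOf_update]
  simp

theorem bNorm_diagramOf {M : ℕ} (n : Fin M → ℕ) :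
    bNorm (diagramOf n) = ∏ i, ∏ j ∈ Finset.range (n i), (1 - tParam ^ (j + 1)) := by
  have e : ∀ x, (diagramOf n).rowLens.count x = (partsOf n).count x := fun x => by
    rw [← coe_rowLens_diagramOf, Multiset.coe_count]
  rw [bNorm, Finset.prod_subset (s₂ := Finset.univ.image fun i : Fin M => (i : ℕ) + 1),
    Finset.prod_image]
  · simp only [e, count_partsOf]
  · intro i _ j _ hij
    exact Fin.ext (Nat.succ_injective hij)
  · intro x hx
    rw [List.mem_toFinset, ← Multiset.mem_coe, coe_rowLens_diagramOf] at hx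
    obtain ⟨i, -, rfl⟩ := (mem_partsOf n x).1 hx
    exact Finset.mem_image_of_mem _ (Finset.mem_univ i)
  · intro x _ hx
    rw [List.mem_toFinset] at hx
    rw [List.count_eq_zero_of_not_mem hx, Finset.range_zero, Finset.prod_empty]

theorem bNorm_ne_zero (lam : YoungDiagram) : bNorm lam ≠ 0 :=
  Finset.prod_ne_zero_iff.2 fun _ _ => Finset.prod_ne_zero_iff.2 fun j _ =>
    one_sub_tParam_pow_ne_zero (Nat.succ_ne_zero j)

/-! ### Realizations of the Fock space by Hall-Littlewood functions -/

theorem IsRealization.of_single {ι : Type} [DecidableEq ι] {M : ℕ} {site : Fin M → ι}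
    (hs : Function.Injective site) {W : Type*} [AddCommGroup W] [Module K W]
    {ρ : Module.End K PolyOne →ₐ[K] Module.End K W} {J : Fock ι →ₗ[K] W}
    (hvac : ∀ n : ι → ℕ, (∀ j, n (site j) = 0) → ∀ S S' : Module.End K PolyOne, S 1 = S' 1 →
      ρ S (J (Finsupp.single n 1)) = ρ S' (J (Finsupp.single n 1)))
    (hcre : ∀ (i : Fin M) (n : ι → ℕ), (∀ j, i < j → n (site j) = 0) →
      J (Finsupp.single (Function.update n (site i) (n (site i) + 1)) 1) =
        ρ (hOp (((i : ℕ) + 1 : ℕ) : ℤ)) (J (Finsupp.single n 1))) : IsRealization site ρ J where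
  injective := hs
  vacuum v hv S S' h := by
    rw [vac_eq_span] at hv
    refine LinearMap.eqOn_span' (f := ρ S ∘ₗ J) (g := ρ S' ∘ₗ J) ?_ hv
    rintro _ ⟨n, hn, rfl⟩
    exact hvac n (fun j => hn j (Nat.zero_le _)) S S' h
  creation m hm v hv := by
    rw [vac_eq_span] at hv
    refine LinearMap.eqOn_span' (f := J ∘ₗ upSeq site m)
      (g := ρ (hOp ((m + 1 : ℕ) : ℤ)) ∘ₗ J) ?_ hv
    rintro _ ⟨n, hn, rfl⟩
    rw [LinearMap.comp_apply, LinearMap.comp_apply, upSeq_of_lt site hm, creat_single]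
    exact hcre ⟨m, hm⟩ n fun j hj => hn j hj

/-- The map from the Fock space of one chain to polynomials in one family of variables. -/
def hallMap (M : ℕ) : Fock (Fin M) →ₗ[K] PolyOne :=
  Finsupp.linearCombination K fun n => hallQ (diagramOf n)

theorem hallMap_single {M : ℕ} (n : Fin M → ℕ) :
    hallMap M (Finsupp.single n 1) = hallQ (diagramOf n) := by
  rw [hallMap, Finsupp.linearCombination_single, one_smul]

theorem isRealization_hallMap (M : ℕ) :
    IsRealization (id : Fin M → Fin M) (AlgHom.id K _) (hallMap M) := by
  refine .of_single Function.injective_id (fun n hn S S' h => ?_) fun i n hn => ?_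
  · have : n = 0 := funext hn
    subst this
    rw [hallMap_single, hallQ_diagramOf_zero]
    exact h
  · rw [hallMap_single, hallMap_single]
    exact hallQ_diagramOf_update n i hn

theorem hallMap_injective (M : ℕ) : Function.Injective (hallMap M) := by
  refine (isRealization_hallMap M).injective_of_vacuum fun v hv h => ?_
  -- For a single chain the vacuum is one-dimensional and its generator is sent to 1.
  have e : v = v 0 • Finsupp.single 0 1 := by
    rw [Finsupp.smul_single, smul_eq_mul, mul_one]
    refine (Finsupp.support_subset_singleton.1 fun n hn => ?_)
    rw [Finset.mem_singleton]
    exact funext fun j => hv hn j (Nat.zero_le _)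
  rw [e, map_smul, hallMap_single, hallQ_diagramOf_zero] at h
  have h0 : v 0 = 0 := (smul_eq_zero.1 h).resolve_right one_ne_zero
  rw [e, h0, zero_smul]

theorem range_hallMap (M : ℕ) : LinearMap.range (hallMap M) = hallSpan M := by
  rw [hallMap, Finsupp.range_linearCombination, hallSpan]
  congr 1
  ext f
  constructor
  · rintro ⟨n, rfl⟩
    exact ⟨_, rowLen_diagramOf_le n, rfl⟩
  · rintro ⟨lam, h, rfl⟩
    obtain ⟨n, rfl⟩ := exists_diagramOf_eq h
    exact ⟨n, rfl⟩

/-! ### Hall-Littlewood functions form a basis -/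

/-- Finitely many diagrams fit into M columns for some M, where independence is injectivity of
`hallMap`. -/
theorem linearIndependent_hallQ : LinearIndependent K hallQ := by
  rw [linearIndependent_iff_finset_linearIndependent]
  intro s
  have hM : ∀ x : s, x.1.rowLen 0 ≤ s.sup fun lam => lam.rowLen 0 := fun x =>
    Finset.le_sup (f := fun lam : YoungDiagram => lam.rowLen 0) x.2
  choose g hg using fun x : s => exists_diagramOf_eq (hM x)
  have h1 : LinearIndependent K fun n : Fin (s.sup fun lam => lam.rowLen 0) → ℕ =>
    hallQ (diagramOf n) := hallMap_injective _
  have h2 : Function.Injective g := fun x y h => Subtype.ext (by rw [← hg x, ← hg y, h])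
  have h3 := h1.comp g h2
  have h4 : ((fun n => hallQ (diagramOf n)) ∘ g) = hallQ ∘ Subtype.val := by
    funext x
    simp [hg x]
  rwa [h4] at h3

/-- The differential equation of the generating series gives n q_n = ∑ m(1−tᵐ) x_m q_{n−m}, which
can be solved for x_n because n(1−tⁿ) ≠ 0. -/
theorem mem_adjoin_qPoly (n : ℕ+) :
    (MvPolynomial.X n : PolyOne) ∈ Algebra.adjoin K (Set.range qPoly) := by
  have hq : ∀ k, qPoly k ∈ Algebra.adjoin K (Set.range qPoly) := fun k =>
    Algebra.subset_adjoin ⟨k, rfl⟩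
  induction n using PNat.strongInductionOn with
  | _ n ih =>
    have h := congrArg (coeff (n : ℕ)) (eul_expSeries wt (fun m : ℕ+ => (MvPolynomial.X m : PolyOne))
      fun _ _ => mul_comm _ _)
    set S := Algebra.adjoin K (Set.range qPoly)
    have e : ∀ m : ℕ+, coeff (m : ℕ) (eul (linSeries wt fun m : ℕ+ => (MvPolynomial.X m : PolyOne))) =
        (((m : ℕ) : K) * wt m) • MvPolynomial.X m := fun m => by
      rw [coeff_eul, coeff_linSeries, ← Nat.cast_smul_eq_nsmul K, smul_smul]
    have e' : ∀ k, coeff k (expSeries (linSeries wt fun m : ℕ+ => (MvPolynomial.X m : PolyOne))) =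
        qPoly k := fun k => (qPoly_eq k).symm
    have hn : ((n : ℕ), 0) ∈ antidiagonal (n : ℕ) := mem_antidiagonal.2 (add_zero _)
    rw [coeff_eul, coeff_mul, ← Finset.add_sum_erase _ _ hn, e,
      e', e', ← qInt_natCast 0, Nat.cast_zero, qInt_zero, mul_one, ← sub_eq_iff_eq_add] at h
    have hmem : (((n : ℕ) : K) * wt n) • (MvPolynomial.X n : PolyOne) ∈ S := by
      rw [← h]
      refine sub_mem (S.nsmul_mem (hq n) n) (sum_mem fun p hp => mul_mem ?_ (by rw [e']; exact hq _))
      obtain ⟨a, b⟩ := p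
      rw [Finset.mem_erase, mem_antidiagonal] at hp
      rcases Nat.eq_zero_or_pos a with rfl | ha
      · rw [coeff_eul, zero_smul]; exact zero_mem S
      · have h1 : a < n := by
          rcases Nat.eq_zero_or_pos b with rfl | hb
          · exact absurd (show (a, 0) = ((n : ℕ), 0) from Prod.ext hp.2 rfl) hp.1
          · have := hp.2; simp only at this; omega
        have h2 := e ⟨a, ha⟩
        rw [PNat.mk_coe] at h2
        rw [h2]
        exact S.smul_mem (ih ⟨a, ha⟩ h1) _
    have hc : ((n : ℕ) : K) * wt n ≠ 0 :=
      mul_ne_zero (Nat.cast_ne_zero.2 n.ne_zero) (one_sub_tParam_pow_ne_zero n.ne_zero)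
    have := S.smul_mem hmem (((n : ℕ) : K) * wt n)⁻¹
    rwa [smul_smul, inv_mul_cancel₀ hc, one_smul] at this

theorem adjoin_qPoly : Algebra.adjoin K (Set.range qPoly) = ⊤ := by
  rw [eq_top_iff, ← MvPolynomial.adjoin_range_X, Algebra.adjoin_le_iff]
  rintro _ ⟨n, rfl⟩
  exact mem_adjoin_qPoly n

/-- The span is stable under every q_k: by `upper_eq`, q_k Q_λ is a combination of functions with at
most λ₁ columns and of such functions with one longer row added. It contains 1, and the q_k generate
the algebra. -/
theorem span_hallQ : Submodule.span K (Set.range hallQ) = ⊤ := by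
  set N := Submodule.span K (Set.range hallQ) with hN
  have h1 : (1 : PolyOne) ∈ N := by
    rw [← hallQ_diagramOf_zero 0]
    exact Submodule.subset_span ⟨_, rfl⟩
  have hJ : ∀ {M L : ℕ} (v : Fock (Fin M)), M < L → hOp (L : ℤ) (hallMap M v) ∈ N := by
    intro M L v hL
    induction v using Finsupp.induction_linear with
    | zero => simp
    | add x y hx hy => rw [map_add, map_add]; exact add_mem hx hy
    | single n c =>
      rw [← mul_one c, ← smul_eq_mul, ← Finsupp.smul_single, map_smul, map_smul, hallMap_single]
      obtain ⟨lam, -, h⟩ := exists_hallQ_eq_hOp (L := L) (by omega)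
        ((rowLen_diagramOf_le n).trans hL.le)
      rw [← h]
      exact Submodule.smul_mem _ _ (Submodule.subset_span ⟨lam, rfl⟩)
  have hJ' : ∀ {M : ℕ} (v : Fock (Fin M)), hallMap M v ∈ N := by
    intro M v
    have : hallMap M v ∈ hallSpan M := by rw [← range_hallMap]; exact ⟨v, rfl⟩
    refine Submodule.span_mono ?_ this
    rintro _ ⟨lam, -, rfl⟩
    exact ⟨lam, rfl⟩
  have hq : ∀ k, ∀ f ∈ N, qPoly k * f ∈ N := by
    intro k f hf
    induction hf using Submodule.span_induction with
    | zero => simp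
    | add x y _ _ hx hy => rw [mul_add]; exact add_mem hx hy
    | smul a x _ hx => rw [mul_smul_comm]; exact Submodule.smul_mem _ _ hx
    | mem x hx =>
      obtain ⟨lam, rfl⟩ := hx
      obtain ⟨n, hn⟩ := exists_diagramOf_eq (le_refl (lam.rowLen 0))
      have h := (isRealization_hallMap (lam.rowLen 0)).upper_eq (Finsupp.single n 1) k
      rw [hallMap_single, hn] at h
      change qPoly k * hallQ lam = _ at h
      rw [h]
      exact add_mem (hJ' _) (Submodule.sum_mem _ fun p _ => hJ _ (by omega))
  rw [eq_top_iff]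
  rintro f -
  have hf : f ∈ Algebra.adjoin K (Set.range qPoly) := by rw [adjoin_qPoly]; trivial
  have : ∀ g ∈ N, f * g ∈ N := by
    induction hf using Algebra.adjoin_induction with
    | mem x hx => obtain ⟨k, rfl⟩ := hx; exact hq k
    | algebraMap r => intro g hg; rw [← Algebra.smul_def]; exact Submodule.smul_mem _ _ hg
    | add x y _ _ hx hy => intro g hg; rw [add_mul]; exact add_mem (hx g hg) (hy g hg)
    | mul x y _ _ hx hy => intro g hg; rw [mul_assoc]; exact hx _ (hy g hg)
  simpa using this 1 h1

/-- The basis of Hall-Littlewood functions. -/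
def hallBasis : Module.Basis YoungDiagram K PolyOne :=
  .mk linearIndependent_hallQ span_hallQ.ge

theorem hallBasis_apply (lam : YoungDiagram) : hallBasis lam = hallQ lam := by
  simp [hallBasis]

end

end CoupledHL

namespace CoupledHL

noncomputable section

open PowerSeries
open Finset.HasAntidiagonal (antidiagonal mem_antidiagonal)

/-! ### The Hall-Littlewood scalar product -/

/-- The scalar product for which `(Q_λ, Q_μ) = b_λ δ_{λμ}`. -/
def hallForm : LinearMap.BilinForm K PolyOne :=
  hallBasis.constr K fun lam => bNorm lam • hallBasis.coord lam

theorem isHallForm_iff (s : LinearMap.BilinForm K PolyOne) : IsHallForm s ↔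
    ∀ lam mu : YoungDiagram, (lam = mu → s (hallQ lam) (hallQ mu) = bNorm lam) ∧
      (lam ≠ mu → s (hallQ lam) (hallQ mu) = 0) := by
  refine forall₂_congr fun lam mu => and_congr (imp_congr_right fun _ => ?_)
    (imp_congr_right fun _ => ?_)
  · rw [hallP, map_smul, LinearMap.smul_apply, smul_eq_mul, inv_mul_eq_one₀ (bNorm_ne_zero lam),
      eq_comm]
  · rw [hallP, map_smul, LinearMap.smul_apply, smul_eq_mul, mul_eq_zero,
      or_iff_right (inv_ne_zero (bNorm_ne_zero lam))]

theorem isHallForm_hallForm : IsHallForm hallForm := by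
  rw [isHallForm_iff]
  intro lam mu
  have h : hallForm (hallQ lam) (hallQ mu) = bNorm lam * hallBasis.coord lam (hallBasis mu) := by
    rw [hallForm, ← hallBasis_apply lam, Module.Basis.constr_basis, LinearMap.smul_apply,
      smul_eq_mul, hallBasis_apply]
  rw [h, Module.Basis.coord_apply, Module.Basis.repr_self]
  refine ⟨?_, fun hne => ?_⟩
  · rintro rfl
    rw [Finsupp.single_eq_same, mul_one]
  · rw [Finsupp.single_eq_of_ne hne, mul_zero]

theorem IsHallForm.eq {s s' : LinearMap.BilinForm K PolyOne} (h : IsHallForm s)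
    (h' : IsHallForm s') : s = s' := by
  rw [isHallForm_iff] at h h'
  refine hallBasis.ext fun lam => hallBasis.ext fun mu => ?_
  rw [hallBasis_apply, hallBasis_apply]
  rcases eq_or_ne lam mu with e | e
  · rw [(h lam mu).1 e, (h' lam mu).1 e]
  · rw [(h lam mu).2 e, (h' lam mu).2 e]

namespace IsHallForm

variable {s : LinearMap.BilinForm K PolyOne} (h : IsHallForm s)
include h

open scoped Classical in
theorem apply_hallQ (lam mu : YoungDiagram) :
    s (hallQ lam) (hallQ mu) = if lam = mu then bNorm lam else 0 := by
  rw [isHallForm_iff] at h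
  split_ifs with e
  · exact (h lam mu).1 e
  · exact (h lam mu).2 e

/-- Nondegeneracy, from b_λ ≠ 0; it makes adjoints unique. -/
theorem eq_of_forall {f g : PolyOne} (hfg : ∀ a, s a f = s a g) : f = g := by
  have e : ∀ lam x, s (hallQ lam) x = bNorm lam * hallBasis.coord lam x := by
    intro lam x
    rw [h.eq isHallForm_hallForm, hallForm, ← hallBasis_apply lam, Module.Basis.constr_basis,
      LinearMap.smul_apply, smul_eq_mul]
  refine hallBasis.ext_elem fun lam => ?_
  have := hfg (hallQ lam)
  rw [e, e] at this
  exact mul_left_cancel₀ (bNorm_ne_zero lam) this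

/-- The scalar product makes `B†` and `(1 - t) B` adjoint. -/
theorem creat_lower {M : ℕ} (i : Fin M) (v w : Fock (Fin M)) :
    s (hallMap M (creat i v)) (hallMap M w) = s (hallMap M v) (hallMap M (lower i w)) := by
  have e : s.compl₁₂ (hallMap M ∘ₗ creat i) (hallMap M) =
      s.compl₁₂ (hallMap M) (hallMap M ∘ₗ lower i) := by
    refine Finsupp.lhom_ext' fun n => LinearMap.ext_ring (Finsupp.lhom_ext' fun n' =>
      LinearMap.ext_ring ?_)
    simp only [LinearMap.comp_apply, LinearMap.compl₁₂_apply, Finsupp.lsingle_apply, creat_single,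
      lower_single, one_mul]
    rw [show ∀ c : K, (Finsupp.single (Function.update n' i (n' i - 1)) c : Fock (Fin M)) =
      c • Finsupp.single (Function.update n' i (n' i - 1)) 1 by simp, map_smul, hallMap_single,
      hallMap_single, hallMap_single, hallMap_single, map_smul, h.apply_hallQ, h.apply_hallQ,
      smul_eq_mul]
    simp only [(diagramOf_injective M).eq_iff]
    -- One more row of length i + 1 multiplies b by 1 − t^{n_i + 1}, which is the matrix element of
    -- (1−t)B on the enlarged vector.
    by_cases hn : Function.update n i (n i + 1) = n'
    · subst hn
      rw [if_pos rfl, Function.update_self, Nat.add_sub_cancel, Function.update_idem,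
        Function.update_eq_self, if_pos rfl, bNorm_diagramOf, bNorm_diagramOf,
        ← Finset.mul_prod_erase _ _ (Finset.mem_univ i), ← Finset.mul_prod_erase _
        (fun i => ∏ j ∈ Finset.range (n i), (1 - tParam ^ (j + 1))) (Finset.mem_univ i),
        Function.update_self, Finset.prod_range_succ, mul_comm (∏ j ∈ Finset.range (n i), _) (_ - _),
        mul_assoc]
      congr 2
      refine Finset.prod_congr rfl fun j hj => ?_
      rw [Function.update_of_ne (Finset.ne_of_mem_erase hj)]
    · rw [if_neg hn]
      split_ifs with h2
      · have h3 : n' i = 0 := by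
          by_contra h3
          refine hn ?_
          rw [h2, Function.update_self, Function.update_idem, Nat.sub_add_cancel (by omega),
            Function.update_eq_self]
        rw [h3, pow_zero, sub_self, zero_mul]
      · rw [mul_zero]
  exact LinearMap.congr_fun₂ e v w

theorem upSeq_dnSeq {M : ℕ} (j : ℕ) (v w : Fock (Fin M)) :
    s (hallMap M (upSeq id j v)) (hallMap M w) = s (hallMap M v) (hallMap M (dnSeq id j w)) := by
  unfold upSeq dnSeq
  split_ifs with hj
  · exact h.creat_lower _ v w
  · simp

theorem dnSeq_upSeq {M : ℕ} (j : ℕ) (v w : Fock (Fin M)) :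
    s (hallMap M (dnSeq id j v)) (hallMap M w) = s (hallMap M v) (hallMap M (upSeq id j w)) := by
  have hsymm : ∀ f g, s f g = s g f := by
    intro f g
    have : s = s.flip := by
      refine h.eq ((isHallForm_iff _).2 fun lam mu => ⟨?_, fun hne => ?_⟩)
      · rintro rfl
        rw [show s.flip (hallQ lam) (hallQ lam) = s (hallQ lam) (hallQ lam) from rfl, h.apply_hallQ,
          if_pos rfl]
      · rw [show s.flip (hallQ lam) (hallQ mu) = s (hallQ mu) (hallQ lam) from rfl, h.apply_hallQ,
          if_neg hne.symm]
    conv_lhs => rw [this]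
    rfl
  rw [hsymm, ← h.upSeq_dnSeq, hsymm]

/-- The entries of the monodromy matrix are pairwise adjoint. -/
theorem monodromy_adjoint {M : ℕ} (m k : ℕ) (v w : Fock (Fin M)) :
    s (hallMap M (coeff k (bSeries id m) v)) (hallMap M w) =
        s (hallMap M v) (hallMap M (coeff k (cSeries id m) w)) ∧
      s (hallMap M (coeff k (dSeries id m) v)) (hallMap M w) =
        s (hallMap M v) (hallMap M (coeff k (aSeries id m) w)) := by
  have hr := isRealization_hallMap M
  induction m generalizing k v w with
  | zero =>
    simp only [bSeries, cSeries, dSeries, aSeries, chain, coeff_one, coeff_X]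
    constructor <;> split_ifs <;> simp
  | succ m ih =>
    have hb : bSeries (id : Fin M → Fin M) (m + 1) = bSeries id m + C (upSeq id m) * dSeries id m := rfl
    have hd : dSeries (id : Fin M → Fin M) (m + 1) =
      X * (dSeries id m + C (dnSeq id m) * bSeries id m) := rfl
    have hc : cSeries (id : Fin M → Fin M) (m + 1) = cSeries id m + C (dnSeq id m) * aSeries id m := rfl
    have ha : aSeries (id : Fin M → Fin M) (m + 1) =
      X * (aSeries id m + C (upSeq id m) * cSeries id m) := rfl
    -- Taking adjoints reverses products. The order is restored because the operators of site m
    -- commute with the entries built from earlier sites.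
    have hup : ∀ k, Commute (upSeq (id : Fin M → Fin M) m) (coeff k (cSeries id m)) := fun k => by
      simpa using (hr.commute_up (m := m) 1 k).2.1
    have hdn : ∀ k, Commute (dnSeq (id : Fin M → Fin M) m) (coeff k (aSeries id m)) := fun k =>
      (hr.commute_dn le_rfl k).1.1
    refine ⟨?_, ?_⟩
    · rw [hb, hc, map_add, map_add, coeff_C_mul, coeff_C_mul, (hdn k).eq]
      simp only [LinearMap.add_apply, map_add, Module.End.mul_apply]
      rw [(ih k v w).1, h.upSeq_dnSeq, (ih k v _).2]
    · rw [hd, ha]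
      rcases k with _ | k
      · rw [coeff_zero_X_mul, coeff_zero_X_mul]; simp
      · rw [coeff_succ_X_mul, coeff_succ_X_mul, map_add, map_add, coeff_C_mul, coeff_C_mul,
          (hup k).eq]
        simp only [LinearMap.add_apply, map_add, Module.End.mul_apply]
        rw [(ih k v w).2, h.dnSeq_upSeq, (ih k v _).1]

/-- H_L adds a row of length L > M, and distinct Hall-Littlewood functions are orthogonal. This
disposes of the correction term of `upper_eq`. -/
theorem hOp_hallMap_eq_zero {M L : ℕ} (hL : M < L) (v w : Fock (Fin M)) :
    s (hOp (L : ℤ) (hallMap M v)) (hallMap M w) = 0 := by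
  have e : s.compl₁₂ (hOp (L : ℤ) ∘ₗ hallMap M) (hallMap M) = 0 := by
    refine Finsupp.lhom_ext' fun n => LinearMap.ext_ring (Finsupp.lhom_ext' fun n' =>
      LinearMap.ext_ring ?_)
    simp only [LinearMap.comp_apply, LinearMap.compl₁₂_apply, Finsupp.lsingle_apply, hallMap_single,
      LinearMap.zero_apply]
    obtain ⟨lam, hlam, hQ⟩ := exists_hallQ_eq_hOp (L := L) (by omega)
      ((rowLen_diagramOf_le n).trans hL.le)
    rw [← hQ, h.apply_hallQ, if_neg]
    rintro rfl
    have := rowLen_diagramOf_le n'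
    omega
  exact LinearMap.congr_fun₂ e v w

/-- The adjoint of multiplication by `q_k` is a coefficient of `exp (ξ(∂̃, w))`. -/
theorem isPerp_dPlus (k : ℕ) : IsPerp s k (coeff k dPlus) := by
  have e : s.compl₁₂ (mulOp (qPoly k)) LinearMap.id = s.compl₁₂ LinearMap.id (coeff k dPlus) := by
    refine hallBasis.ext fun lam => hallBasis.ext fun mu => ?_
    simp only [LinearMap.compl₁₂_apply, LinearMap.id_apply, hallBasis_apply]
    -- Both diagrams are placed in one chain of M sites. There q_k is B̃ plus a correction
    -- orthogonal to Q_μ, the adjoint of B̃ is C̃, and C̃ is D⁺.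
    obtain ⟨M, h₁, h₂⟩ : ∃ M, lam.rowLen 0 ≤ M ∧ mu.rowLen 0 ≤ M :=
      ⟨_, le_max_left _ _, le_max_right _ _⟩
    obtain ⟨n, rfl⟩ := exists_diagramOf_eq h₁
    obtain ⟨n', rfl⟩ := exists_diagramOf_eq h₂
    have hup := (isRealization_hallMap M).upper_eq (Finsupp.single n 1) k
    have hlow := (isRealization_hallMap M).lower_eq (Finsupp.single n' 1) k
    rw [AlgHom.id_apply] at hup hlow
    rw [← hallMap_single, ← hallMap_single, hup, ← hlow, map_add, LinearMap.add_apply,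
      (h.monodromy_adjoint M k _ _).1, map_sum, LinearMap.sum_apply, Finset.sum_eq_zero, add_zero]
    exact fun p _ => h.hOp_hallMap_eq_zero (by omega) _ _
  exact fun f g => LinearMap.congr_fun₂ e f g

theorem isPerp_iff (k : ℕ) (S : Module.End K PolyOne) : IsPerp s k S ↔ S = coeff k dPlus := by
  refine ⟨fun hS => LinearMap.ext fun g => h.eq_of_forall fun a => ?_, ?_⟩
  · rw [← hS a g, h.isPerp_dPlus k a g]
  · rintro rfl
    exact h.isPerp_dPlus k

end IsHallForm

/-- Λ_M is the image of the Fock space of M sites, on which D⁺ is realised by C̃. -/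
theorem dPlus_mem_hallSpan (k M : ℕ) {f : PolyOne} (hf : f ∈ hallSpan M) :
    coeff k dPlus f ∈ hallSpan M := by
  rw [← range_hallMap] at hf ⊢
  obtain ⟨v, rfl⟩ := hf
  exact ⟨_, (isRealization_hallMap M).lower_eq v k⟩

/-! ### The two chains -/

/-- The basis of coupled Hall-Littlewood functions. -/
def coupledBasis : Module.Basis (YoungDiagram × YoungDiagram) K PolyTwo :=
  (hallBasis.tensorProduct hallBasis).map crossEquiv

theorem coupledBasis_apply (lam mu : YoungDiagram) :
    coupledBasis (lam, mu) = coupledQ lam mu := by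
  rw [coupledBasis, Module.Basis.map_apply, Module.Basis.tensorProduct_apply, hallBasis_apply,
    hallBasis_apply, crossEquiv_tmul, coupledQ_eq]

theorem jmath_single {M₁ M₂ : ℕ} (n : Fin M₁ ⊕ Fin M₂ → ℕ) :
    jmath M₁ M₂ (Finsupp.single n 1) =
      atX (hallQ (diagramOf fun i => n (Sum.inl i)))
        (atY (hallQ (diagramOf fun i => n (Sum.inr i))) 1) := by
  rw [jmath, Finsupp.linearCombination_single, one_smul, coupledQ_eq]

theorem jmath_injective (M₁ M₂ : ℕ) : Function.Injective (jmath M₁ M₂) := by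
  have h := coupledBasis.linearIndependent.comp (fun n : Fin M₁ ⊕ Fin M₂ → ℕ =>
    (diagramOf fun i => n (Sum.inl i), diagramOf fun i => n (Sum.inr i))) (fun n n' h => by
      have h1 := diagramOf_injective _ (Prod.ext_iff.1 h).1
      have h2 := diagramOf_injective _ (Prod.ext_iff.1 h).2
      funext i
      rcases i with i | i
      · exact congrFun h1 i
      · exact congrFun h2 i)
  have e : (coupledBasis ∘ fun n : Fin M₁ ⊕ Fin M₂ → ℕ =>
      (diagramOf fun i => n (Sum.inl i), diagramOf fun i => n (Sum.inr i))) =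
      fun n => coupledQ (diagramOf fun i => n (Sum.inl i)) (diagramOf fun i => n (Sum.inr i)) :=
    funext fun n => coupledBasis_apply _ _
  rw [e] at h
  exact h

theorem exists_single_eq {M₁ M₂ : ℕ} {lam mu : YoungDiagram} (h₁ : lam.rowLen 0 ≤ M₁)
    (h₂ : mu.rowLen 0 ≤ M₂) : ∃ n : Fin M₁ ⊕ Fin M₂ → ℕ,
      (diagramOf fun i => n (Sum.inl i)) = lam ∧ (diagramOf fun i => n (Sum.inr i)) = mu := by
  obtain ⟨n₁, rfl⟩ := exists_diagramOf_eq h₁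
  obtain ⟨n₂, rfl⟩ := exists_diagramOf_eq h₂
  exact ⟨Sum.elim n₁ n₂, rfl, rfl⟩

theorem range_jmath (M₁ M₂ : ℕ) : LinearMap.range (jmath M₁ M₂) = coupledSpan M₁ M₂ := by
  rw [jmath, Finsupp.range_linearCombination, coupledSpan]
  congr 1
  ext f
  constructor
  · rintro ⟨n, rfl⟩
    exact ⟨_, _, rowLen_diagramOf_le _, rowLen_diagramOf_le _, rfl⟩
  · rintro ⟨lam, mu, h₁, h₂, rfl⟩
    obtain ⟨n, rfl, rfl⟩ := exists_single_eq h₁ h₂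
    exact ⟨n, rfl⟩

/-- `rhoX` acts on the first tensor factor only, so the second chain is a spectator and the claim is
that of the single chain. -/
theorem isRealization_jmath_inl (M₁ M₂ : ℕ) :
    IsRealization (Sum.inl : Fin M₁ → Fin M₁ ⊕ Fin M₂) rhoX (jmath M₁ M₂) := by
  refine .of_single Sum.inl_injective (fun n hn S S' h => ?_) fun i n hn => ?_
  · have : (fun i => n (Sum.inl i)) = 0 := funext hn
    rw [jmath_single, this, hallQ_diagramOf_zero, rhoX_cross, rhoX_cross, h]
  · rw [jmath_single, jmath_single, rhoX_cross, ← hallQ_diagramOf_update _ i hn]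
    have e₁ : (fun a => Function.update n (Sum.inl i) (n (Sum.inl i) + 1) (Sum.inl a)) =
        Function.update (fun a => n (Sum.inl a)) i (n (Sum.inl i) + 1) := by
      funext a
      rcases eq_or_ne a i with rfl | ha
      · rw [Function.update_self, Function.update_self]
      · rw [Function.update_of_ne ha, Function.update_of_ne fun h => ha (Sum.inl_injective h)]
    have e₂ : (fun a => Function.update n (Sum.inl i) (n (Sum.inl i) + 1) (Sum.inr a)) =
        fun a => n (Sum.inr a) := by
      funext a
      rw [Function.update_of_ne (by simp)]
    rw [e₁, e₂]

theorem isRealization_jmath_inr (M₁ M₂ : ℕ) :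
    IsRealization (Sum.inr : Fin M₂ → Fin M₁ ⊕ Fin M₂) rhoY (jmath M₁ M₂) := by
  refine .of_single Sum.inr_injective (fun n hn S S' h => ?_) fun i n hn => ?_
  · have : (fun i => n (Sum.inr i)) = 0 := funext hn
    rw [jmath_single, this, hallQ_diagramOf_zero, rhoY_cross, rhoY_cross, h]
  · rw [jmath_single, jmath_single, rhoY_cross, ← hallQ_diagramOf_update _ i hn]
    have e₁ : (fun a => Function.update n (Sum.inr i) (n (Sum.inr i) + 1) (Sum.inr a)) =
        Function.update (fun a => n (Sum.inr a)) i (n (Sum.inr i) + 1) := by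
      funext a
      rcases eq_or_ne a i with rfl | ha
      · rw [Function.update_self, Function.update_self]
      · rw [Function.update_of_ne ha, Function.update_of_ne fun h => ha (Sum.inr_injective h)]
    have e₂ : (fun a => Function.update n (Sum.inr i) (n (Sum.inr i) + 1) (Sum.inl a)) =
        fun a => n (Sum.inl a) := by
      funext a
      rw [Function.update_of_ne (by simp)]
    rw [e₁, e₂]

/-! ### Finite chains -/

theorem coeff_truncSum (U : ℕ → Module.End K PolyTwo) (M : ℕ) (n : ℤ) :
    (truncSum U M).coeff n =
      coeffAtPow (PowerSeries.mk fun k => if k ≤ M then U k else 0) (-2) n := by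
  have h : ∀ k : ℕ, (LaurentPolynomial.T (-2 * (k : ℤ)) * LaurentPolynomial.C (U k) :
      (Module.End K PolyTwo)[T;T⁻¹]).coeff n = if n = -2 * (k : ℤ) then U k else 0 := fun k => by
    rw [laurent_coeff_T_mul, LaurentPolynomial.C_apply]
    exact if_congr sub_eq_zero rfl rfl
  rw [truncSum, AddMonoidAlgebra.coeff_sum, Finsupp.finsetSum_apply]
  simp only [h]
  unfold coeffAtPow
  split_ifs with hn
  · obtain ⟨⟨a, rfl⟩, ha⟩ := hn
    rw [Int.mul_ediv_cancel_left _ (by norm_num)] at ha ⊢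
    obtain ⟨a, rfl⟩ := Int.eq_ofNat_of_zero_le ha
    rw [coeff_mk, Int.toNat_natCast]
    split_ifs with haM
    · rw [Finset.sum_eq_single a (fun b _ hb => if_neg (by omega))
        (fun h' => absurd (Finset.mem_range.2 (by omega)) h'), if_pos rfl]
    · exact Finset.sum_eq_zero fun b hb => if_neg (by have := Finset.mem_range.1 hb; omega)
  · refine Finset.sum_eq_zero fun b _ => if_neg ?_
    rintro rfl
    exact hn ⟨dvd_mul_right _ _, by rw [Int.mul_ediv_cancel_left _ (by norm_num)]; omega⟩

theorem coeffAtPow_apply {V W : Type*} [AddCommGroup V] [Module K V] [AddCommGroup W]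
    [Module K W] (J : V →ₗ[K] W) {F : PowerSeries (Module.End K V)}
    {G : PowerSeries (Module.End K W)} {v : V} {d n : ℤ}
    (h : J (coeff (n / d).toNat F v) = coeff (n / d).toNat G (J v)) :
    J (coeffAtPow F d n v) = coeffAtPow G d n (J v) := by
  unfold coeffAtPow
  split_ifs
  · exact h
  · simp

/-- The truncation at k = M on the right agrees with the fact that C̃ has no coefficient beyond
degree M. -/
theorem IsRealization.acts {ι : Type} [DecidableEq ι] {M : ℕ} {site : Fin M → ι}
    {ρ : Module.End K PolyOne →ₐ[K] Module.End K PolyTwo} {J : Fock ι →ₗ[K] PolyTwo}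
    (h : IsRealization site ρ J) {U : ℕ → Module.End K PolyTwo}
    (hU : ∀ k, U k = ρ (coeff k dPlus)) (v : Fock ι) (n : ℤ) :
    J (coeffAtPow (cSeries site M) (-2) n v) = (truncSum U M).coeff n (J v) := by
  rw [coeff_truncSum]
  refine coeffAtPow_apply J ?_
  rw [coeff_mk]
  split_ifs with hk
  · rw [hU, h.lower_eq]
  · have e : ∀ k, M < k → coeff k (cSeries site M) = 0 := (coeff_chain_eq_zero _ _ M).1
    rw [e _ (not_le.1 hk), LinearMap.zero_apply, map_zero, LinearMap.zero_apply]

/-! ### Infinite chains -/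

/-- The coupled functions form a basis, and thresholds for a sum of two polynomials can be added, so
the limit may be tested on basis elements. -/
theorem limitIs_of_coupledQ {𝒜 : ∀ M₁ M₂ : ℕ, (Module.End K (TwoFock M₁ M₂))[T;T⁻¹]}
    {G : ℤ → Module.End K PolyTwo}
    (h : ∀ (lam mu : YoungDiagram) (n : ℤ), ∃ N : ℕ, ∀ M₁ M₂ : ℕ, N ≤ M₁ → N ≤ M₂ →
      ∃ v : TwoFock M₁ M₂, jmath M₁ M₂ v = coupledQ lam mu ∧
        jmath M₁ M₂ ((𝒜 M₁ M₂).coeff n v) = G n (coupledQ lam mu)) : LimitIs 𝒜 G := by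
  intro f n
  have hf : f ∈ Submodule.span K (Set.range coupledBasis) := by
    rw [coupledBasis.span_eq]; trivial
  induction hf using Submodule.span_induction with
  | mem x hx =>
    obtain ⟨⟨lam, mu⟩, rfl⟩ := hx
    rw [coupledBasis_apply]
    exact h lam mu n
  | zero => exact ⟨0, fun M₁ M₂ _ _ => ⟨0, by simp⟩⟩
  | add x y _ _ hx hy =>
    obtain ⟨N, hN⟩ := hx
    obtain ⟨N', hN'⟩ := hy
    refine ⟨N + N', fun M₁ M₂ h₁ h₂ => ?_⟩
    obtain ⟨v, hv, hv'⟩ := hN M₁ M₂ (by omega) (by omega)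
    obtain ⟨w, hw, hw'⟩ := hN' M₁ M₂ (by omega) (by omega)
    exact ⟨v + w, by rw [map_add, hv, hw], by rw [map_add, map_add, hv', hw', map_add]⟩
  | smul a x _ hx =>
    obtain ⟨N, hN⟩ := hx
    refine ⟨N, fun M₁ M₂ h₁ h₂ => ?_⟩
    obtain ⟨v, hv, hv'⟩ := hN M₁ M₂ h₁ h₂
    exact ⟨a • v, by rw [map_smul, hv], by rw [map_smul, map_smul, hv', map_smul]⟩

theorem eq_zero_of_rowLen_le {M : ℕ} (n : Fin M → ℕ) (j : Fin M)
    (h : (diagramOf n).rowLen 0 ≤ j) : n j = 0 := by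
  by_contra h0
  have h1 : (j : ℕ) + 1 ∈ (diagramOf n).rowLens := by
    rw [← Multiset.mem_coe, coe_rowLens_diagramOf]
    exact (mem_partsOf n _).2 ⟨j, h0, rfl⟩
  have := (rowLen_zero_le_iff _ _).1 h _ h1
  omega

/-- L bounds the columns of both diagrams, so the sites from L on are empty; `N n` is the number of
further empty sites that the coefficient of uⁿ requires. -/
theorem limitIs_of_exact {𝒜 : ∀ M₁ M₂ : ℕ, (Module.End K (TwoFock M₁ M₂))[T;T⁻¹]}
    {G : ℤ → Module.End K PolyTwo} (N : ℤ → ℕ)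
    (h : ∀ (n : ℤ) (L M₁ M₂ : ℕ), L + N n ≤ M₁ → L + N n ≤ M₂ → ∀ v : TwoFock M₁ M₂,
      v ∈ vac (Sum.inl : Fin M₁ → _) L → v ∈ vac (Sum.inr : Fin M₂ → _) L →
        jmath M₁ M₂ ((𝒜 M₁ M₂).coeff n v) = G n (jmath M₁ M₂ v)) : LimitIs 𝒜 G := by
  refine limitIs_of_coupledQ fun lam mu n => ⟨lam.rowLen 0 + mu.rowLen 0 + N n,
    fun M₁ M₂ h₁ h₂ => ?_⟩
  obtain ⟨a, ha₁, ha₂⟩ := exists_single_eq (lam := lam) (mu := mu) (M₁ := M₁) (M₂ := M₂) (by omega)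
    (by omega)
  have hJ : jmath M₁ M₂ (Finsupp.single a 1) = coupledQ lam mu := by
    rw [jmath_single, ha₁, ha₂, coupledQ_eq]
  refine ⟨Finsupp.single a 1, hJ, ?_⟩
  rw [← hJ]
  refine h n (lam.rowLen 0 + mu.rowLen 0) M₁ M₂ h₁ h₂ _ (single_mem_vac _ (fun j hj => ?_) 1)
    (single_mem_vac _ (fun j hj => ?_) 1)
  · exact eq_zero_of_rowLen_le (fun i => a (Sum.inl i)) j (by rw [ha₁]; omega)
  · exact eq_zero_of_rowLen_le (fun i => a (Sum.inr i)) j (by rw [ha₂]; omega)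

theorem limitIs_bTilde₁ : LimitIs bTilde₁ (coeffAtPow gammaMinus₁ 2) := by
  -- The coefficient of uⁿ has degree k = n/2 in u², and the correction vanishes as soon as k + L <
  -- M₁.
  refine limitIs_of_exact (fun n => (n / 2).toNat + 1) fun n L M₁ M₂ h₁ h₂ v hv _ => ?_
  have e : (bTilde₁ M₁ M₂).coeff n = coeffAtPow (bSeries Sum.inl M₁) 2 n :=
    coeff_T_mul_monodromy_upper _ n
  rw [e]
  refine coeffAtPow_apply _ ?_
  rw [coeff_gammaMinus₁]
  exact (isRealization_jmath_inl M₁ M₂).upper_eq_of_lt (by omega) hv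

theorem limitIs_bTilde₂ : LimitIs bTilde₂ (coeffAtPow gammaMinus₂ 2) := by
  refine limitIs_of_exact (fun n => (n / 2).toNat + 1) fun n L M₁ M₂ h₁ h₂ v _ hv => ?_
  have e : (bTilde₂ M₁ M₂).coeff n = coeffAtPow (bSeries Sum.inr M₂) 2 n :=
    coeff_T_mul_monodromy_upper _ n
  rw [e]
  refine coeffAtPow_apply _ ?_
  rw [coeff_gammaMinus₂]
  exact (isRealization_jmath_inr M₁ M₂).upper_eq_of_lt (by omega) hv

theorem coeff_cTilde₁ (M₁ M₂ : ℕ) (n : ℤ) :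
    (cTilde₁ M₁ M₂).coeff n = coeffAtPow (cSeries Sum.inl M₁) (-2) n :=
  coeff_T_mul_monodromy_lower _ n

theorem coeff_cTilde₂ (M₁ M₂ : ℕ) (n : ℤ) :
    (cTilde₂ M₁ M₂).coeff n = coeffAtPow (cSeries Sum.inr M₂) (-2) n :=
  coeff_T_mul_monodromy_lower _ n

/-- No slack is needed: C̃ acts by D⁺ exactly on the image of every finite chain, so the limit only
enlarges the domain. -/
theorem limitIs_cTilde₁ : LimitIs cTilde₁ (coeffAtPow gammaPlus₁ (-2)) := by
  refine limitIs_of_exact (fun _ => 0) fun n L M₁ M₂ _ _ v _ _ => ?_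
  rw [coeff_cTilde₁]
  refine coeffAtPow_apply _ ?_
  rw [coeff_gammaPlus₁, (isRealization_jmath_inl M₁ M₂).lower_eq]

theorem limitIs_cTilde₂ : LimitIs cTilde₂ (coeffAtPow gammaPlus₂ (-2)) := by
  refine limitIs_of_exact (fun _ => 0) fun n L M₁ M₂ _ _ v _ _ => ?_
  rw [coeff_cTilde₂]
  refine coeffAtPow_apply _ ?_
  rw [coeff_gammaPlus₂, (isRealization_jmath_inr M₁ M₂).lower_eq]

end

end CoupledHL

/-! ### Assembly of the main theorem. -/

theorem mainTheorem6 :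
    -- the Hall-Littlewood scalar product is well defined
    (∃! s : LinearMap.BilinForm K PolyOne, IsHallForm s) ∧
    -- the map from the Fock space is an isomorphism onto the space of coupled functions
    (∀ M₁ M₂ : ℕ, Function.Injective (jmath M₁ M₂) ∧
      LinearMap.range (jmath M₁ M₂) = coupledSpan M₁ M₂) ∧
    -- the adjoints of multiplication by `q_k` exist, are unique, and preserve `Λ_M`
    (∀ s : LinearMap.BilinForm K PolyOne, IsHallForm s → ∀ k : ℕ,
      ∃! S : Module.End K PolyOne, IsPerp s k S) ∧
    (∀ s : LinearMap.BilinForm K PolyOne, IsHallForm s →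
      ∀ (k : ℕ) (S : Module.End K PolyOne), IsPerp s k S →
        (∀ M : ℕ, ∀ f ∈ hallSpan M, S f ∈ hallSpan M) ∧
        (∃! U : Module.End K PolyTwo, IsSubstX S U) ∧
        (∃! U : Module.End K PolyTwo, IsSubstY S U)) ∧
    -- the annihilation operators
    (∀ s : LinearMap.BilinForm K PolyOne, IsHallForm s →
      ∀ qperp : ℕ → Module.End K PolyOne, (∀ k, IsPerp s k (qperp k)) →
      ∀ U V : ℕ → Module.End K PolyTwo,
        (∀ k, IsSubstX (qperp k) (U k)) → (∀ k, IsSubstY (qperp k) (V k)) →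
        ∀ M₁ M₂ : ℕ,
          ActsAs (cTilde₁ M₁ M₂) (truncSum U M₁) ∧
          ActsAs (cTilde₂ M₁ M₂) (truncSum V M₂)) ∧
    -- the limit of infinitely many sites
    LimitIs bTilde₁ (coeffAtPow gammaMinus₁ 2) ∧
    LimitIs cTilde₁ (coeffAtPow gammaPlus₁ (-2)) ∧
    LimitIs bTilde₂ (coeffAtPow gammaMinus₂ 2) ∧
    LimitIs cTilde₂ (coeffAtPow gammaPlus₂ (-2)) := by
  -- Every adjoint of multiplication by q_k is the explicit coefficient of D⁺; this turns the
  -- statements quantified over forms and adjoints into statements about one operator.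
  have hperp : ∀ s : LinearMap.BilinForm K PolyOne, IsHallForm s →
      ∀ (k : ℕ) (S : Module.End K PolyOne), IsPerp s k S → S = PowerSeries.coeff k dPlus :=
    fun s hs k S => (hs.isPerp_iff k S).1
  refine ⟨⟨hallForm, isHallForm_hallForm, fun s hs => hs.eq isHallForm_hallForm⟩,
    fun M₁ M₂ => ⟨jmath_injective M₁ M₂, range_jmath M₁ M₂⟩,
    fun s hs k => ⟨PowerSeries.coeff k dPlus, hs.isPerp_dPlus k, hperp s hs k⟩, ?_, ?_,
    limitIs_bTilde₁, limitIs_cTilde₁, limitIs_bTilde₂, limitIs_cTilde₂⟩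
  · intro s hs k S hS
    refine ⟨fun M f hf => ?_, ⟨rhoX S, (isSubstX_iff S _).2 rfl, fun U => (isSubstX_iff S U).1⟩,
      ⟨rhoY S, (isSubstY_iff S _).2 rfl, fun U => (isSubstY_iff S U).1⟩⟩
    rw [hperp s hs k S hS]
    exact dPlus_mem_hallSpan k M hf
  · intro s hs qperp hq U V hU hV M₁ M₂
    refine ⟨fun v n => ?_, fun v n => ?_⟩
    · rw [coeff_cTilde₁]
      exact (isRealization_jmath_inl M₁ M₂).acts (fun k => by
        rw [(isSubstX_iff _ _).1 (hU k), hperp s hs k _ (hq k)]) v n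
    · rw [coeff_cTilde₂]
      exact (isRealization_jmath_inr M₁ M₂).acts (fun k => by
        rw [(isSubstY_iff _ _).1 (hV k), hperp s hs k _ (hq k)]) v n
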